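/- **Syntax.** Types are generated from $\iota$ (individuals), $o$ (truth values), $\epsilon$ (constructions) by $(\alpha\to\beta)$. For each type $\alpha$ there are denumerably many variables $f_\alpha,g_\alpha,h_\alpha,p_\alpha,u_\alpha,v_\alpha,w_\alpha,x_\alpha,y_\alpha,z_\alpha,\dots$, and a set of constants; these include the *logical constants* $=_{\alpha\to\alpha\to o}$, $\text{is-var}_{\epsilon\to o}$, $\text{is-var}^\alpha_{\epsilon\to o}$, $\text{is-con}_{\epsilon\to o}$, $\text{is-con}^\alpha_{\epsilon\to o}$, $\text{app}_{\epsilon\to\epsilon\to\epsilon}$, $\text{abs}_{\epsilon\to\epsilon\to\epsilon}$, $\text{quo}_{\epsilon\to\epsilon}$, $\text{is-expr}_{\epsilon\to o}$, $\text{is-expr}^\alpha_{\epsilon\to o}$, $\sqsubset_{\epsilon\to\epsilon\to o}$, $\text{is-free-in}_{\epsilon\to\epsilon\to o}$ (for all types $\alpha$). Expressions are: variables, constants, applications $F_{\alpha\to\beta}A_\alpha$, abstractions $\lambda\mathbf x_\alpha.B_\beta$, quotations $\ulcorner A_\alpha\urcorner$ of type $\epsilon$ for eval-free $A_\alpha$,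 and evaluations $[\![A_\epsilon]\!]_\beta$ of type $\beta$; an expression is *eval-free* if it is built without evaluations. A *formula* is an expression of type $o$. In an eval-free expression, occurrences of a variable inside a quotation are neither free nor bound; otherwise "free" is as usual. A *construction* is an expression built from quotations $\ulcorner\mathbf x_\alpha\urcorner$, $\ulcorner\mathbf c_\alpha\urcorner$ of variables and constants by $\text{app}$, $\text{abs}$, $\text{quo}$. Abbreviations: $A=B$ is $=AB$ (written $\equiv$ for formulas); $T_o$ is $(=_{o\to o\to o})=(=_{o\to o\to o})$; $F_o$ is $(\lambda x_o.T_o)=(\lambda x_o.x_o)$; $\forall\mathbf x_\alpha.A$ is $(\lambda\mathbf x_\alpha.T_o)=(\lambda\mathbf x_\alpha.A)$; $\wedge$ is $\lambda x_o.\lambda y_o.((\lambda g_{o\to o\to o}.g\,T_o\,T_o)=(\lambda g_{o\to o\to o}.g\,x_o\,y_o))$; $\supset$ is $\lambda x_o.\lambda y_o.(x_o=(x_o\wedge y_o))$; $\neg$ is $=_{o\to o\to o}F_o$; $\vee$ is $\lambda x_o.\lambda y_o.\neg(\neg x_o\wedge\neg y_o)$; $\exists\mathbf x_\alpha.A$ is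 $\neg\forall\mathbf x_\alpha.\neg A$; $A\neq B$ is $\neg(A=B)$; and $\mathrm{EFF}(\mathbf x_\alpha,B_\beta)$ ("$\mathbf x_\alpha$ is effective in $B_\beta$") is $\exists\mathbf y_\alpha.((\lambda\mathbf x_\alpha.B_\beta)\mathbf y_\alpha\neq B_\beta)$ for any variable $\mathbf y_\alpha\neq\mathbf x_\alpha$. **Proof system.** Bold letters $\mathbf x,\mathbf y$ range over variables and $\mathbf c,\mathbf d$ over constants; $x,y,\dots$ are the specific variables; $\alpha,\beta,\gamma$ range over types; unless indicated, $x,y,z,u,v$ have type $\epsilon$ in the B axioms. The axioms are: - A1: $(g_{o\to o}T_o\wedge g_{o\to o}F_o)=\forall x_o.g_{o\to o}x_o$. A2: $x_\alpha=y_\alpha\supset h_{\alpha\to o}x_\alpha=h_{\alpha\to o}y_\alpha$. A3: $(f_{\alpha\to\beta}=g_{\alpha\to\beta})=\forall x_\alpha.(f x_\alpha=g x_\alpha)$. - A4: (1) $(\lambda\mathbf x_\alpha.\mathbf y_\beta)A_\alpha=\mathbf y_\beta$ for distinct $\mathbf x_\alpha,\mathbf y_\beta$; (2) $(\lambda\mathbf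 x_\alpha.\mathbf x_\alpha)A=A$; (3) $(\lambda\mathbf x_\alpha.\mathbf c_\beta)A=\mathbf c_\beta$; (4) $(\lambda\mathbf x_\alpha.BC)A=((\lambda\mathbf x_\alpha.B)A)((\lambda\mathbf x_\alpha.C)A)$; (5) $(\lambda\mathbf x_\alpha.\lambda\mathbf y_\beta.B)A=\lambda\mathbf y_\beta.((\lambda\mathbf x_\alpha.B)A)$ for distinct $\mathbf x_\alpha,\mathbf y_\beta$, if $A$ is eval-free and $\mathbf y_\beta$ not free in $A$, or $B$ is eval-free and $\mathbf x_\alpha$ not free in $B$; (6) $(\lambda\mathbf x_\alpha.\lambda\mathbf x_\alpha.B)A=\lambda\mathbf x_\alpha.B$. - B1: (1) $\text{is-var}^\alpha x\supset\text{is-var}\,x$; (2) $\text{is-var}^\alpha\ulcorner\mathbf x_\alpha\urcorner$; (3) $\neg\,\text{is-var}^\alpha\ulcorner\mathbf x_\beta\urcorner$ if $\alpha\ne\beta$; (4) $\neg\,\text{is-var}\,A$ for constructions $A$ not of the form $\ulcorner\mathbf x_\alpha\urcorner$. B2: the same four with "con" for "var" and $\mathbf c$ for $\mathbf x$ inside the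 quotations. - B3: (1) $\text{is-expr}^\alpha x\supset\text{is-expr}\,x$; (2) $(\text{is-var}^\alpha x\vee\text{is-con}^\alpha x)\supset\text{is-expr}^\alpha x$; (3) $(\text{is-expr}^{\alpha\to\beta}x\wedge\text{is-expr}^\alpha y)\supset\text{is-expr}^\beta(\text{app}\,x\,y)$; (4) $(\text{is-var}^\alpha x\wedge\text{is-expr}^\beta y)\supset\text{is-expr}^{\alpha\to\beta}(\text{abs}\,x\,y)$; (5) $\text{is-expr}\,x\supset\text{is-expr}^\epsilon(\text{quo}\,x)$; (6) $(\text{is-expr}^\alpha x\wedge\text{is-expr}^\beta y)\supset\neg\,\text{is-expr}(\text{app}\,x\,y)$ if $\alpha$ is not of the form $\beta\to\gamma$; (7) $(\neg\,\text{is-expr}\,x\vee\neg\,\text{is-expr}\,y)\supset\neg\,\text{is-expr}(\text{app}\,x\,y)$; (8) $(\neg\,\text{is-var}\,x\vee\neg\,\text{is-expr}\,y)\supset\neg\,\text{is-expr}(\text{abs}\,x\,y)$; (9) $\neg\,\text{is-expr}\,x\supset\neg\,\text{is-expr}(\text{quo}\,x)$. - B4: (1) $\text{is-var}\,x\supset(\neg\,\text{is-con}\,x\wedge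 x\ne\text{app}\,y\,z\wedge x\ne\text{abs}\,y\,z\wedge x\ne\text{quo}\,y)$; (2) $\text{is-con}\,x\supset(\neg\,\text{is-var}\,x\wedge x\ne\text{app}\,y\,z\wedge x\ne\text{abs}\,y\,z\wedge x\ne\text{quo}\,y)$; (3) $x=\text{app}\,y\,z\supset(\neg\,\text{is-var}\,x\wedge\neg\,\text{is-con}\,x\wedge x\ne\text{abs}\,u\,v\wedge x\ne\text{quo}\,u)$; (4) $x=\text{abs}\,y\,z\supset(\neg\,\text{is-var}\,x\wedge\neg\,\text{is-con}\,x\wedge x\ne\text{app}\,u\,v\wedge x\ne\text{quo}\,u)$; (5) $x=\text{quo}\,y\supset(\neg\,\text{is-var}\,x\wedge\neg\,\text{is-con}\,x\wedge x\ne\text{app}\,u\,v\wedge x\ne\text{abs}\,u\,v)$; (6) $\ulcorner\mathbf x_\alpha\urcorner\ne\ulcorner\mathbf y_\beta\urcorner$ for distinct variables; (7) $\ulcorner\mathbf c_\alpha\urcorner\ne\ulcorner\mathbf d_\beta\urcorner$ for distinct constants; (8) $\text{app}\,x\,y=\text{app}\,u\,v\supset(x=u\wedge y=v)$; (9) $\text{abs}\,x\,y=\text{abs}\,u\,v\supset(x=u\wedge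 y=v)$; (10) $\text{quo}\,x=\text{quo}\,u\supset x=u$. - B5: $x\sqsubset\text{app}\,x\,y$; $x\sqsubset\text{app}\,y\,x$; $x\sqsubset\text{abs}\,x\,y$; $x\sqsubset\text{abs}\,y\,x$; $x\sqsubset\text{quo}\,x$; $(x\sqsubset y\wedge y\sqsubset z)\supset x\sqsubset z$. - B6: $\forall u.(\forall v.(v\sqsubset u\supset p_{\epsilon\to o}v)\supset p_{\epsilon\to o}u)\supset\forall u.p_{\epsilon\to o}u$. - B7: (1) $\text{is-var}\,x\supset\text{is-free-in}\,x\,x$; (2) $(\text{is-var}\,x\wedge\text{is-var}\,y\wedge x\ne y)\supset\neg\,\text{is-free-in}\,x\,y$; (3) $(\text{is-var}\,x\wedge\text{is-con}\,y)\supset\neg\,\text{is-free-in}\,x\,y$; (4) $(\text{is-var}\,x\wedge\text{is-expr}(\text{app}\,y\,z))\supset(\text{is-free-in}\,x\,(\text{app}\,y\,z)\equiv(\text{is-free-in}\,x\,y\vee\text{is-free-in}\,x\,z))$; (5) $(\text{is-var}\,x\wedge\text{is-expr}(\text{abs}\,y\,z)\wedge x\ne y)\supset(\text{is-free-in}\,x\,(\text{abs}\,y\,z)\equiv\text{is-free-in}\,x\,z)$;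 (6) $\text{is-expr}(\text{abs}\,x\,y)\supset\neg\,\text{is-free-in}\,x\,(\text{abs}\,x\,y)$; (7) $(\text{is-var}\,x\wedge\text{is-expr}\,y)\supset\neg\,\text{is-free-in}\,x\,(\text{quo}\,y)$; (8) $(\neg\,\text{is-var}\,x\vee\neg\,\text{is-expr}\,y)\supset\neg\,\text{is-free-in}\,x\,y$. - B8: $\ulcorner FA\urcorner=\text{app}\ulcorner F\urcorner\ulcorner A\urcorner$; $\ulcorner\lambda\mathbf x_\alpha.B\urcorner=\text{abs}\ulcorner\mathbf x_\alpha\urcorner\ulcorner B\urcorner$; $\ulcorner\ulcorner A\urcorner\urcorner=\text{quo}\ulcorner A\urcorner$. B9: $(\lambda\mathbf x_\alpha.\ulcorner B_\beta\urcorner)A_\alpha=\ulcorner B_\beta\urcorner$. - B10: (1) $[\![\ulcorner\mathbf x_\alpha\urcorner]\!]_\alpha=\mathbf x_\alpha$; (2) $[\![\ulcorner\mathbf c_\alpha\urcorner]\!]_\alpha=\mathbf c_\alpha$; (3) $(\text{is-expr}^{\alpha\to\beta}A\wedge\text{is-expr}^\alpha B)\supset[\![\text{app}\,A\,B]\!]_\beta=[\![A]\!]_{\alpha\to\beta}[\![B]\!]_\alpha$;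 (4) $(\text{is-expr}^\beta A\wedge\neg\,\text{is-free-in}\ulcorner\mathbf x_\alpha\urcorner\ulcorner A\urcorner)\supset[\![\text{abs}\ulcorner\mathbf x_\alpha\urcorner A]\!]_{\alpha\to\beta}=\lambda\mathbf x_\alpha.[\![A]\!]_\beta$; (5) $\text{is-expr}^\epsilon A\supset[\![\text{quo}\,A]\!]_\epsilon=A$. - B11: (1) $(\lambda\mathbf x_\alpha.[\![B]\!]_\beta)\mathbf x_\alpha=[\![B]\!]_\beta$; (2) $(\text{is-expr}^\beta((\lambda\mathbf x_\alpha.B)A)\wedge\neg\,\text{is-free-in}\ulcorner\mathbf x_\alpha\urcorner((\lambda\mathbf x_\alpha.B)A))\supset(\lambda\mathbf x_\alpha.[\![B]\!]_\beta)A=[\![(\lambda\mathbf x_\alpha.B)A]\!]_\beta$. - B12: $\neg\,\mathrm{EFF}(\mathbf x_\alpha,B)$ if $B$ is eval-free and $\mathbf x_\alpha$ is not free in $B$. - B13: $\bigl(\forall\mathbf y_\beta.\neg\,\mathrm{EFF}(\mathbf y_\beta,A_\alpha)\ \vee\ \forall\mathbf x_\alpha.\forall\mathbf y_\beta.\neg\,\mathrm{EFF}(\mathbf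 x_\alpha,B_\gamma)\bigr)\supset(\lambda\mathbf x_\alpha.\lambda\mathbf y_\beta.B_\gamma)A_\alpha=\lambda\mathbf y_\beta.((\lambda\mathbf x_\alpha.B_\gamma)A_\alpha)$ for distinct $\mathbf x_\alpha,\mathbf y_\beta$. The single rule (Rule R): from $A_\alpha=B_\alpha$ and $C_o$ infer the result of replacing one occurrence of $A_\alpha$ in $C_o$ by $B_\alpha$, where the occurrence is not inside a quotation and is not the variable bound by an abstraction. A *theory* $T=(L_{\mathcal D},\Gamma)$ consists of a set $\mathcal D$ of constants containing all logical constants, which determines the language $L_{\mathcal D}$ of all expressions whose constants (also inside quotations) lie in $\mathcal D$, and a set $\Gamma$ of formulas of $L_{\mathcal D}$. $T\vdash A$ means that $A$ is the last member of a finite sequence of formulas of $L_{\mathcal D}$ each of which is an axiom, a member of $\Gamma$, or inferred from earlier members by Rule R. (Free variables of members of $\Gamma$ thus act as universally quantified.) **Real theories.** Let $T_{\mathbb R}=(L_{\mathcal D},\Gamma)$ be any theory such that $\mathcal D$ contains constants $0_\iota,1_\iota$; $-,{}^{-1}$ of type $\iota\to\iota$; $+,*$ of type $\iota\to\iota\to\iota$;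 $\text{pos}_{\iota\to o}$; $<,\le$ of type $\iota\to\iota\to o$; $\text{ub},\text{lub}$ of type $\iota\to(\iota\to o)\to o$; negation, addition and multiplication of functions $\iota\to\iota$; $\text{is-diff}_{(\iota\to\iota)\to o}$; $\text{deriv}_{(\iota\to\iota)\to(\iota\to\iota)}$; $\text{is-poly}_{\epsilon\to o}$; $\text{poly-diff}_{\epsilon\to\epsilon\to\epsilon}$; and $\Gamma$ contains the following. - Complete ordered field axioms for $\iota$ (with $x,y,z$ of type $\iota$ and $p$ of type $\iota\to o$): associativity and commutativity of $+$ and $*$; $x+0=x$; $x+(-x)=0$; $x*1=x$; $x\ne0\supset x*x^{-1}=1$; $0\ne1$; $x*(y+z)=x*y+x*z$; exactly one of $x=0$, $\text{pos}\,x$, $\text{pos}(-x)$ holds; $(\text{pos}\,x\wedge\text{pos}\,y)\supset\text{pos}(x+y)$ and $(\text{pos}\,x\wedge\text{pos}\,y)\supset\text{pos}(x*y)$; $x<y\equiv\text{pos}(y+(-x))$; $x\le y\equiv(x<y\vee x=y)$; $\text{ub}\,x\,p\equiv\forall y.(p\,y\supset y\le x)$; $\text{lub}\,x\,p\equiv(\text{ub}\,x\,p\wedge\forall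 y.(\text{ub}\,y\,p\supset x\le y))$; $(\exists x.p\,x\wedge\exists x.\text{ub}\,x\,p)\supset\exists x.\text{lub}\,x\,p$. - The pointwise definitions of negation, addition and multiplication of functions; $\text{is-diff}\,f\equiv\forall x.\exists y.D(f,x,y)$; and $\text{is-diff}\,f\supset\forall x.D(f,x,\text{deriv}\,f\,x)$, where $D(f,x,d)$ is the formula $\forall u.(0<u\supset\exists v.(0<v\wedge\forall h.((h\ne0\wedge-v<h\wedge h<v)\supset(-u<q\wedge q<u))))$ with $q:=((f(x+h)+(-(f\,x)))*h^{-1})+(-d)$ and $u,v,h$ of type $\iota$, i.e. $d$ is the limit of the difference quotients of $f$ at $x$. - Writing $\ominus A:=\text{app}\,\ulcorner-\urcorner A$, $A\oplus B:=\text{app}(\text{app}\,\ulcorner+\urcorner A)B$, $A\otimes B:=\text{app}(\text{app}\,\ulcorner*\urcorner A)B$ for the quasiquotations of negation, sum and product on type $\iota$: the recursive definition $$\text{is-poly}=\lambda u_\epsilon.\bigl(u=\ulcorner x_\iota\urcorner\vee u=\ulcorner y_\iota\urcorner\vee u=\ulcorner0_\iota\urcorner\vee u=\ulcorner1_\iota\urcorner\vee\exists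 v_\epsilon.(\text{is-poly}\,v\wedge u=\ominus v)\vee\exists v_\epsilon.\exists w_\epsilon.(\text{is-poly}\,v\wedge\text{is-poly}\,w\wedge u=v\oplus w)\vee\exists v_\epsilon.\exists w_\epsilon.(\text{is-poly}\,v\wedge\text{is-poly}\,w\wedge u=v\otimes w)\bigr)$$ and the six formulas (with $x,y,z$ of type $\epsilon$, $d:=\text{poly-diff}$): $\text{is-var}^\iota x\supset d\,x\,x=\ulcorner1_\iota\urcorner$; $(\text{is-var}^\iota x\wedge\text{is-var}^\iota y\wedge x\ne y)\supset d\,x\,y=\ulcorner0_\iota\urcorner$; $(\text{is-con}^\iota x\wedge\text{is-var}^\iota y)\supset d\,x\,y=\ulcorner0_\iota\urcorner$; $(\text{is-poly}\,x\wedge\text{is-var}^\iota y)\supset d(\ominus x)y=\ominus(d\,x\,y)$; $(\text{is-poly}\,x\wedge\text{is-poly}\,y\wedge\text{is-var}^\iota z)\supset d(x\oplus y)z=(d\,x\,z)\oplus(d\,y\,z)$; $(\text{is-poly}\,x\wedge\text{is-poly}\,y\wedge\text{is-var}^\iota z)\supset d(x\otimes y)z=((d\,x\,z)\otimes y)\oplus(x\otimes(d\,y\,z))$.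 **Theorem (meaning formula for poly-diff).** For every such theory $T_{\mathbb R}$, $$T_{\mathbb R}\vdash\forall u_\epsilon.\bigl(\text{is-poly}\,u_\epsilon\supset\text{deriv}(\lambda\mathbf x_\iota.[\![u_\epsilon]\!]_\iota)=\lambda\mathbf x_\iota.[\![\text{poly-diff}\,u_\epsilon\,\ulcorner\mathbf x_\iota\urcorner]\!]_\iota\bigr),$$ where $\mathbf x_\iota$ is either of the variables $x_\iota$, $y_\iota$. -/

import Mathlib

universe u

namespace CTTqe

/-! ## Types, constants and expressions -/

/-- Types: individuals, truth values, constructions, and function types. -/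
inductive Ty : Type where
  | ind : Ty
  | bool : Ty
  | constr : Ty
  | arr : Ty → Ty → Ty

infixr:60 "⟶ₜ" => Ty.arr

notation "ιₜ" => Ty.ind
notation "oₜ" => Ty.bool
notation "εₜ" => Ty.constr

/-- The nonlogical constants of the theory of the real numbers. -/
inductive RealConst : Ty → Type where
  | zero : RealConst ιₜ
  | one : RealConst ιₜ
  | minus : RealConst (ιₜ ⟶ₜ ιₜ)
  | plus : RealConst (ιₜ ⟶ₜ ιₜ ⟶ₜ ιₜ)
  | times : RealConst (ιₜ ⟶ₜ ιₜ ⟶ₜ ιₜ)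
  | recip : RealConst (ιₜ ⟶ₜ ιₜ)
  | pos : RealConst (ιₜ ⟶ₜ oₜ)
  | less : RealConst (ιₜ ⟶ₜ ιₜ ⟶ₜ oₜ)
  | lesseq : RealConst (ιₜ ⟶ₜ ιₜ ⟶ₜ oₜ)
  | ub : RealConst (ιₜ ⟶ₜ (ιₜ ⟶ₜ oₜ) ⟶ₜ oₜ)
  | lub : RealConst (ιₜ ⟶ₜ (ιₜ ⟶ₜ oₜ) ⟶ₜ oₜ)
  | fminus : RealConst ((ιₜ ⟶ₜ ιₜ) ⟶ₜ (ιₜ ⟶ₜ ιₜ))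
  | fplus : RealConst ((ιₜ ⟶ₜ ιₜ) ⟶ₜ (ιₜ ⟶ₜ ιₜ) ⟶ₜ (ιₜ ⟶ₜ ιₜ))
  | ftimes : RealConst ((ιₜ ⟶ₜ ιₜ) ⟶ₜ (ιₜ ⟶ₜ ιₜ) ⟶ₜ (ιₜ ⟶ₜ ιₜ))
  | isDiff : RealConst ((ιₜ ⟶ₜ ιₜ) ⟶ₜ oₜ)
  | derivative : RealConst ((ιₜ ⟶ₜ ιₜ) ⟶ₜ (ιₜ ⟶ₜ ιₜ))
  | isPoly : RealConst (εₜ ⟶ₜ oₜ)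
  | polyDiff : RealConst (εₜ ⟶ₜ εₜ ⟶ₜ εₜ)

/-- The constants of each type: the logical constants, the constants of the theory of the real
numbers, and an arbitrary supply `κ` of further nonlogical constants. -/
inductive Const (κ : Ty → Type u) : Ty → Type u where
  | eq (α : Ty) : Const κ (α ⟶ₜ α ⟶ₜ oₜ)
  | isVar : Const κ (εₜ ⟶ₜ oₜ)
  | isVarT (α : Ty) : Const κ (εₜ ⟶ₜ oₜ)
  | isCon : Const κ (εₜ ⟶ₜ oₜ)
  | isConT (α : Ty) : Const κ (εₜ ⟶ₜ oₜ)
  | app : Const κ (εₜ ⟶ₜ εₜ ⟶ₜ εₜ)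
  | abs : Const κ (εₜ ⟶ₜ εₜ ⟶ₜ εₜ)
  | quo : Const κ (εₜ ⟶ₜ εₜ)
  | isExpr : Const κ (εₜ ⟶ₜ oₜ)
  | isExprT (α : Ty) : Const κ (εₜ ⟶ₜ oₜ)
  | subexpr : Const κ (εₜ ⟶ₜ εₜ ⟶ₜ oₜ)
  | isFreeIn : Const κ (εₜ ⟶ₜ εₜ ⟶ₜ oₜ)
  | real {α : Ty} (c : RealConst α) : Const κ α
  | other {α : Ty} (c : κ α) : Const κ α

/-- The logical constants. -/
inductive Const.IsLogical {κ : Ty → Type u} : {α : Ty} → Const κ α → Prop where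
  | eq (α : Ty) : IsLogical (Const.eq α)
  | isVar : IsLogical Const.isVar
  | isVarT (α : Ty) : IsLogical (Const.isVarT α)
  | isCon : IsLogical Const.isCon
  | isConT (α : Ty) : IsLogical (Const.isConT α)
  | app : IsLogical Const.app
  | abs : IsLogical Const.abs
  | quo : IsLogical Const.quo
  | isExpr : IsLogical Const.isExpr
  | isExprT (α : Ty) : IsLogical (Const.isExprT α)
  | subexpr : IsLogical Const.subexpr
  | isFreeIn : IsLogical Const.isFreeIn

/-- Raw expressions, indexed by their type. The variables of type `α` are the `var n α` with
`n : ℕ`. The term `eval β A` is the evaluation of `A` at type `β`; the only role of the second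
component of an evaluation is to fix this type. That quoted expressions are eval-free is
demanded by `InLang` below. -/
inductive Expr (κ : Ty → Type u) : Ty → Type u where
  | var (n : ℕ) (α : Ty) : Expr κ α
  | const {α : Ty} (c : Const κ α) : Expr κ α
  | app {α β : Ty} (F : Expr κ (α ⟶ₜ β)) (A : Expr κ α) : Expr κ β
  | lam {β : Ty} (n : ℕ) (α : Ty) (B : Expr κ β) : Expr κ (α ⟶ₜ β)
  | quote {α : Ty} (A : Expr κ α) : Expr κ εₜ
  | eval (β : Ty) (A : Expr κ εₜ) : Expr κ β

infixl:100 "⬝" => Expr.app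

variable {κ : Ty → Type u}

/-- An expression is eval-free if it is built without evaluations. -/
def EvalFree : {α : Ty} → Expr κ α → Prop
  | _, Expr.var _ _ => True
  | _, Expr.const _ => True
  | _, Expr.app F A => EvalFree F ∧ EvalFree A
  | _, Expr.lam _ _ B => EvalFree B
  | _, Expr.quote A => EvalFree A
  | _, Expr.eval _ _ => False

/-- `InLang D A`: the expression `A` is well formed (quoted subexpressions are eval-free) and all
its constants, also those inside quotations, belong to `D`. -/
def InLang (D : Set (Σ α : Ty, Const κ α)) : {α : Ty} → Expr κ α → Prop
  | _, Expr.var _ _ => True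
  | α, Expr.const c => (⟨α, c⟩ : Σ α : Ty, Const κ α) ∈ D
  | _, Expr.app F A => InLang D F ∧ InLang D A
  | _, Expr.lam _ _ B => InLang D B
  | _, Expr.quote A => EvalFree A ∧ InLang D A
  | _, Expr.eval _ A => InLang D A

/-- `FreeIn n α B`: the variable `n` of type `α` has a free occurrence in `B`. Occurrences inside
quotations are not free. The notion is used for eval-free `B` only. -/
def FreeIn (n : ℕ) (α : Ty) : {β : Ty} → Expr κ β → Prop
  | _, Expr.var m β => m = n ∧ β = α
  | _, Expr.const _ => False
  | _, Expr.app F A => FreeIn n α F ∨ FreeIn n α A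
  | _, Expr.lam m β B => ((m, β) : ℕ × Ty) ≠ (n, α) ∧ FreeIn n α B
  | _, Expr.quote _ => False
  | _, Expr.eval _ A => FreeIn n α A

/-! ## Names of the specific variables -/

abbrev fN : ℕ := 0
abbrev gN : ℕ := 1
abbrev hN : ℕ := 2
abbrev uN : ℕ := 3
abbrev vN : ℕ := 4
abbrev wN : ℕ := 5
abbrev xN : ℕ := 6
abbrev yN : ℕ := 7
abbrev zN : ℕ := 8
abbrev pN : ℕ := 9

/-! ## Definitions and abbreviations -/

/-- The equation of `A` and `B`; for formulas it is also the equivalence. -/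
def eqE {α : Ty} (A B : Expr κ α) : Expr κ oₜ := Expr.const (Const.eq α) ⬝ A ⬝ B

infix:50 "=ₑ" => eqE

/-- Truth. -/
def truE : Expr κ oₜ :=
  (Expr.const (Const.eq oₜ) : Expr κ (oₜ ⟶ₜ oₜ ⟶ₜ oₜ)) =ₑ Expr.const (Const.eq oₜ)

/-- Falsehood. -/
def falE : Expr κ oₜ := Expr.lam xN oₜ truE =ₑ Expr.lam xN oₜ (Expr.var xN oₜ)

/-- Universal quantification over the variable `n` of type `α`. -/
def allE (n : ℕ) (α : Ty) (A : Expr κ oₜ) : Expr κ oₜ := Expr.lam n α truE =ₑ Expr.lam n α A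

/-- The conjunction function. -/
def andC : Expr κ (oₜ ⟶ₜ oₜ ⟶ₜ oₜ) :=
  Expr.lam xN oₜ (Expr.lam yN oₜ
    (Expr.lam gN (oₜ ⟶ₜ oₜ ⟶ₜ oₜ) (Expr.var gN (oₜ ⟶ₜ oₜ ⟶ₜ oₜ) ⬝ truE ⬝ truE) =ₑ
      Expr.lam gN (oₜ ⟶ₜ oₜ ⟶ₜ oₜ)
        (Expr.var gN (oₜ ⟶ₜ oₜ ⟶ₜ oₜ) ⬝ Expr.var xN oₜ ⬝ Expr.var yN oₜ)))

def andE (A B : Expr κ oₜ) : Expr κ oₜ := andC ⬝ A ⬝ B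

infixr:35 "∧ₑ" => andE

/-- The implication function. -/
def impC : Expr κ (oₜ ⟶ₜ oₜ ⟶ₜ oₜ) :=
  Expr.lam xN oₜ (Expr.lam yN oₜ
    (Expr.var xN oₜ =ₑ (Expr.var xN oₜ ∧ₑ Expr.var yN oₜ)))

def impE (A B : Expr κ oₜ) : Expr κ oₜ := impC ⬝ A ⬝ B

infixr:25 "⊃ₑ" => impE

/-- The negation function. -/
def negC : Expr κ (oₜ ⟶ₜ oₜ) := Expr.const (Const.eq oₜ) ⬝ falE

def negE (A : Expr κ oₜ) : Expr κ oₜ := negC ⬝ A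

prefix:90 "¬ₑ" => negE

/-- The disjunction function. -/
def orC : Expr κ (oₜ ⟶ₜ oₜ ⟶ₜ oₜ) :=
  Expr.lam xN oₜ (Expr.lam yN oₜ (¬ₑ (¬ₑ Expr.var xN oₜ ∧ₑ ¬ₑ Expr.var yN oₜ)))

def orE (A B : Expr κ oₜ) : Expr κ oₜ := orC ⬝ A ⬝ B

infixr:30 "∨ₑ" => orE

/-- Existential quantification over the variable `n` of type `α`. -/
def exE (n : ℕ) (α : Ty) (A : Expr κ oₜ) : Expr κ oₜ := ¬ₑ allE n α (¬ₑ A)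

def neE {α : Ty} (A B : Expr κ α) : Expr κ oₜ := ¬ₑ (A =ₑ B)

infix:50 "≠ₑ" => neE

def isVarE (A : Expr κ εₜ) : Expr κ oₜ := Expr.const Const.isVar ⬝ A
def isVarTE (α : Ty) (A : Expr κ εₜ) : Expr κ oₜ := Expr.const (Const.isVarT α) ⬝ A
def isConE (A : Expr κ εₜ) : Expr κ oₜ := Expr.const Const.isCon ⬝ A
def isConTE (α : Ty) (A : Expr κ εₜ) : Expr κ oₜ := Expr.const (Const.isConT α) ⬝ A
def isExprE (A : Expr κ εₜ) : Expr κ oₜ := Expr.const Const.isExpr ⬝ A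
def isExprTE (α : Ty) (A : Expr κ εₜ) : Expr κ oₜ := Expr.const (Const.isExprT α) ⬝ A
def appE (A B : Expr κ εₜ) : Expr κ εₜ := Expr.const Const.app ⬝ A ⬝ B
def absE (A B : Expr κ εₜ) : Expr κ εₜ := Expr.const Const.abs ⬝ A ⬝ B
def quoE (A : Expr κ εₜ) : Expr κ εₜ := Expr.const Const.quo ⬝ A
def isFreeInE (A B : Expr κ εₜ) : Expr κ oₜ := Expr.const Const.isFreeIn ⬝ A ⬝ B
def subE (A B : Expr κ εₜ) : Expr κ oₜ := Expr.const Const.subexpr ⬝ A ⬝ B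

infix:50 "⊏ₑ" => subE

/-- The formula saying that the variable `n` of type `α` is effective in `B`, with the variable
`m` of the same type (`m ≠ n`) as bound variable. -/
def effE (m n : ℕ) (α : Ty) {β : Ty} (B : Expr κ β) : Expr κ oₜ :=
  exE m α (Expr.lam n α B ⬝ Expr.var m α ≠ₑ B)

/-- Constructions: the terms built from quotations of variables and constants by the three
syntax constructors. -/
inductive IsConstruction : Expr κ εₜ → Prop where
  | var (n : ℕ) (α : Ty) : IsConstruction (Expr.quote (Expr.var n α))
  | const {α : Ty} (c : Const κ α) : IsConstruction (Expr.quote (Expr.const c))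
  | app {A B : Expr κ εₜ} : IsConstruction A → IsConstruction B → IsConstruction (appE A B)
  | abs {A B : Expr κ εₜ} : IsConstruction A → IsConstruction B → IsConstruction (absE A B)
  | quo {A : Expr κ εₜ} : IsConstruction A → IsConstruction (quoE A)

/-! ## The specific variables -/

abbrev fv (α : Ty) : Expr κ α := Expr.var fN α
abbrev gv (α : Ty) : Expr κ α := Expr.var gN α
abbrev hv (α : Ty) : Expr κ α := Expr.var hN α
abbrev uv (α : Ty) : Expr κ α := Expr.var uN α
abbrev vv (α : Ty) : Expr κ α := Expr.var vN α
abbrev wv (α : Ty) : Expr κ α := Expr.var wN α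
abbrev xv (α : Ty) : Expr κ α := Expr.var xN α
abbrev yv (α : Ty) : Expr κ α := Expr.var yN α
abbrev zv (α : Ty) : Expr κ α := Expr.var zN α
abbrev pv (α : Ty) : Expr κ α := Expr.var pN α

/-! ## The proof system -/

/-- The axioms of the logic. -/
inductive IsAxiom : Expr κ oₜ → Prop where
  -- truth values, Leibniz' law, extensionality
  | a1 : IsAxiom ((gv (oₜ ⟶ₜ oₜ) ⬝ truE ∧ₑ gv (oₜ ⟶ₜ oₜ) ⬝ falE) =ₑ
      allE xN oₜ (gv (oₜ ⟶ₜ oₜ) ⬝ xv oₜ))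
  | a2 (α : Ty) : IsAxiom (xv α =ₑ yv α ⊃ₑ
      hv (α ⟶ₜ oₜ) ⬝ xv α =ₑ hv (α ⟶ₜ oₜ) ⬝ yv α)
  | a3 (α β : Ty) : IsAxiom ((fv (α ⟶ₜ β) =ₑ gv (α ⟶ₜ β)) =ₑ
      allE xN α (fv (α ⟶ₜ β) ⬝ xv α =ₑ gv (α ⟶ₜ β) ⬝ xv α))
  -- beta-reduction
  | a4_1 (n : ℕ) (α : Ty) (m : ℕ) (β : Ty) (A : Expr κ α)
      (hne : ((n, α) : ℕ × Ty) ≠ (m, β)) :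
      IsAxiom (Expr.lam n α (Expr.var m β) ⬝ A =ₑ Expr.var m β)
  | a4_2 (n : ℕ) (α : Ty) (A : Expr κ α) : IsAxiom (Expr.lam n α (Expr.var n α) ⬝ A =ₑ A)
  | a4_3 (n : ℕ) (α : Ty) {β : Ty} (c : Const κ β) (A : Expr κ α) :
      IsAxiom (Expr.lam n α (Expr.const c) ⬝ A =ₑ Expr.const c)
  | a4_4 (n : ℕ) (α : Ty) {β γ : Ty} (B : Expr κ (β ⟶ₜ γ)) (C : Expr κ β) (A : Expr κ α) :
      IsAxiom (Expr.lam n α (B ⬝ C) ⬝ A =ₑ (Expr.lam n α B ⬝ A) ⬝ (Expr.lam n α C ⬝ A))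
  | a4_5 (n : ℕ) (α : Ty) (m : ℕ) (β : Ty) {γ : Ty} (B : Expr κ γ) (A : Expr κ α)
      (hne : ((n, α) : ℕ × Ty) ≠ (m, β))
      (hfree : (EvalFree A ∧ ¬ FreeIn m β A) ∨ (EvalFree B ∧ ¬ FreeIn n α B)) :
      IsAxiom (Expr.lam n α (Expr.lam m β B) ⬝ A =ₑ Expr.lam m β (Expr.lam n α B ⬝ A))
  | a4_6 (n : ℕ) (α : Ty) {β : Ty} (B : Expr κ β) (A : Expr κ α) :
      IsAxiom (Expr.lam n α (Expr.lam n α B) ⬝ A =ₑ Expr.lam n α B)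
  -- variables
  | b1_1 (α : Ty) : IsAxiom (isVarTE α (xv εₜ) ⊃ₑ isVarE (xv εₜ))
  | b1_2 (n : ℕ) (α : Ty) : IsAxiom (isVarTE α (Expr.quote (Expr.var n α)))
  | b1_3 (α : Ty) (n : ℕ) (β : Ty) (hne : α ≠ β) :
      IsAxiom (¬ₑ isVarTE α (Expr.quote (Expr.var n β)))
  | b1_4 (A : Expr κ εₜ) (hA : IsConstruction A)
      (hne : ∀ (n : ℕ) (α : Ty), A ≠ Expr.quote (Expr.var n α)) : IsAxiom (¬ₑ isVarE A)
  -- constants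
  | b2_1 (α : Ty) : IsAxiom (isConTE α (xv εₜ) ⊃ₑ isConE (xv εₜ))
  | b2_2 {α : Ty} (c : Const κ α) : IsAxiom (isConTE α (Expr.quote (Expr.const c)))
  | b2_3 (α : Ty) {β : Ty} (c : Const κ β) (hne : α ≠ β) :
      IsAxiom (¬ₑ isConTE α (Expr.quote (Expr.const c)))
  | b2_4 (A : Expr κ εₜ) (hA : IsConstruction A)
      (hne : ∀ (α : Ty) (c : Const κ α), A ≠ Expr.quote (Expr.const c)) : IsAxiom (¬ₑ isConE A)
  -- constructions that represent eval-free expressions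
  | b3_1 (α : Ty) : IsAxiom (isExprTE α (xv εₜ) ⊃ₑ isExprE (xv εₜ))
  | b3_2 (α : Ty) : IsAxiom ((isVarTE α (xv εₜ) ∨ₑ isConTE α (xv εₜ)) ⊃ₑ isExprTE α (xv εₜ))
  | b3_3 (α β : Ty) : IsAxiom ((isExprTE (α ⟶ₜ β) (xv εₜ) ∧ₑ isExprTE α (yv εₜ)) ⊃ₑ
      isExprTE β (appE (xv εₜ) (yv εₜ)))
  | b3_4 (α β : Ty) : IsAxiom ((isVarTE α (xv εₜ) ∧ₑ isExprTE β (yv εₜ)) ⊃ₑ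
      isExprTE (α ⟶ₜ β) (absE (xv εₜ) (yv εₜ)))
  | b3_5 : IsAxiom (isExprE (xv εₜ) ⊃ₑ isExprTE εₜ (quoE (xv εₜ)))
  | b3_6 (α β : Ty) (hne : ∀ γ : Ty, α ≠ (β ⟶ₜ γ)) :
      IsAxiom ((isExprTE α (xv εₜ) ∧ₑ isExprTE β (yv εₜ)) ⊃ₑ
        ¬ₑ isExprE (appE (xv εₜ) (yv εₜ)))
  | b3_7 : IsAxiom ((¬ₑ isExprE (xv εₜ) ∨ₑ ¬ₑ isExprE (yv εₜ)) ⊃ₑ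
      ¬ₑ isExprE (appE (xv εₜ) (yv εₜ)))
  | b3_8 : IsAxiom ((¬ₑ isVarE (xv εₜ) ∨ₑ ¬ₑ isExprE (yv εₜ)) ⊃ₑ
      ¬ₑ isExprE (absE (xv εₜ) (yv εₜ)))
  | b3_9 : IsAxiom (¬ₑ isExprE (xv εₜ) ⊃ₑ ¬ₑ isExprE (quoE (xv εₜ)))
  -- constructions are distinct
  | b4_1 : IsAxiom (isVarE (xv εₜ) ⊃ₑ
      (¬ₑ isConE (xv εₜ) ∧ₑ xv εₜ ≠ₑ appE (yv εₜ) (zv εₜ) ∧ₑ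
        xv εₜ ≠ₑ absE (yv εₜ) (zv εₜ) ∧ₑ xv εₜ ≠ₑ quoE (yv εₜ)))
  | b4_2 : IsAxiom (isConE (xv εₜ) ⊃ₑ
      (¬ₑ isVarE (xv εₜ) ∧ₑ xv εₜ ≠ₑ appE (yv εₜ) (zv εₜ) ∧ₑ
        xv εₜ ≠ₑ absE (yv εₜ) (zv εₜ) ∧ₑ xv εₜ ≠ₑ quoE (yv εₜ)))
  | b4_3 : IsAxiom (xv εₜ =ₑ appE (yv εₜ) (zv εₜ) ⊃ₑ
      (¬ₑ isVarE (xv εₜ) ∧ₑ ¬ₑ isConE (xv εₜ) ∧ₑ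
        xv εₜ ≠ₑ absE (uv εₜ) (vv εₜ) ∧ₑ xv εₜ ≠ₑ quoE (uv εₜ)))
  | b4_4 : IsAxiom (xv εₜ =ₑ absE (yv εₜ) (zv εₜ) ⊃ₑ
      (¬ₑ isVarE (xv εₜ) ∧ₑ ¬ₑ isConE (xv εₜ) ∧ₑ
        xv εₜ ≠ₑ appE (uv εₜ) (vv εₜ) ∧ₑ xv εₜ ≠ₑ quoE (uv εₜ)))
  | b4_5 : IsAxiom (xv εₜ =ₑ quoE (yv εₜ) ⊃ₑ
      (¬ₑ isVarE (xv εₜ) ∧ₑ ¬ₑ isConE (xv εₜ) ∧ₑ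
        xv εₜ ≠ₑ appE (uv εₜ) (vv εₜ) ∧ₑ xv εₜ ≠ₑ absE (uv εₜ) (vv εₜ)))
  | b4_6 (n : ℕ) (α : Ty) (m : ℕ) (β : Ty) (hne : ((n, α) : ℕ × Ty) ≠ (m, β)) :
      IsAxiom (Expr.quote (Expr.var n α) ≠ₑ Expr.quote (Expr.var m β))
  | b4_7 {α β : Ty} (c : Const κ α) (d : Const κ β)
      (hne : (⟨α, c⟩ : Σ α : Ty, Const κ α) ≠ ⟨β, d⟩) :
      IsAxiom (Expr.quote (Expr.const c) ≠ₑ Expr.quote (Expr.const d))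
  | b4_8 : IsAxiom (appE (xv εₜ) (yv εₜ) =ₑ appE (uv εₜ) (vv εₜ) ⊃ₑ
      (xv εₜ =ₑ uv εₜ ∧ₑ yv εₜ =ₑ vv εₜ))
  | b4_9 : IsAxiom (absE (xv εₜ) (yv εₜ) =ₑ absE (uv εₜ) (vv εₜ) ⊃ₑ
      (xv εₜ =ₑ uv εₜ ∧ₑ yv εₜ =ₑ vv εₜ))
  | b4_10 : IsAxiom (quoE (xv εₜ) =ₑ quoE (uv εₜ) ⊃ₑ xv εₜ =ₑ uv εₜ)
  -- proper subconstructions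
  | b5_1 : IsAxiom (xv εₜ ⊏ₑ appE (xv εₜ) (yv εₜ))
  | b5_2 : IsAxiom (xv εₜ ⊏ₑ appE (yv εₜ) (xv εₜ))
  | b5_3 : IsAxiom (xv εₜ ⊏ₑ absE (xv εₜ) (yv εₜ))
  | b5_4 : IsAxiom (xv εₜ ⊏ₑ absE (yv εₜ) (xv εₜ))
  | b5_5 : IsAxiom (xv εₜ ⊏ₑ quoE (xv εₜ))
  | b5_6 : IsAxiom ((xv εₜ ⊏ₑ yv εₜ ∧ₑ yv εₜ ⊏ₑ zv εₜ) ⊃ₑ xv εₜ ⊏ₑ zv εₜ)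
  -- induction principle for constructions
  | b6 : IsAxiom (allE uN εₜ
      (allE vN εₜ (vv εₜ ⊏ₑ uv εₜ ⊃ₑ pv (εₜ ⟶ₜ oₜ) ⬝ vv εₜ) ⊃ₑ pv (εₜ ⟶ₜ oₜ) ⬝ uv εₜ) ⊃ₑ
      allE uN εₜ (pv (εₜ ⟶ₜ oₜ) ⬝ uv εₜ))
  -- free variables
  | b7_1 : IsAxiom (isVarE (xv εₜ) ⊃ₑ isFreeInE (xv εₜ) (xv εₜ))
  | b7_2 : IsAxiom ((isVarE (xv εₜ) ∧ₑ isVarE (yv εₜ) ∧ₑ xv εₜ ≠ₑ yv εₜ) ⊃ₑ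
      ¬ₑ isFreeInE (xv εₜ) (yv εₜ))
  | b7_3 : IsAxiom ((isVarE (xv εₜ) ∧ₑ isConE (yv εₜ)) ⊃ₑ ¬ₑ isFreeInE (xv εₜ) (yv εₜ))
  | b7_4 : IsAxiom ((isVarE (xv εₜ) ∧ₑ isExprE (appE (yv εₜ) (zv εₜ))) ⊃ₑ
      isFreeInE (xv εₜ) (appE (yv εₜ) (zv εₜ)) =ₑ
        (isFreeInE (xv εₜ) (yv εₜ) ∨ₑ isFreeInE (xv εₜ) (zv εₜ)))
  | b7_5 : IsAxiom ((isVarE (xv εₜ) ∧ₑ isExprE (absE (yv εₜ) (zv εₜ)) ∧ₑ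
        xv εₜ ≠ₑ yv εₜ) ⊃ₑ
      isFreeInE (xv εₜ) (absE (yv εₜ) (zv εₜ)) =ₑ isFreeInE (xv εₜ) (zv εₜ))
  | b7_6 : IsAxiom (isExprE (absE (xv εₜ) (yv εₜ)) ⊃ₑ
      ¬ₑ isFreeInE (xv εₜ) (absE (xv εₜ) (yv εₜ)))
  | b7_7 : IsAxiom ((isVarE (xv εₜ) ∧ₑ isExprE (yv εₜ)) ⊃ₑ
      ¬ₑ isFreeInE (xv εₜ) (quoE (yv εₜ)))
  | b7_8 : IsAxiom ((¬ₑ isVarE (xv εₜ) ∨ₑ ¬ₑ isExprE (yv εₜ)) ⊃ₑ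
      ¬ₑ isFreeInE (xv εₜ) (yv εₜ))
  -- quotation
  | b8_1 {α β : Ty} (F : Expr κ (α ⟶ₜ β)) (A : Expr κ α) :
      IsAxiom (Expr.quote (F ⬝ A) =ₑ appE (Expr.quote F) (Expr.quote A))
  | b8_2 (n : ℕ) (α : Ty) {β : Ty} (B : Expr κ β) :
      IsAxiom (Expr.quote (Expr.lam n α B) =ₑ
        absE (Expr.quote (Expr.var n α)) (Expr.quote B))
  | b8_3 {α : Ty} (A : Expr κ α) :
      IsAxiom (Expr.quote (Expr.quote A) =ₑ quoE (Expr.quote A))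
  | b9 (n : ℕ) (α : Ty) {β : Ty} (B : Expr κ β) (A : Expr κ α) :
      IsAxiom (Expr.lam n α (Expr.quote B) ⬝ A =ₑ Expr.quote B)
  -- evaluation
  | b10_1 (n : ℕ) (α : Ty) :
      IsAxiom (Expr.eval α (Expr.quote (Expr.var n α)) =ₑ Expr.var n α)
  | b10_2 {α : Ty} (c : Const κ α) :
      IsAxiom (Expr.eval α (Expr.quote (Expr.const c)) =ₑ Expr.const c)
  | b10_3 (α β : Ty) (A B : Expr κ εₜ) :
      IsAxiom ((isExprTE (α ⟶ₜ β) A ∧ₑ isExprTE α B) ⊃ₑ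
        Expr.eval β (appE A B) =ₑ Expr.eval (α ⟶ₜ β) A ⬝ Expr.eval α B)
  | b10_4 (n : ℕ) (α β : Ty) (A : Expr κ εₜ) :
      IsAxiom ((isExprTE β A ∧ₑ ¬ₑ isFreeInE (Expr.quote (Expr.var n α)) (Expr.quote A)) ⊃ₑ
        Expr.eval (α ⟶ₜ β) (absE (Expr.quote (Expr.var n α)) A) =ₑ
          Expr.lam n α (Expr.eval β A))
  | b10_5 (A : Expr κ εₜ) : IsAxiom (isExprTE εₜ A ⊃ₑ Expr.eval εₜ (quoE A) =ₑ A)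
  | b11_1 (n : ℕ) (α β : Ty) (B : Expr κ εₜ) :
      IsAxiom (Expr.lam n α (Expr.eval β B) ⬝ Expr.var n α =ₑ Expr.eval β B)
  | b11_2 (n : ℕ) (α β : Ty) (B : Expr κ εₜ) (A : Expr κ α) :
      IsAxiom ((isExprTE β (Expr.lam n α B ⬝ A) ∧ₑ
          ¬ₑ isFreeInE (Expr.quote (Expr.var n α)) (Expr.lam n α B ⬝ A)) ⊃ₑ
        Expr.lam n α (Expr.eval β B) ⬝ A =ₑ Expr.eval β (Expr.lam n α B ⬝ A))
  -- effectiveness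
  | b12 (m n : ℕ) (α : Ty) {β : Ty} (B : Expr κ β) (hmn : m ≠ n) (hB : EvalFree B)
      (hfree : ¬ FreeIn n α B) : IsAxiom (¬ₑ effE m n α B)
  -- the noneffectiveness conditions are required for all values of the bound variables
  | b13 (n : ℕ) (α : Ty) (m : ℕ) (β : Ty) {γ : Ty} (B : Expr κ γ) (A : Expr κ α) (k l : ℕ)
      (hne : ((n, α) : ℕ × Ty) ≠ (m, β)) (hk : k ≠ m) (hl : l ≠ n) :
      IsAxiom ((allE m β (¬ₑ effE k m β A) ∨ₑ allE n α (allE m β (¬ₑ effE l n α B))) ⊃ₑ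
        Expr.lam n α (Expr.lam m β B) ⬝ A =ₑ Expr.lam m β (Expr.lam n α B ⬝ A))

/-- `Replace A B C D`: `D` results from `C` by replacing one occurrence of `A`, which is not
within a quotation (nor the variable bound by an abstraction), by `B`. -/
inductive Replace {α : Ty} (A B : Expr κ α) : {β : Ty} → Expr κ β → Expr κ β → Prop where
  | here : Replace A B A B
  | appL {β γ : Ty} {F G : Expr κ (β ⟶ₜ γ)} (C : Expr κ β) :
      Replace A B F G → Replace A B (F ⬝ C) (G ⬝ C)
  | appR {β γ : Ty} (F : Expr κ (β ⟶ₜ γ)) {C D : Expr κ β} :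
      Replace A B C D → Replace A B (F ⬝ C) (F ⬝ D)
  | lam {γ : Ty} (n : ℕ) (β : Ty) {C D : Expr κ γ} :
      Replace A B C D → Replace A B (Expr.lam n β C) (Expr.lam n β D)
  | eval (β : Ty) {C D : Expr κ εₜ} :
      Replace A B C D → Replace A B (Expr.eval β C) (Expr.eval β D)

/-- A theory: a language, given by a set of constants containing the logical constants, and a set
of formulas of that language. -/
structure Theory (κ : Ty → Type u) where
  consts : Set (Σ α : Ty, Const κ α)
  logical_mem : ∀ {α : Ty} (c : Const κ α), c.IsLogical → ⟨α, c⟩ ∈ consts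
  formulas : Set (Expr κ oₜ)
  formulas_inLang : ∀ A ∈ formulas, InLang consts A

/-- The theorems of a theory `T`: everything obtained from the axioms of the logic in the language
of `T` and the formulas of `T` by equality substitution (Rule R). -/
inductive Theory.Provable (T : Theory κ) : Expr κ oₜ → Prop where
  | logic {A : Expr κ oₜ} : IsAxiom A → InLang T.consts A → Provable T A
  | hyp {A : Expr κ oₜ} : A ∈ T.formulas → Provable T A
  | ruleR {α : Ty} {A B : Expr κ α} {C D : Expr κ oₜ} :
      Provable T (A =ₑ B) → Provable T C → Replace A B C D → Provable T D

/-! ## The theory of the real numbers -/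

abbrev rc {α : Ty} (c : RealConst α) : Expr κ α := Expr.const (Const.real c)

def zeroE : Expr κ ιₜ := rc RealConst.zero
def oneE : Expr κ ιₜ := rc RealConst.one
def minusE (A : Expr κ ιₜ) : Expr κ ιₜ := rc RealConst.minus ⬝ A
def plusE (A B : Expr κ ιₜ) : Expr κ ιₜ := rc RealConst.plus ⬝ A ⬝ B
def timesE (A B : Expr κ ιₜ) : Expr κ ιₜ := rc RealConst.times ⬝ A ⬝ B
def recipE (A : Expr κ ιₜ) : Expr κ ιₜ := rc RealConst.recip ⬝ A
def posE (A : Expr κ ιₜ) : Expr κ oₜ := rc RealConst.pos ⬝ A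
def lessE (A B : Expr κ ιₜ) : Expr κ oₜ := rc RealConst.less ⬝ A ⬝ B
def lesseqE (A B : Expr κ ιₜ) : Expr κ oₜ := rc RealConst.lesseq ⬝ A ⬝ B
def ubE (A : Expr κ ιₜ) (P : Expr κ (ιₜ ⟶ₜ oₜ)) : Expr κ oₜ := rc RealConst.ub ⬝ A ⬝ P
def lubE (A : Expr κ ιₜ) (P : Expr κ (ιₜ ⟶ₜ oₜ)) : Expr κ oₜ := rc RealConst.lub ⬝ A ⬝ P
def isDiffE (F : Expr κ (ιₜ ⟶ₜ ιₜ)) : Expr κ oₜ := rc RealConst.isDiff ⬝ F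
def derivE (F : Expr κ (ιₜ ⟶ₜ ιₜ)) : Expr κ (ιₜ ⟶ₜ ιₜ) := rc RealConst.derivative ⬝ F
def isPolyE (A : Expr κ εₜ) : Expr κ oₜ := rc RealConst.isPoly ⬝ A
def polyDiffE (A B : Expr κ εₜ) : Expr κ εₜ := rc RealConst.polyDiff ⬝ A ⬝ B

infixl:65 "+ₑ" => plusE
infixl:70 "*ₑ" => timesE
prefix:75 "-ₑ" => minusE
infix:50 "<ₑ" => lessE
infix:50 "≤ₑ" => lesseqE

/-- The quasiquotation of a negation. -/
def qMinus (A : Expr κ εₜ) : Expr κ εₜ := appE (Expr.quote (rc RealConst.minus)) A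

/-- The quasiquotation of a sum. -/
def qPlus (A B : Expr κ εₜ) : Expr κ εₜ := appE (appE (Expr.quote (rc RealConst.plus)) A) B

/-- The quasiquotation of a product. -/
def qTimes (A B : Expr κ εₜ) : Expr κ εₜ := appE (appE (Expr.quote (rc RealConst.times)) A) B

/-- The type of individuals is a complete ordered field. -/
inductive IsFieldFormula : Expr κ oₜ → Prop where
  | add_assoc : IsFieldFormula
      ((xv ιₜ +ₑ yv ιₜ) +ₑ zv ιₜ =ₑ xv ιₜ +ₑ (yv ιₜ +ₑ zv ιₜ))
  | add_comm : IsFieldFormula (xv ιₜ +ₑ yv ιₜ =ₑ yv ιₜ +ₑ xv ιₜ)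
  | add_zero : IsFieldFormula (xv ιₜ +ₑ zeroE =ₑ xv ιₜ)
  | add_neg : IsFieldFormula (xv ιₜ +ₑ -ₑ xv ιₜ =ₑ zeroE)
  | mul_assoc : IsFieldFormula
      ((xv ιₜ *ₑ yv ιₜ) *ₑ zv ιₜ =ₑ xv ιₜ *ₑ (yv ιₜ *ₑ zv ιₜ))
  | mul_comm : IsFieldFormula (xv ιₜ *ₑ yv ιₜ =ₑ yv ιₜ *ₑ xv ιₜ)
  | mul_one : IsFieldFormula (xv ιₜ *ₑ oneE =ₑ xv ιₜ)
  | mul_recip : IsFieldFormula (xv ιₜ ≠ₑ zeroE ⊃ₑ xv ιₜ *ₑ recipE (xv ιₜ) =ₑ oneE)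
  | zero_ne_one : IsFieldFormula (zeroE ≠ₑ oneE)
  | distrib : IsFieldFormula
      (xv ιₜ *ₑ (yv ιₜ +ₑ zv ιₜ) =ₑ xv ιₜ *ₑ yv ιₜ +ₑ xv ιₜ *ₑ zv ιₜ)
  | trichotomy : IsFieldFormula
      ((xv ιₜ =ₑ zeroE ∧ₑ ¬ₑ posE (xv ιₜ) ∧ₑ ¬ₑ posE (-ₑ xv ιₜ)) ∨ₑ
        (xv ιₜ ≠ₑ zeroE ∧ₑ posE (xv ιₜ) ∧ₑ ¬ₑ posE (-ₑ xv ιₜ)) ∨ₑ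
        (xv ιₜ ≠ₑ zeroE ∧ₑ ¬ₑ posE (xv ιₜ) ∧ₑ posE (-ₑ xv ιₜ)))
  | pos_add : IsFieldFormula ((posE (xv ιₜ) ∧ₑ posE (yv ιₜ)) ⊃ₑ posE (xv ιₜ +ₑ yv ιₜ))
  | pos_mul : IsFieldFormula ((posE (xv ιₜ) ∧ₑ posE (yv ιₜ)) ⊃ₑ posE (xv ιₜ *ₑ yv ιₜ))
  | less_def : IsFieldFormula ((xv ιₜ <ₑ yv ιₜ) =ₑ posE (yv ιₜ +ₑ -ₑ xv ιₜ))
  | lesseq_def : IsFieldFormula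
      ((xv ιₜ ≤ₑ yv ιₜ) =ₑ (xv ιₜ <ₑ yv ιₜ ∨ₑ xv ιₜ =ₑ yv ιₜ))
  | ub_def : IsFieldFormula (ubE (xv ιₜ) (pv (ιₜ ⟶ₜ oₜ)) =ₑ
      allE yN ιₜ (pv (ιₜ ⟶ₜ oₜ) ⬝ yv ιₜ ⊃ₑ yv ιₜ ≤ₑ xv ιₜ))
  | lub_def : IsFieldFormula (lubE (xv ιₜ) (pv (ιₜ ⟶ₜ oₜ)) =ₑ
      (ubE (xv ιₜ) (pv (ιₜ ⟶ₜ oₜ)) ∧ₑ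
        allE yN ιₜ (ubE (yv ιₜ) (pv (ιₜ ⟶ₜ oₜ)) ⊃ₑ xv ιₜ ≤ₑ yv ιₜ)))
  | complete : IsFieldFormula
      ((exE xN ιₜ (pv (ιₜ ⟶ₜ oₜ) ⬝ xv ιₜ) ∧ₑ exE xN ιₜ (ubE (xv ιₜ) (pv (ιₜ ⟶ₜ oₜ)))) ⊃ₑ
        exE xN ιₜ (lubE (xv ιₜ) (pv (ιₜ ⟶ₜ oₜ))))

/-- The formula saying that `D` is the limit of the difference quotient
`(F (X + h) - F X) / h` as `h` tends to zero through nonzero values. It is used for terms in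
which the variables named `u`, `v`, `h` of the type of individuals do not occur. -/
def hasDerivE (F : Expr κ (ιₜ ⟶ₜ ιₜ)) (X D : Expr κ ιₜ) : Expr κ oₜ :=
  allE uN ιₜ (zeroE <ₑ uv ιₜ ⊃ₑ
    exE vN ιₜ (zeroE <ₑ vv ιₜ ∧ₑ
      allE hN ιₜ ((hv ιₜ ≠ₑ zeroE ∧ₑ -ₑ vv ιₜ <ₑ hv ιₜ ∧ₑ hv ιₜ <ₑ vv ιₜ) ⊃ₑ
        (-ₑ uv ιₜ <ₑ ((F ⬝ (X +ₑ hv ιₜ) +ₑ -ₑ (F ⬝ X)) *ₑ recipE (hv ιₜ)) +ₑ -ₑ D ∧ₑ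
          ((F ⬝ (X +ₑ hv ιₜ) +ₑ -ₑ (F ⬝ X)) *ₑ recipE (hv ιₜ)) +ₑ -ₑ D <ₑ uv ιₜ))))

/-- The operations on functions, differentiability and the derivative. -/
inductive IsCalculusFormula : Expr κ oₜ → Prop where
  | fminus_def : IsCalculusFormula (rc RealConst.fminus =ₑ
      Expr.lam fN (ιₜ ⟶ₜ ιₜ) (Expr.lam xN ιₜ (-ₑ (fv (ιₜ ⟶ₜ ιₜ) ⬝ xv ιₜ))))
  | fplus_def : IsCalculusFormula (rc RealConst.fplus =ₑ
      Expr.lam fN (ιₜ ⟶ₜ ιₜ) (Expr.lam gN (ιₜ ⟶ₜ ιₜ) (Expr.lam xN ιₜ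
        (fv (ιₜ ⟶ₜ ιₜ) ⬝ xv ιₜ +ₑ gv (ιₜ ⟶ₜ ιₜ) ⬝ xv ιₜ))))
  | ftimes_def : IsCalculusFormula (rc RealConst.ftimes =ₑ
      Expr.lam fN (ιₜ ⟶ₜ ιₜ) (Expr.lam gN (ιₜ ⟶ₜ ιₜ) (Expr.lam xN ιₜ
        (fv (ιₜ ⟶ₜ ιₜ) ⬝ xv ιₜ *ₑ gv (ιₜ ⟶ₜ ιₜ) ⬝ xv ιₜ))))
  | isDiff_def : IsCalculusFormula (isDiffE (fv (ιₜ ⟶ₜ ιₜ)) =ₑ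
      allE xN ιₜ (exE yN ιₜ (hasDerivE (fv (ιₜ ⟶ₜ ιₜ)) (xv ιₜ) (yv ιₜ))))
  | deriv_spec : IsCalculusFormula (isDiffE (fv (ιₜ ⟶ₜ ιₜ)) ⊃ₑ
      allE xN ιₜ (hasDerivE (fv (ιₜ ⟶ₜ ιₜ)) (xv ιₜ) (derivE (fv (ιₜ ⟶ₜ ιₜ)) ⬝ xv ιₜ)))

/-- The body of the recursive definition of the predicate for polynomials in the variables `x`
and `y` of the type of individuals; it has the variable `u` free. -/
def isPolyBody : Expr κ oₜ :=
  uv εₜ =ₑ Expr.quote (xv ιₜ) ∨ₑ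
  uv εₜ =ₑ Expr.quote (yv ιₜ) ∨ₑ
  uv εₜ =ₑ Expr.quote zeroE ∨ₑ
  uv εₜ =ₑ Expr.quote oneE ∨ₑ
  exE vN εₜ (isPolyE (vv εₜ) ∧ₑ uv εₜ =ₑ qMinus (vv εₜ)) ∨ₑ
  exE vN εₜ (exE wN εₜ
    (isPolyE (vv εₜ) ∧ₑ isPolyE (wv εₜ) ∧ₑ uv εₜ =ₑ qPlus (vv εₜ) (wv εₜ))) ∨ₑ
  exE vN εₜ (exE wN εₜ
    (isPolyE (vv εₜ) ∧ₑ isPolyE (wv εₜ) ∧ₑ uv εₜ =ₑ qTimes (vv εₜ) (wv εₜ)))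

/-- The definition of the predicate for polynomials and the specification of symbolic
differentiation. -/
inductive IsPolyFormula : Expr κ oₜ → Prop where
  | isPoly_def : IsPolyFormula (rc RealConst.isPoly =ₑ Expr.lam uN εₜ isPolyBody)
  | diff_var_same : IsPolyFormula (isVarTE ιₜ (xv εₜ) ⊃ₑ
      polyDiffE (xv εₜ) (xv εₜ) =ₑ Expr.quote oneE)
  | diff_var_other : IsPolyFormula
      ((isVarTE ιₜ (xv εₜ) ∧ₑ isVarTE ιₜ (yv εₜ) ∧ₑ xv εₜ ≠ₑ yv εₜ) ⊃ₑ
        polyDiffE (xv εₜ) (yv εₜ) =ₑ Expr.quote zeroE)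
  | diff_con : IsPolyFormula ((isConTE ιₜ (xv εₜ) ∧ₑ isVarTE ιₜ (yv εₜ)) ⊃ₑ
      polyDiffE (xv εₜ) (yv εₜ) =ₑ Expr.quote zeroE)
  | diff_minus : IsPolyFormula ((isPolyE (xv εₜ) ∧ₑ isVarTE ιₜ (yv εₜ)) ⊃ₑ
      polyDiffE (qMinus (xv εₜ)) (yv εₜ) =ₑ qMinus (polyDiffE (xv εₜ) (yv εₜ)))
  | diff_plus : IsPolyFormula
      ((isPolyE (xv εₜ) ∧ₑ isPolyE (yv εₜ) ∧ₑ isVarTE ιₜ (zv εₜ)) ⊃ₑ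
        polyDiffE (qPlus (xv εₜ) (yv εₜ)) (zv εₜ) =ₑ
          qPlus (polyDiffE (xv εₜ) (zv εₜ)) (polyDiffE (yv εₜ) (zv εₜ)))
  | diff_times : IsPolyFormula
      ((isPolyE (xv εₜ) ∧ₑ isPolyE (yv εₜ) ∧ₑ isVarTE ιₜ (zv εₜ)) ⊃ₑ
        polyDiffE (qTimes (xv εₜ) (yv εₜ)) (zv εₜ) =ₑ
          qPlus (qTimes (polyDiffE (xv εₜ) (zv εₜ)) (yv εₜ))
            (qTimes (xv εₜ) (polyDiffE (yv εₜ) (zv εₜ))))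

/-- `T` is a theory of the real numbers: its language contains the constants of real arithmetic
and calculus, and among its formulas are the axioms of a complete ordered field for the type of
individuals, the definitions of the operations and notions of calculus, and the definition and
specification of the two constants for polynomials. -/
structure IsRealTheory (T : Theory κ) : Prop where
  const_mem : ∀ {α : Ty} (c : RealConst α),
    (⟨α, Const.real c⟩ : Σ α : Ty, Const κ α) ∈ T.consts
  field_mem : ∀ A : Expr κ oₜ, IsFieldFormula A → A ∈ T.formulas
  calculus_mem : ∀ A : Expr κ oₜ, IsCalculusFormula A → A ∈ T.formulas
  poly_mem : ∀ A : Expr κ oₜ, IsPolyFormula A → A ∈ T.formulas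

/-- The meaning formula for symbolic differentiation with respect to the variable `n` of the type
of individuals. -/
def meaningFormula (n : ℕ) : Expr κ oₜ :=
  allE uN εₜ (isPolyE (uv εₜ) ⊃ₑ
    derivE (Expr.lam n ιₜ (Expr.eval ιₜ (uv εₜ))) =ₑ
      Expr.lam n ιₜ (Expr.eval ιₜ (polyDiffE (uv εₜ) (Expr.quote (Expr.var n ιₜ)))))

end CTTqe

/-! Symbolic differentiation of polynomials agrees with the derivative because both obey the same
recursion: constants, the two variables, negation, sums, products. Limits of difference quotients
are unique and satisfy these rules in every ordered field, and the induction axiom for constructions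
yields induction over polynomials. The difficulty lies in the calculus: the recursion concerns
evaluations ⟦u⟧, into which substitution is severely restricted, so ordinary reasoning is not
available for them.

The proof therefore separates an eval-free law from its application to evaluations. The law
(`evalLawE`) concerns a variable f of type ε→ι→ι: if f satisfies the recursion clauses of evaluation
on polynomials, then deriv (λx. f u x) = λx. f (d u ⌜x⌝) x, where d is poly-diff. An eval-free
formula without further nonlogical constants is provable once it holds in all Henkin models
(`completeness`), and there the law is the calculus just described (`Model.tr_evalLawE`).
Completeness comes from a term model. It rests on the provability of tautologies
(`PropForm.provable`), established for all formulas, also those with evaluations.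

To apply the law, f is replaced by E = λu.λx.((λw.⟦u⟧)⌜0⌝), which is `interpE`. Axiom `b13` lets an
argument pass a binder whose variable is noneffective in the argument. The binders over f in the law
are those of u, w and x, and E is built so that these three are noneffective in it (`rigid_interp`).
On polynomials E t x equals ⟦t⟧ (`interp_eval`): by `b11_2` a substitution enters an evaluation if
the resulting construction represents an expression of the right type in which the substituted
variable is not free. No variables but x and y of type ι are free in a polynomial, and the variable
of differentiation is only ever reduced at itself, which `b11_1` permits.

The clauses for E follow from the axioms for evaluation, but as equations between irregular terms
(terms with evaluations) under the premise that constructions are polynomials. Such conditional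
equations are handled by proving a law for function variables f, g, h by completeness and
substituting for them (`inst_functions`). Substituting one irregular function after another would
mean substituting into evaluations already inserted. Instead the three functions are made the values
at 0, 1, −1 of a single function with one more argument, by interpolation (`familyE`), so that one
irregular substitution suffices. Finally E is exchanged for evaluation on both sides of the
derivative equation (`cond_deriv_left`, `cond_deriv_right`). -/

namespace CTTqe
variable {κ : Ty → Type u}

/-! ## Equational reasoning -/

infix:26 "⊢ₚ" => Theory.Provable

/-- Membership in the language of a theory. -/
abbrev Theory.Lang (T : Theory κ) {α : Ty} (A : Expr κ α) : Prop := InLang T.consts A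

variable {T : Theory κ}

theorem Replace.inLang {D : Set (Σ α : Ty, Const κ α)} {α β : Ty} {A B : Expr κ α}
    {X Y : Expr κ β} (h : Replace A B X Y) (hB : InLang D B) (hX : InLang D X) : InLang D Y := by
  induction h with
  | here => exact hB
  | appL C _ ih => exact ⟨ih hX.1, hX.2⟩
  | appR F _ ih => exact ⟨hX.1, ih hX.2⟩
  | lam n β _ ih => exact ih hX
  | eval β _ ih => exact ih hX

theorem inLang_eqE {D : Set (Σ α : Ty, Const κ α)} {α : Ty} {A B : Expr κ α}
    (h : InLang D (A =ₑ B)) : InLang D A ∧ InLang D B := ⟨h.1.2, h.2⟩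

namespace Theory.Provable

theorem lang {A : Expr κ oₜ} (h : T ⊢ₚ A) : T.Lang A := by
  induction h with
  | logic _ h => exact h
  | hyp h => exact T.formulas_inLang _ h
  | ruleR _ _ hr ih1 ih2 => exact hr.inLang (inLang_eqE ih1).2 ih2

theorem left {α : Ty} {A B : Expr κ α} (h : T ⊢ₚ A =ₑ B) : T.Lang A := (inLang_eqE h.lang).1

theorem right {α : Ty} {A B : Expr κ α} (h : T ⊢ₚ A =ₑ B) : T.Lang B := (inLang_eqE h.lang).2

theorem mp {A B : Expr κ oₜ} (h : T ⊢ₚ A =ₑ B) (hA : T ⊢ₚ A) : T ⊢ₚ B :=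
  ruleR h hA Replace.here

end Theory.Provable

namespace Theory

theorem lang_eq (T : Theory κ) (α : Ty) : T.Lang (Expr.const (Const.eq α)) :=
  T.logical_mem _ (Const.IsLogical.eq α)

theorem lang_eqE {α : Ty} {A B : Expr κ α} (hA : T.Lang A) (hB : T.Lang B) :
    T.Lang (A =ₑ B) := ⟨⟨T.lang_eq α, hA⟩, hB⟩

theorem lang_app {α β : Ty} {F : Expr κ (α ⟶ₜ β)} {A : Expr κ α} (hF : T.Lang F)
    (hA : T.Lang A) : T.Lang (F ⬝ A) := ⟨hF, hA⟩

/-- Reflexivity is not an axiom. The equation (λx.x)A = A is used by Rule R to rewrite its own left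
side. -/
theorem refl {α : Ty} {A : Expr κ α} (hA : T.Lang A) : T ⊢ₚ A =ₑ A := by
  have h : T ⊢ₚ Expr.lam 0 α (Expr.var 0 α) ⬝ A =ₑ A :=
    Provable.logic (IsAxiom.a4_2 0 α A) (lang_eqE ⟨trivial, hA⟩ hA)
  exact Provable.ruleR h h (Replace.appL _ (Replace.appR _ Replace.here))

namespace Provable

theorem symm {α : Ty} {A B : Expr κ α} (h : T ⊢ₚ A =ₑ B) : T ⊢ₚ B =ₑ A :=
  ruleR h (refl h.left) (Replace.appL _ (Replace.appR _ Replace.here))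

theorem trans {α : Ty} {A B C : Expr κ α} (h : T ⊢ₚ A =ₑ B) (h' : T ⊢ₚ B =ₑ C) :
    T ⊢ₚ A =ₑ C := ruleR h' h (Replace.appR _ Replace.here)

theorem mpr {A B : Expr κ oₜ} (h : T ⊢ₚ A =ₑ B) (hB : T ⊢ₚ B) : T ⊢ₚ A := h.symm.mp hB

theorem app {α β : Ty} {F G : Expr κ (α ⟶ₜ β)} {A B : Expr κ α} (h : T ⊢ₚ F =ₑ G)
    (h' : T ⊢ₚ A =ₑ B) : T ⊢ₚ F ⬝ A =ₑ G ⬝ B := by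
  have h1 : T ⊢ₚ F ⬝ A =ₑ F ⬝ A := refl ⟨h.left, h'.left⟩
  have h2 : T ⊢ₚ F ⬝ A =ₑ G ⬝ A := ruleR h h1 (Replace.appR _ (Replace.appL _ Replace.here))
  exact ruleR h' h2 (Replace.appR _ (Replace.appR _ Replace.here))

theorem appL {α β : Ty} {F G : Expr κ (α ⟶ₜ β)} (h : T ⊢ₚ F =ₑ G) {A : Expr κ α}
    (hA : T.Lang A) : T ⊢ₚ F ⬝ A =ₑ G ⬝ A := h.app (refl hA)

theorem appR {α β : Ty} {A B : Expr κ α} (h : T ⊢ₚ A =ₑ B) {F : Expr κ (α ⟶ₜ β)}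
    (hF : T.Lang F) : T ⊢ₚ F ⬝ A =ₑ F ⬝ B := (refl hF).app h

theorem lam {α : Ty} {A B : Expr κ α} (h : T ⊢ₚ A =ₑ B) (n : ℕ) (β : Ty) :
    T ⊢ₚ Expr.lam n β A =ₑ Expr.lam n β B :=
  ruleR h (refl (A := Expr.lam n β A) h.left) (Replace.appR _ (Replace.lam n β Replace.here))

theorem eval {A B : Expr κ εₜ} (h : T ⊢ₚ A =ₑ B) (β : Ty) :
    T ⊢ₚ Expr.eval β A =ₑ Expr.eval β B :=
  ruleR h (refl (A := Expr.eval β A) h.left) (Replace.appR _ (Replace.eval β Replace.here))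

theorem eq_congr {α : Ty} {A A' B B' : Expr κ α} (h : T ⊢ₚ A =ₑ A') (h' : T ⊢ₚ B =ₑ B') :
    T ⊢ₚ (A =ₑ B) =ₑ (A' =ₑ B') := ((refl (T.lang_eq α)).app h).app h'

end Provable

/-! ## Simultaneous substitution into eval-free expressions -/

end Theory

open Classical in
noncomputable instance : DecidableEq Ty := fun _ _ => Classical.propDecidable _

/-- Assignments of expressions to variables. -/
abbrev Subst (κ : Ty → Type u) := (p : ℕ × Ty) → Expr κ p.2

/-- The identity substitution. -/
def idS : Subst κ := fun p => Expr.var p.1 p.2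

/-- Change of a substitution at one variable. -/
noncomputable def Subst.up (σ : Subst κ) (n : ℕ) (α : Ty) (A : Expr κ α) : Subst κ :=
  Function.update σ (n, α) A

/-- Simultaneous substitution for the free variables, without renaming of bound variables. -/
noncomputable def sub : Subst κ → {α : Ty} → Expr κ α → Expr κ α
  | σ, _, Expr.var n α => σ (n, α)
  | _, _, Expr.const c => Expr.const c
  | σ, _, Expr.app F A => Expr.app (sub σ F) (sub σ A)
  | σ, _, Expr.lam n α B => Expr.lam n α (sub (σ.up n α (Expr.var n α)) B)
  | _, _, Expr.quote A => Expr.quote A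
  | σ, _, Expr.eval β A => Expr.eval β (sub σ A)

theorem Subst.up_self (σ : Subst κ) (n : ℕ) (α : Ty) (A : Expr κ α) :
    σ.up n α A (n, α) = A := Function.update_self _ _ _

theorem Subst.up_ne (σ : Subst κ) {n : ℕ} {α : Ty} (A : Expr κ α) {p : ℕ × Ty}
    (h : p ≠ (n, α)) : σ.up n α A p = σ p := Function.update_of_ne h _ _

theorem Subst.up_up (σ : Subst κ) (n : ℕ) (α : Ty) (A B : Expr κ α) :
    (σ.up n α A).up n α B = σ.up n α B := Function.update_idem _ _ _

theorem Subst.up_comm (σ : Subst κ) {n m : ℕ} {α β : Ty} (h : ((n, α) : ℕ × Ty) ≠ (m, β))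
    (A : Expr κ α) (B : Expr κ β) :
    (σ.up n α A).up m β B = (σ.up m β B).up n α A := by
  unfold Subst.up
  exact Function.update_comm h _ _ _

theorem Subst.up_eq_self (σ : Subst κ) {n : ℕ} {α : Ty} {A : Expr κ α} (h : σ (n, α) = A) :
    σ.up n α A = σ := by subst h; exact Function.update_eq_self _ _

theorem sub_congr {α : Ty} (B : Expr κ α) (hB : EvalFree B) (σ τ : Subst κ)
    (h : ∀ p : ℕ × Ty, FreeIn p.1 p.2 B → σ p = τ p) : sub σ B = sub τ B := by
  induction B generalizing σ τ with
  | var n α => exact h (n, α) ⟨rfl, rfl⟩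
  | const c => rfl
  | app F A ihF ihA =>
    simp only [sub]
    rw [ihF hB.1 σ τ fun p hp => h p (Or.inl hp), ihA hB.2 σ τ fun p hp => h p (Or.inr hp)]
  | lam n α B ih =>
    simp only [sub]
    congr 1
    refine ih hB _ _ fun p hp => ?_
    by_cases hpn : p = (n, α)
    · subst hpn; simp only [Subst.up_self]
    · rw [Subst.up_ne _ _ hpn, Subst.up_ne _ _ hpn]
      exact h p ⟨fun e => hpn e.symm, hp⟩
  | quote A => rfl
  | eval β A => exact hB.elim

theorem idS_up (n : ℕ) (α : Ty) : (idS : Subst κ).up n α (Expr.var n α) = idS :=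
  Subst.up_eq_self _ rfl

theorem sub_idS {α : Ty} (B : Expr κ α) : sub idS B = B := by
  induction B with
  | var n α => rfl
  | const c => rfl
  | app F A ihF ihA => simp only [sub, ihF, ihA]
  | lam n α B ih => simp only [sub, idS_up, ih]
  | quote A => rfl
  | eval β A ih => simp only [sub, ih]

theorem sub_closed {α : Ty} (B : Expr κ α) (hB : EvalFree B) (σ : Subst κ)
    (h : ∀ n β, ¬ FreeIn n β B) : sub σ B = B := by
  rw [sub_congr B hB σ idS fun p hp => absurd hp (h p.1 p.2), sub_idS]

theorem sub_lang {D : Set (Σ α : Ty, Const κ α)} {α : Ty} (B : Expr κ α) (hB : InLang D B)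
    (σ : Subst κ) (h : ∀ p, InLang D (σ p)) : InLang D (sub σ B) := by
  induction B generalizing σ with
  | var n α => exact h (n, α)
  | const c => exact hB
  | app F A ihF ihA => exact ⟨ihF hB.1 σ h, ihA hB.2 σ h⟩
  | lam n α B ih =>
    refine ih hB _ fun p => ?_
    by_cases hpn : p = (n, α)
    · subst hpn; rw [Subst.up_self]; trivial
    · rw [Subst.up_ne _ _ hpn]; exact h p
  | quote A => exact hB
  | eval β A ih => exact ih hB σ h

/-- Substitutions with values in the language of the theory. -/
def Theory.LangS (T : Theory κ) (σ : Subst κ) : Prop := ∀ p, T.Lang (σ p)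

theorem Theory.langS_idS : T.LangS idS := fun _ => trivial

theorem Theory.LangS.up {σ : Subst κ} (h : T.LangS σ) {n : ℕ} {α : Ty} {A : Expr κ α}
    (hA : T.Lang A) : T.LangS (σ.up n α A) := by
  intro p
  by_cases hpn : p = (n, α)
  · subst hpn; rw [Subst.up_self]; exact hA
  · rw [Subst.up_ne _ _ hpn]; exact h p

/-! ### Moving arguments through binders -/

namespace Theory

/-- `T.Pass m β A`: the argument `A` passes the binder for the variable `m` of type `β`. -/
def Pass (T : Theory κ) (m : ℕ) (β : Ty) {α : Ty} (A : Expr κ α) : Prop :=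
  ∀ (k : ℕ) {γ : Ty} (B : Expr κ γ), ((k, α) : ℕ × Ty) ≠ (m, β) → T.Lang B → T.Lang A →
    T ⊢ₚ Expr.lam k α (Expr.lam m β B) ⬝ A =ₑ Expr.lam m β (Expr.lam k α B ⬝ A)

/-- `T.Inert k α X`: substitution for the variable `k` of type `α` does not change `X`. -/
structure Inert (T : Theory κ) (k : ℕ) (α : Ty) {γ : Ty} (X : Expr κ γ) : Prop where
  beta : ∀ A : Expr κ α, T.Lang A → T ⊢ₚ Expr.lam k α X ⬝ A =ₑ X
  pass : ∀ (m : ℕ) (β : Ty) (A : Expr κ α), ((k, α) : ℕ × Ty) ≠ (m, β) → T.Lang A →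
    T ⊢ₚ Expr.lam k α (Expr.lam m β X) ⬝ A =ₑ Expr.lam m β (Expr.lam k α X ⬝ A)

theorem pass_of_evalFree {m : ℕ} {β α : Ty} {A : Expr κ α} (hA : EvalFree A)
    (hm : ¬ FreeIn m β A) : T.Pass m β A := fun k _ B hne hB hLA =>
  Provable.logic (IsAxiom.a4_5 k α m β B A hne (Or.inl ⟨hA, hm⟩)) (lang_eqE ⟨hB, hLA⟩ ⟨hB, hLA⟩)

theorem beta_app {k : ℕ} {α β γ : Ty} {F F' : Expr κ (β ⟶ₜ γ)} {C C' : Expr κ β} {A : Expr κ α}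
    (hF : T ⊢ₚ Expr.lam k α F ⬝ A =ₑ F') (hC : T ⊢ₚ Expr.lam k α C ⬝ A =ₑ C') :
    T ⊢ₚ Expr.lam k α (F ⬝ C) ⬝ A =ₑ F' ⬝ C' := by
  refine (Provable.logic (IsAxiom.a4_4 k α F C A) ?_).trans (hF.app hC)
  have h1 : T.Lang F := hF.left.1
  have h2 : T.Lang A := hF.left.2
  have h3 : T.Lang C := hC.left.1
  exact lang_eqE ⟨⟨h1, h3⟩, h2⟩ ⟨⟨h1, h2⟩, h3, h2⟩

theorem beta_self {k : ℕ} {α : Ty} {A : Expr κ α} (hA : T.Lang A) :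
    T ⊢ₚ Expr.lam k α (Expr.var k α) ⬝ A =ₑ A :=
  Provable.logic (IsAxiom.a4_2 k α A) (lang_eqE ⟨trivial, hA⟩ hA)

theorem beta_var {k : ℕ} {α : Ty} {m : ℕ} {β : Ty} {A : Expr κ α} (hA : T.Lang A)
    (h : ((k, α) : ℕ × Ty) ≠ (m, β)) :
    T ⊢ₚ Expr.lam k α (Expr.var m β) ⬝ A =ₑ Expr.var m β :=
  Provable.logic (IsAxiom.a4_1 k α m β A h) (lang_eqE ⟨trivial, hA⟩ trivial)

theorem beta_const {k : ℕ} {α : Ty} {β : Ty} {c : Const κ β} {A : Expr κ α} (hA : T.Lang A)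
    (hc : T.Lang (Expr.const c)) :
    T ⊢ₚ Expr.lam k α (Expr.const c) ⬝ A =ₑ Expr.const c :=
  Provable.logic (IsAxiom.a4_3 k α c A) (lang_eqE ⟨hc, hA⟩ hc)

theorem beta_lam_self {k : ℕ} {α β : Ty} {B : Expr κ β} {A : Expr κ α} (hA : T.Lang A)
    (hB : T.Lang B) :
    T ⊢ₚ Expr.lam k α (Expr.lam k α B) ⬝ A =ₑ Expr.lam k α B :=
  Provable.logic (IsAxiom.a4_6 k α B A) (lang_eqE ⟨hB, hA⟩ hB)

theorem beta_quote {k : ℕ} {α β : Ty} {B : Expr κ β} {A : Expr κ α} (hA : T.Lang A)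
    (hB : T.Lang (Expr.quote B)) :
    T ⊢ₚ Expr.lam k α (Expr.quote B) ⬝ A =ₑ Expr.quote B :=
  Provable.logic (IsAxiom.b9 k α B A) (lang_eqE ⟨hB, hA⟩ hB)

/-- The second alternative of `a4_5` concerns the body only, so any argument, even one with
evaluations, may pass the inner binders. -/
theorem beta_not_free {k : ℕ} {α γ : Ty} {B : Expr κ γ} (hB : EvalFree B)
    (hk : ¬ FreeIn k α B) (hL : T.Lang B) {A : Expr κ α} (hA : T.Lang A) :
    T ⊢ₚ Expr.lam k α B ⬝ A =ₑ B := by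
  induction B with
  | var n β => exact beta_var hA fun h => hk (by rw [Prod.mk.injEq] at h; exact ⟨h.1.symm, h.2.symm⟩)
  | const c => exact beta_const hA hL
  | app F C ihF ihC =>
    exact beta_app (ihF hB.1 (fun h => hk (Or.inl h)) hL.1) (ihC hB.2 (fun h => hk (Or.inr h)) hL.2)
  | lam n β B ih =>
    by_cases h : ((n, β) : ℕ × Ty) = (k, α)
    · obtain ⟨rfl, rfl⟩ := Prod.mk.inj h
      exact beta_lam_self hA hL
    · have hk' : ¬ FreeIn k α B := fun h' => hk ⟨h, h'⟩
      refine (Provable.logic (IsAxiom.a4_5 k α n β B A (fun e => h e.symm)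
        (Or.inr ⟨hB, hk'⟩)) ?_).trans ((ih hB hk' hL).lam n β)
      exact lang_eqE ⟨hL, hA⟩ ⟨hL, hA⟩
  | quote B => exact beta_quote hA hL
  | eval β B => exact hB.elim

theorem inert_of_evalFree {k : ℕ} {α γ : Ty} {X : Expr κ γ} (hX : EvalFree X)
    (hk : ¬ FreeIn k α X) (hL : T.Lang X) : T.Inert k α X where
  beta _ hA := beta_not_free hX hk hL hA
  pass m β A hne hA := Provable.logic (IsAxiom.a4_5 k α m β X A hne (Or.inr ⟨hX, hk⟩))
    (lang_eqE ⟨hL, hA⟩ ⟨hL, hA⟩)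

end Theory

/-- `Binds Q k α B`: every binder of `B` with a free occurrence of the variable `k` of type `α`
in its scope is the binder of a variable satisfying `Q`. -/
def Binds (Q : ℕ → Ty → Prop) (k : ℕ) (α : Ty) : {β : Ty} → Expr κ β → Prop
  | _, Expr.var _ _ => True
  | _, Expr.const _ => True
  | _, Expr.app F A => Binds Q k α F ∧ Binds Q k α A
  | _, Expr.lam m β B =>
      ((m, β) : ℕ × Ty) ≠ (k, α) → FreeIn k α B → Q m β ∧ Binds Q k α B
  | _, Expr.quote _ => True
  | _, Expr.eval _ _ => True

theorem Binds.mono {Q Q' : ℕ → Ty → Prop} {k : ℕ} {α β : Ty} {B : Expr κ β}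
    (h : Binds Q k α B) (hQ : ∀ m β, Q m β → Q' m β) : Binds Q' k α B := by
  induction B with
  | app F A ihF ihA => exact ⟨ihF h.1, ihA h.2⟩
  | lam m β B ih => exact fun h1 h2 => ⟨hQ _ _ (h h1 h2).1, ih (h h1 h2).2⟩
  | _ => trivial

namespace Theory

/-- A class of expressions, closed under substitution into eval-free expressions, in which the
variable `k` of type `α` is inert. -/
structure InertClass (T : Theory κ) (k : ℕ) (α : Ty) (R : (γ : Ty) → Expr κ γ → Prop) : Prop where
  inert : ∀ {γ : Ty} {X : Expr κ γ}, R γ X → T.Inert k α X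
  sub_mem : ∀ {γ : Ty} (B : Expr κ γ) (σ : Subst κ), EvalFree B → T.Lang B → T.LangS σ →
    (∀ p : ℕ × Ty, FreeIn p.1 p.2 B → R p.2 (σ p)) → R γ (sub σ B)
  var_mem : ∀ {m : ℕ} {β : Ty}, ((m, β) : ℕ × Ty) ≠ (k, α) → R β (Expr.var m β)

/-- Beta-reduction of a substitution instance of an eval-free expression. -/
theorem InertClass.beta {k : ℕ} {α : Ty} {R : (γ : Ty) → Expr κ γ → Prop}
    (hR : T.InertClass k α R) {A : Expr κ α} (hA : T.Lang A) {β : Ty} (B : Expr κ β)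
    (hB : EvalFree B) (hL : T.Lang B) (σ : Subst κ) (hσ : T.LangS σ)
    (hk : σ (k, α) = Expr.var k α)
    (hin : ∀ p : ℕ × Ty, p ≠ (k, α) → FreeIn p.1 p.2 B → R p.2 (σ p))
    (hpass : Binds (fun m γ => T.Pass m γ A) k α B) :
    T ⊢ₚ Expr.lam k α (sub σ B) ⬝ A =ₑ sub (σ.up k α A) B := by
  induction B generalizing σ with
  | var n β =>
    by_cases h : ((n, β) : ℕ × Ty) = (k, α)
    · obtain ⟨rfl, rfl⟩ := Prod.mk.inj h
      simp only [sub, hk, Subst.up_self]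
      exact beta_self hA
    · simp only [sub, Subst.up_ne _ _ h]
      exact (hR.inert (hin _ h ⟨rfl, rfl⟩)).beta A hA
  | const c => exact beta_const hA hL
  | app F C ihF ihC =>
    exact beta_app (ihF hB.1 hL.1 σ hσ hk (fun p h1 h2 => hin p h1 (Or.inl h2)) hpass.1)
      (ihC hB.2 hL.2 σ hσ hk (fun p h1 h2 => hin p h1 (Or.inr h2)) hpass.2)
  | lam m γ B ih =>
    have hσ' : T.LangS (σ.up m γ (Expr.var m γ)) := hσ.up trivial
    have hLs : T.Lang (sub (σ.up m γ (Expr.var m γ)) B) := sub_lang B hL _ hσ'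
    by_cases h : ((m, γ) : ℕ × Ty) = (k, α)
    · obtain ⟨rfl, rfl⟩ := Prod.mk.inj h
      simp only [sub, Subst.up_up]
      exact beta_lam_self hA hLs
    · have hin' : ∀ p : ℕ × Ty, p ≠ (k, α) → FreeIn p.1 p.2 B →
          R p.2 (σ.up m γ (Expr.var m γ) p) := by
        intro p h1 h2
        by_cases hp : p = (m, γ)
        · subst hp; rw [Subst.up_self]; exact hR.var_mem h
        · rw [Subst.up_ne _ _ hp]; exact hin p h1 ⟨fun e => hp e.symm, h2⟩
      have hk' : σ.up m γ (Expr.var m γ) (k, α) = Expr.var k α := by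
        rw [Subst.up_ne _ _ fun e => h e.symm, hk]
      simp only [sub]
      rw [Subst.up_comm _ (fun e => h e.symm)]
      -- A binder with the variable free in its scope is crossed because the argument may pass it.
      -- Otherwise the substituted body is inert and is crossed on its own account, with no
      -- condition on the argument.
      by_cases hf : FreeIn k α B
      · obtain ⟨hp, hb⟩ := hpass h hf
        exact (hp k _ (fun e => h e.symm) hLs hA).trans
          ((ih hB hL _ hσ' hk' hin' hb).lam m γ)
      · have hRs : R _ (sub (σ.up m γ (Expr.var m γ)) B) := by
          refine hR.sub_mem B _ hB hL hσ' fun p hp => hin' p (fun e => hf ?_) hp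
          subst e; exact hp
        refine ((hR.inert hRs).pass m γ A (fun e => h e.symm) hA).trans (Provable.lam ?_ m γ)
        rw [sub_congr B hB ((σ.up m γ (Expr.var m γ)).up k α A) (σ.up m γ (Expr.var m γ))
          fun p hp => Subst.up_ne _ _ fun e => hf (by subst e; exact hp)]
        exact (hR.inert hRs).beta A hA
  | quote C => exact beta_quote hA hL
  | eval β C => exact hB.elim

end Theory

theorem evalFree_sub {α : Ty} (B : Expr κ α) (hB : EvalFree B) (σ : Subst κ)
    (h : ∀ p : ℕ × Ty, FreeIn p.1 p.2 B → EvalFree (σ p)) : EvalFree (sub σ B) := by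
  induction B generalizing σ with
  | var n α => exact h (n, α) ⟨rfl, rfl⟩
  | const c => trivial
  | app F A ihF ihA =>
    exact ⟨ihF hB.1 σ fun p hp => h p (Or.inl hp), ihA hB.2 σ fun p hp => h p (Or.inr hp)⟩
  | lam n α B ih =>
    refine ih hB _ fun p hp => ?_
    by_cases hpn : p = (n, α)
    · subst hpn; simp only [Subst.up_self]; trivial
    · rw [Subst.up_ne _ _ hpn]; exact h p ⟨fun e => hpn e.symm, hp⟩
  | quote A => exact hB
  | eval β A => exact hB.elim

theorem not_freeIn_sub {k : ℕ} {γ : Ty} {α : Ty} (B : Expr κ α) (hB : EvalFree B) (σ : Subst κ)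
    (h : ∀ p : ℕ × Ty, FreeIn p.1 p.2 B → ¬ FreeIn k γ (σ p)) : ¬ FreeIn k γ (sub σ B) := by
  induction B generalizing σ with
  | var n α => exact h (n, α) ⟨rfl, rfl⟩
  | const c => exact id
  | app F A ihF ihA =>
    exact fun hf => hf.elim (ihF hB.1 σ fun p hp => h p (Or.inl hp))
      (ihA hB.2 σ fun p hp => h p (Or.inr hp))
  | lam n α B ih =>
    rintro ⟨hne, hf⟩
    refine ih hB _ (fun p hp => ?_) hf
    by_cases hpn : p = (n, α)
    · subst hpn; simp only [Subst.up_self]; exact fun e => hne (Prod.ext e.1 e.2)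
    · rw [Subst.up_ne _ _ hpn]; exact h p ⟨fun e => hpn e.symm, hp⟩
  | quote A => exact id
  | eval β A => exact hB.elim

namespace Theory

theorem inertClass_evalFree (T : Theory κ) (k : ℕ) (α : Ty) :
    T.InertClass k α fun _ X => EvalFree X ∧ ¬ FreeIn k α X ∧ T.Lang X where
  inert h := inert_of_evalFree h.1 h.2.1 h.2.2
  sub_mem B σ hB hL hσ h := ⟨evalFree_sub B hB σ fun p hp => (h p hp).1,
    not_freeIn_sub B hB σ fun p hp => (h p hp).2.1, sub_lang B hL σ hσ⟩
  var_mem h := ⟨trivial, fun e => h (Prod.ext e.1 e.2), trivial⟩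

/-- Beta-reduction for eval-free bodies. -/
theorem beta {k : ℕ} {α : Ty} {A : Expr κ α} (hA : T.Lang A) {β : Ty} (B : Expr κ β)
    (hB : EvalFree B) (hL : T.Lang B) (hpass : Binds (fun m γ => T.Pass m γ A) k α B) :
    T ⊢ₚ Expr.lam k α B ⬝ A =ₑ sub (idS.up k α A) B := by
  have := (T.inertClass_evalFree k α).beta hA B hB hL idS langS_idS rfl
    (fun p hp _ => ⟨trivial, fun e => hp (Prod.ext e.1 e.2), trivial⟩) hpass
  rwa [sub_idS] at this

end Theory
end CTTqe

namespace CTTqe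
variable {κ : Ty → Type u} {T : Theory κ}

/-! ## Computation rules for substitution and the syntactic predicates -/

@[simp] theorem idS_apply (n : ℕ) (α : Ty) : (idS : Subst κ) (n, α) = Expr.var n α := rfl

attribute [simp] Subst.up_self

@[simp] theorem Subst.up_ne' (σ : Subst κ) {n m : ℕ} {α β : Ty} (A : Expr κ α)
    (h : ¬ (((m, β) : ℕ × Ty) = (n, α))) : σ.up n α A (m, β) = σ (m, β) := Subst.up_ne _ _ h

theorem closed_truE (n : ℕ) (α : Ty) : ¬ FreeIn n α (truE : Expr κ oₜ) := by
  simp [FreeIn, truE, eqE]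

theorem closed_falE (n : ℕ) (α : Ty) : ¬ FreeIn n α (falE : Expr κ oₜ) := by
  simp only [FreeIn, falE, truE, eqE]; rintro ⟨⟩ <;> aesop

theorem closed_andC (n : ℕ) (α : Ty) : ¬ FreeIn n α (andC : Expr κ _) := by
  simp only [FreeIn, andC, truE, eqE]; aesop

theorem closed_impC (n : ℕ) (α : Ty) : ¬ FreeIn n α (impC : Expr κ _) := by
  have := closed_andC (κ := κ) n α
  simp only [FreeIn, impC, andE, eqE]; aesop

theorem closed_negC (n : ℕ) (α : Ty) : ¬ FreeIn n α (negC : Expr κ _) := by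
  have := closed_falE (κ := κ) n α
  simp only [FreeIn, negC]; aesop

theorem closed_orC (n : ℕ) (α : Ty) : ¬ FreeIn n α (orC : Expr κ _) := by
  have h1 := closed_andC (κ := κ) n α
  have h2 := closed_negC (κ := κ) n α
  simp only [FreeIn, orC, andE, negE]; aesop

section EvalFree
variable {α : Ty} {A B : Expr κ oₜ} {C D : Expr κ α}

theorem evalFree_truE : EvalFree (truE : Expr κ oₜ) := ⟨⟨trivial, trivial⟩, trivial⟩
theorem evalFree_falE : EvalFree (falE : Expr κ oₜ) := ⟨⟨trivial, evalFree_truE⟩, trivial⟩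
theorem evalFree_andC : EvalFree (andC : Expr κ _) := by simp [EvalFree, andC, truE, eqE]
theorem evalFree_impC : EvalFree (impC : Expr κ _) := by
  simp [EvalFree, impC, andE, eqE, evalFree_andC]
theorem evalFree_negC : EvalFree (negC : Expr κ _) := ⟨trivial, evalFree_falE⟩
theorem evalFree_orC : EvalFree (orC : Expr κ _) := by
  simp [EvalFree, orC, andE, negE, evalFree_andC, evalFree_negC]

@[simp] theorem evalFree_eqE : EvalFree (C =ₑ D) ↔ EvalFree C ∧ EvalFree D := by
  simp [EvalFree, eqE]
@[simp] theorem evalFree_andE : EvalFree (A ∧ₑ B) ↔ EvalFree A ∧ EvalFree B := by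
  simp [EvalFree, andE, evalFree_andC]
@[simp] theorem evalFree_impE : EvalFree (A ⊃ₑ B) ↔ EvalFree A ∧ EvalFree B := by
  simp [EvalFree, impE, evalFree_impC]
@[simp] theorem evalFree_negE : EvalFree (¬ₑ A) ↔ EvalFree A := by
  simp [EvalFree, negE, evalFree_negC]
@[simp] theorem evalFree_allE {n : ℕ} : EvalFree (allE n α A) ↔ EvalFree A := by
  simp [EvalFree, allE, evalFree_truE]

end EvalFree

attribute [simp] evalFree_truE evalFree_falE evalFree_andC evalFree_impC evalFree_negC evalFree_orC

section FreeIn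
variable {α β : Ty} {n : ℕ} {A B : Expr κ oₜ} {C D : Expr κ α}

attribute [simp] closed_truE closed_falE closed_andC closed_impC closed_negC closed_orC

@[simp] theorem freeIn_eqE : FreeIn n β (C =ₑ D) ↔ FreeIn n β C ∨ FreeIn n β D := by
  simp [FreeIn, eqE]
@[simp] theorem freeIn_andE : FreeIn n β (A ∧ₑ B) ↔ FreeIn n β A ∨ FreeIn n β B := by
  simp [FreeIn, andE]
@[simp] theorem freeIn_impE : FreeIn n β (A ⊃ₑ B) ↔ FreeIn n β A ∨ FreeIn n β B := by
  simp [FreeIn, impE]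
@[simp] theorem freeIn_negE : FreeIn n β (¬ₑ A) ↔ FreeIn n β A := by
  simp [FreeIn, negE]
@[simp] theorem freeIn_allE {m : ℕ} :
    FreeIn n β (allE m α A) ↔ ((m, α) : ℕ × Ty) ≠ (n, β) ∧ FreeIn n β A := by
  simp [FreeIn, allE]

end FreeIn

section Sub
variable {α : Ty} {n : ℕ} {A B : Expr κ oₜ} {C D : Expr κ α} (σ : Subst κ)

@[simp] theorem sub_truE : sub σ truE = truE := sub_closed _ evalFree_truE σ closed_truE
@[simp] theorem sub_falE : sub σ falE = falE := sub_closed _ evalFree_falE σ closed_falE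
@[simp] theorem sub_eqE : sub σ (C =ₑ D) = (sub σ C =ₑ sub σ D) := rfl
@[simp] theorem sub_andE : sub σ (A ∧ₑ B) = (sub σ A ∧ₑ sub σ B) := by
  simp only [andE, sub, sub_closed _ evalFree_andC σ closed_andC]
@[simp] theorem sub_impE : sub σ (A ⊃ₑ B) = (sub σ A ⊃ₑ sub σ B) := by
  simp only [impE, sub, sub_closed _ evalFree_impC σ closed_impC]
@[simp] theorem sub_orE : sub σ (A ∨ₑ B) = (sub σ A ∨ₑ sub σ B) := by
  simp only [orE, sub, sub_closed _ evalFree_orC σ closed_orC]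
@[simp] theorem sub_negE : sub σ (¬ₑ A) = (¬ₑ sub σ A) := by
  simp only [negE, sub, sub_closed _ evalFree_negC σ closed_negC]
@[simp] theorem sub_allE :
    sub σ (allE n α A) = allE n α (sub (σ.up n α (Expr.var n α)) A) := by
  simp only [allE, sub_eqE, sub, sub_truE]

end Sub

section Lang
variable {α : Ty} {n : ℕ} {A B : Expr κ oₜ} {C D : Expr κ α}

theorem lang_truE : T.Lang truE := Theory.lang_eqE (T.lang_eq _) (T.lang_eq _)
theorem lang_falE : T.Lang falE :=
  Theory.lang_eqE (A := Expr.lam xN oₜ truE) lang_truE (B := Expr.lam xN oₜ (Expr.var xN oₜ)) trivial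
theorem lang_andC : T.Lang andC := by
  have h1 := T.lang_eq ((oₜ ⟶ₜ oₜ ⟶ₜ oₜ) ⟶ₜ oₜ)
  have h2 := lang_truE (T := T)
  simp only [Theory.Lang, andC, eqE, InLang] at *; simp [h1, h2]
theorem lang_impC : T.Lang impC := by
  have h1 := T.lang_eq oₜ
  have h2 := lang_andC (T := T)
  simp only [Theory.Lang, impC, andE, eqE, InLang] at *; simp [h1, h2]
theorem lang_negC : T.Lang negC := ⟨T.lang_eq _, lang_falE⟩
theorem lang_orC : T.Lang orC := by
  have h1 := lang_negC (T := T)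
  have h2 := lang_andC (T := T)
  simp only [Theory.Lang, orC, andE, negE, InLang] at *; simp [h1, h2]

@[simp] theorem lang_const_eq : InLang T.consts (Expr.const (Const.eq α)) := T.lang_eq α
@[simp] theorem inLang_eqE_iff : InLang T.consts (C =ₑ D) ↔ T.Lang C ∧ T.Lang D :=
  ⟨inLang_eqE, fun h => Theory.lang_eqE h.1 h.2⟩
@[simp] theorem inLang_andE : InLang T.consts (A ∧ₑ B) ↔ T.Lang A ∧ T.Lang B :=
  ⟨fun h => ⟨h.1.2, h.2⟩, fun h => ⟨⟨lang_andC, h.1⟩, h.2⟩⟩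
@[simp] theorem inLang_impE : InLang T.consts (A ⊃ₑ B) ↔ T.Lang A ∧ T.Lang B :=
  ⟨fun h => ⟨h.1.2, h.2⟩, fun h => ⟨⟨lang_impC, h.1⟩, h.2⟩⟩
@[simp] theorem inLang_orE : InLang T.consts (A ∨ₑ B) ↔ T.Lang A ∧ T.Lang B :=
  ⟨fun h => ⟨h.1.2, h.2⟩, fun h => ⟨⟨lang_orC, h.1⟩, h.2⟩⟩
@[simp] theorem inLang_negE : InLang T.consts (¬ₑ A) ↔ T.Lang A :=
  ⟨fun h => h.2, fun h => ⟨lang_negC, h⟩⟩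
@[simp] theorem inLang_allE : InLang T.consts (allE n α A) ↔ T.Lang A :=
  ⟨fun h => (inLang_eqE h).2, fun h => Theory.lang_eqE (A := Expr.lam n α truE) lang_truE h⟩
@[simp] theorem inLang_lam {β : Ty} {B : Expr κ β} :
    InLang T.consts (Expr.lam n α B) ↔ T.Lang B := Iff.rfl
@[simp] theorem inLang_app {β : Ty} {F : Expr κ (α ⟶ₜ β)} :
    InLang T.consts (F ⬝ C) ↔ T.Lang F ∧ T.Lang C := Iff.rfl
@[simp] theorem inLang_var : InLang T.consts (Expr.var n α) ↔ True := Iff.rfl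
attribute [simp] lang_truE lang_falE lang_andC lang_impC lang_negC lang_orC

end Lang

/-! ## The propositional fragment -/

namespace Theory

theorem binds_of_forall {Q : ℕ → Ty → Prop} (hQ : ∀ m β, Q m β) {k : ℕ} {α β : Ty}
    (B : Expr κ β) : Binds Q k α B := by
  induction B with
  | app F A ihF ihA => exact ⟨ihF, ihA⟩
  | lam m β B ih => exact fun _ _ => ⟨hQ _ _, ih⟩
  | _ => trivial

theorem binds_of_not_free {Q : ℕ → Ty → Prop} {k : ℕ} {α β : Ty}
    (B : Expr κ β) (h : ¬ FreeIn k α B) : Binds Q k α B := by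
  induction B with
  | app F A ihF ihA => exact ⟨ihF fun e => h (Or.inl e), ihA fun e => h (Or.inr e)⟩
  | lam m β B ih => exact fun h1 h2 => (h ⟨h1, h2⟩).elim
  | _ => trivial

/-- Substitution of a closed eval-free expression. -/
theorem beta_closed {k : ℕ} {α : Ty} {A : Expr κ α} (hA : T.Lang A) (hE : EvalFree A)
    (hc : ∀ m β, ¬ FreeIn m β A) {β : Ty} (B : Expr κ β) (hB : EvalFree B) (hL : T.Lang B) :
    T ⊢ₚ Expr.lam k α B ⬝ A =ₑ sub (idS.up k α A) B :=
  beta hA B hB hL (binds_of_forall (fun m β => pass_of_evalFree hE (hc m β)) B)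

/-- An argument equal to the bound variable. -/
theorem beta_id {k : ℕ} {α β : Ty} (B : Expr κ β) (hB : EvalFree B) (hL : T.Lang B) :
    T ⊢ₚ Expr.lam k α B ⬝ Expr.var k α =ₑ B := by
  suffices h : Binds (fun m γ => T.Pass m γ (Expr.var k α : Expr κ α)) k α B by
    have := beta (T := T) (A := Expr.var k α) trivial B hB hL h
    rwa [idS_up, sub_idS] at this
  clear hB hL
  induction B with
  | app F A ihF ihA => exact ⟨ihF, ihA⟩
  | lam m β B ih =>
    exact fun h _ => ⟨pass_of_evalFree trivial fun e => h (Prod.ext e.1.symm e.2.symm), ih⟩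
  | _ => trivial

/-- As long as theorems are not known to be equations with truth, only equations can be
instantiated: both abstractions are applied to the argument. -/
theorem inst_eq {k : ℕ} {α : Ty} {A : Expr κ α} (hA : T.Lang A) {β : Ty} {B C : Expr κ β}
    (h : T ⊢ₚ B =ₑ C) (hB : EvalFree B) (hC : EvalFree C)
    (hpB : Binds (fun m γ => T.Pass m γ A) k α B) (hpC : Binds (fun m γ => T.Pass m γ A) k α C) :
    T ⊢ₚ sub (idS.up k α A) B =ₑ sub (idS.up k α A) C :=
  ((beta hA B hB h.left hpB).symm.trans ((h.lam k α).appL hA)).trans (beta hA C hC h.right hpC)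

theorem inst_eq_closed {k : ℕ} {α : Ty} {A : Expr κ α} (hA : T.Lang A) (hE : EvalFree A)
    (hc : ∀ m β, ¬ FreeIn m β A) {β : Ty} {B C : Expr κ β}
    (h : T ⊢ₚ B =ₑ C) (hB : EvalFree B) (hC : EvalFree C) :
    T ⊢ₚ sub (idS.up k α A) B =ₑ sub (idS.up k α A) C :=
  inst_eq hA h hB hC (binds_of_forall (fun m β => pass_of_evalFree hE (hc m β)) B)
    (binds_of_forall (fun m β => pass_of_evalFree hE (hc m β)) C)

theorem truth : T ⊢ₚ truE := refl (T.lang_eq _)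

theorem extensionality (α β : Ty) : T ⊢ₚ (fv (α ⟶ₜ β) =ₑ gv (α ⟶ₜ β)) =ₑ
    allE xN α (fv (α ⟶ₜ β) ⬝ xv α =ₑ gv (α ⟶ₜ β) ⬝ xv α) :=
  Provable.logic (IsAxiom.a3 α β) (by simp)

/-- Extensionality for the identity function turns id = id into λx.T = λx.(x = x), which is then
applied to `B`. -/
theorem truth_eq_self {β : Ty} {B : Expr κ β} (hB : T.Lang B) : T ⊢ₚ truE =ₑ (B =ₑ B) := by
  have hid : EvalFree (Expr.lam yN β (Expr.var yN β) : Expr κ (β ⟶ₜ β)) := trivial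
  have hcl : ∀ m γ, ¬ FreeIn m γ (Expr.lam yN β (Expr.var yN β) : Expr κ (β ⟶ₜ β)) := by
    simp only [FreeIn]; aesop
  have hL : T.Lang (Expr.lam yN β (Expr.var yN β) : Expr κ (β ⟶ₜ β)) := trivial
  have h1 := inst_eq_closed (k := fN) hL hid hcl (extensionality β β)
    (by simp [EvalFree]) (by simp [EvalFree])
  have h2 := inst_eq_closed (k := gN) hL hid hcl h1 (by simp [EvalFree, sub]) (by simp [EvalFree, sub])
  simp [sub] at h2
  have h3 := h2.mp (refl hL)
  have hb : T ⊢ₚ Expr.lam yN β (Expr.var yN β) ⬝ xv β =ₑ xv β := beta_self trivial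
  have h4 : T ⊢ₚ Expr.lam xN β truE =ₑ Expr.lam xN β (xv β =ₑ xv β) :=
    h3.trans ((hb.eq_congr hb).lam xN β)
  have h5 := h4.appL hB
  have h6 : T ⊢ₚ Expr.lam xN β (xv β =ₑ xv β) ⬝ B =ₑ (B =ₑ B) :=
    beta_app (beta_app (beta_const hB (T.lang_eq β)) (beta_self hB)) (beta_self hB)
  exact ((beta_not_free evalFree_truE (closed_truE _ _) lang_truE hB).symm.trans h5).trans h6

theorem truth_eq_of_eq {β : Ty} {A B : Expr κ β} (h : T ⊢ₚ A =ₑ B) : T ⊢ₚ truE =ₑ (A =ₑ B) :=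
  (truth_eq_self h.left).trans ((refl h.left).eq_congr h)

/-- This is `a1` with λx.B for g. The argument passes the quantifier over x because it is eval-free
and x is bound in it. -/
theorem truth_values (B : Expr κ oₜ) (hB : EvalFree B) (hL : T.Lang B) :
    T ⊢ₚ (sub (idS.up xN oₜ truE) B ∧ₑ sub (idS.up xN oₜ falE) B) =ₑ allE xN oₜ B := by
  have h : T ⊢ₚ (gv (oₜ ⟶ₜ oₜ) ⬝ truE ∧ₑ gv (oₜ ⟶ₜ oₜ) ⬝ falE) =ₑ
      allE xN oₜ (gv (oₜ ⟶ₜ oₜ) ⬝ xv oₜ) := Provable.logic IsAxiom.a1 (by simp)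
  have hG : T.Lang (Expr.lam xN oₜ B) := hL
  have h1 := inst_eq (k := gN) hG h (by simp [EvalFree]) (by simp [EvalFree])
    (by simp [Binds, andE, binds_of_not_free]) (by
      simp only [Binds, allE, eqE, closed_truE, true_and]
      refine ⟨fun _ h => h.elim, fun _ _ => ⟨pass_of_evalFree hB fun h => h.1 rfl, trivial⟩⟩)
  simp [sub] at h1
  have hb := beta_id (k := xN) (α := oₜ) B hB hL
  have hT := beta_closed (T := T) (k := xN) lang_truE evalFree_truE closed_truE B hB hL
  have hF := beta_closed (T := T) (k := xN) lang_falE evalFree_falE closed_falE B hB hL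
  refine (Provable.symm ?_).trans (h1.trans ((refl (A := Expr.lam xN oₜ truE) lang_truE).eq_congr
    (hb.lam xN oₜ)))
  exact ((refl lang_andC).app hT).app hF

theorem true_and_true : T ⊢ₚ (truE ∧ₑ truE) =ₑ truE := by
  have := truth_values (T := T) truE evalFree_truE lang_truE
  simp only [sub_truE] at this
  exact this.trans (truth_eq_self (B := Expr.lam xN oₜ truE) lang_truE).symm

/-- The case λx.x of `a1`, since ∀x.x is by definition F. -/
theorem true_and_false : T ⊢ₚ (truE ∧ₑ falE) =ₑ falE := by
  have := truth_values (T := T) (xv oₜ) trivial trivial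
  simp only [sub, Subst.up_self] at this
  exact this

theorem and_congr {A A' B B' : Expr κ oₜ} (h : T ⊢ₚ A =ₑ A') (h' : T ⊢ₚ B =ₑ B') :
    T ⊢ₚ (A ∧ₑ B) =ₑ (A' ∧ₑ B') := ((refl lang_andC).app h).app h'

theorem forall_of_truth_values (B : Expr κ oₜ) (hB : EvalFree B) (hL : T.Lang B)
    (hT : T ⊢ₚ truE =ₑ sub (idS.up xN oₜ truE) B) (hF : T ⊢ₚ truE =ₑ sub (idS.up xN oₜ falE) B) :
    T ⊢ₚ allE xN oₜ B :=
  (truth_values B hB hL).mp ((and_congr hT hF).mp (true_and_true.mpr truth))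

theorem spec {n : ℕ} {α : Ty} {B : Expr κ oₜ} (h : T ⊢ₚ allE n α B) {A : Expr κ α}
    (hA : T.Lang A) : T ⊢ₚ Expr.lam n α B ⬝ A := by
  have h1 : T ⊢ₚ Expr.lam n α truE ⬝ A =ₑ Expr.lam n α B ⬝ A := Provable.appL h hA
  exact ((beta_not_free evalFree_truE (closed_truE _ _) lang_truE hA).symm.trans h1).mp truth

/-- The law is proved for a variable by its two truth values. No binder stands over the variable
there, so a formula with evaluations may be substituted for it as well. -/
theorem true_and {A : Expr κ oₜ} (hA : T.Lang A) : T ⊢ₚ (truE ∧ₑ A) =ₑ A := by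
  have h := forall_of_truth_values (T := T) ((truE ∧ₑ xv oₜ) =ₑ xv oₜ) (by simp [EvalFree]) (by simp)
    (by simpa [sub] using truth_eq_of_eq true_and_true)
    (by simpa [sub] using truth_eq_of_eq true_and_false)
  have hb : T ⊢ₚ Expr.lam xN oₜ ((truE ∧ₑ xv oₜ) =ₑ xv oₜ) ⬝ A =ₑ ((truE ∧ₑ A) =ₑ A) := by
    have := beta (T := T) (k := xN) hA ((truE ∧ₑ xv oₜ) =ₑ xv oₜ) (by simp [EvalFree]) (by simp)
      (by simp [Binds, andE, eqE, binds_of_not_free])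
    simpa [sub] using this
  exact hb.mp (spec h hA)

/-- The formula ∀x.(T = x) is computed twice: by `a1` it equals (T = T) ∧ (T = F), that is T = F,
and by extensionality it equals λx.T = λx.x, which is F. -/
theorem true_eq_false : T ⊢ₚ (truE =ₑ falE) =ₑ (falE : Expr κ oₜ) := by
  have h := truth_values (T := T) (truE =ₑ xv oₜ) (by simp [EvalFree]) (by simp)
  simp [sub] at h
  have hL : T.Lang (truE =ₑ falE : Expr κ oₜ) := lang_eqE lang_truE lang_falE
  have h1 : T ⊢ₚ (truE =ₑ falE) =ₑ allE xN oₜ (truE =ₑ xv oₜ) :=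
    (true_and hL).symm.trans ((and_congr (truth_eq_self lang_truE) (refl hL)).trans h)
  have e1 := inst_eq_closed (T := T) (k := fN) (A := Expr.lam xN oₜ truE) (by simp) (by simp [EvalFree])
    (by simp [FreeIn]) (extensionality oₜ oₜ) (by simp [EvalFree]) (by simp [EvalFree])
  simp [sub] at e1
  have e2 := inst_eq_closed (T := T) (k := gN) (A := Expr.lam xN oₜ (xv oₜ)) (by simp)
    (by simp [EvalFree]) (by simp only [FreeIn]; aesop) e1 (by simp [EvalFree]) (by simp [EvalFree])
  simp [sub] at e2
  have b1 : T ⊢ₚ Expr.lam xN oₜ truE ⬝ xv oₜ =ₑ truE :=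
    beta_not_free evalFree_truE (closed_truE _ _) lang_truE trivial
  have b2 : T ⊢ₚ Expr.lam xN oₜ (xv oₜ) ⬝ xv oₜ =ₑ xv oₜ := beta_self trivial
  have e3 := e2.trans ((refl (A := Expr.lam xN oₜ truE) lang_truE).eq_congr
    ((b1.eq_congr b2).lam xN oₜ))
  exact h1.trans e3.symm

theorem true_eq {A : Expr κ oₜ} (hA : T.Lang A) : T ⊢ₚ (truE =ₑ A) =ₑ A := by
  have h := forall_of_truth_values (T := T) ((truE =ₑ xv oₜ) =ₑ xv oₜ) (by simp [EvalFree]) (by simp)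
    (by simpa [sub] using truth_eq_of_eq (truth_eq_self lang_truE).symm)
    (by simpa [sub] using truth_eq_of_eq true_eq_false)
  have hb : T ⊢ₚ Expr.lam xN oₜ ((truE =ₑ xv oₜ) =ₑ xv oₜ) ⬝ A =ₑ ((truE =ₑ A) =ₑ A) := by
    have := beta (T := T) (k := xN) hA ((truE =ₑ xv oₜ) =ₑ xv oₜ) (by simp [EvalFree]) (by simp)
      (by simp [Binds, eqE, binds_of_not_free])
    simpa [sub] using this
  exact hb.mp (spec h hA)

theorem truth_eq {A : Expr κ oₜ} (h : T ⊢ₚ A) : T ⊢ₚ truE =ₑ A := (true_eq h.lang).mpr h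

theorem of_truth_eq {A : Expr κ oₜ} (h : T ⊢ₚ truE =ₑ A) : T ⊢ₚ A := h.mp truth

/-- A theorem A amounts to the equation T = A, and Rule R works under abstractions; hence there is
no restriction on A. -/
theorem gen {A : Expr κ oₜ} (h : T ⊢ₚ A) (n : ℕ) (α : Ty) : T ⊢ₚ allE n α A :=
  (truth_eq h).lam n α

/-- Where evaluations prevent the computation of a substitution, the redex takes its place and is
still a theorem. -/
theorem lam_app {A : Expr κ oₜ} (h : T ⊢ₚ A) (n : ℕ) {α : Ty} {B : Expr κ α} (hB : T.Lang B) :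
    T ⊢ₚ Expr.lam n α A ⬝ B := spec (gen h n α) hB

/-- Substitution into an eval-free theorem. -/
theorem inst {k : ℕ} {α : Ty} {A : Expr κ α} (hA : T.Lang A) {B : Expr κ oₜ}
    (h : T ⊢ₚ B) (hB : EvalFree B) (hp : Binds (fun m γ => T.Pass m γ A) k α B) :
    T ⊢ₚ sub (idS.up k α A) B := (beta hA B hB h.lang hp).mp (lam_app h k hA)

theorem inst_closed {k : ℕ} {α : Ty} {A : Expr κ α} (hA : T.Lang A) (hE : EvalFree A)
    (hc : ∀ m β, ¬ FreeIn m β A) {B : Expr κ oₜ} (h : T ⊢ₚ B) (hB : EvalFree B) :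
    T ⊢ₚ sub (idS.up k α A) B :=
  inst hA h hB (binds_of_forall (fun m β => pass_of_evalFree hE (hc m β)) B)

theorem true_imp {A : Expr κ oₜ} (hA : T.Lang A) : T ⊢ₚ (truE ⊃ₑ A) =ₑ A := by
  have h1 := beta_closed (T := T) (k := xN) lang_truE evalFree_truE closed_truE
    (Expr.lam yN oₜ (Expr.var xN oₜ =ₑ (Expr.var xN oₜ ∧ₑ Expr.var yN oₜ)))
    (by simp [EvalFree]) (by simp)
  simp [sub] at h1
  have h2 := beta (T := T) (k := yN) hA (truE =ₑ (truE ∧ₑ Expr.var yN oₜ)) (by simp [EvalFree])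
    (by simp) (by simp [Binds, eqE, andE, binds_of_not_free])
  simp [sub] at h2
  exact ((h1.appL hA).trans h2).trans ((true_eq (by simp [hA])).trans (true_and hA))

theorem imp_congr {A A' B B' : Expr κ oₜ} (h : T ⊢ₚ A =ₑ A') (h' : T ⊢ₚ B =ₑ B') :
    T ⊢ₚ (A ⊃ₑ B) =ₑ (A' ⊃ₑ B') := ((refl lang_impC).app h).app h'

theorem modus_ponens {A B : Expr κ oₜ} (h : T ⊢ₚ (A ⊃ₑ B)) (hA : T ⊢ₚ A) : T ⊢ₚ B := by
  have hB : T.Lang B := h.lang.2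
  exact (((imp_congr (truth_eq hA) (refl hB)).symm).trans (true_imp hB)).mp h

end Theory
end CTTqe

/-! ### Case analysis on truth values -/

namespace CTTqe
variable {κ : Ty → Type u} {T : Theory κ}

namespace Theory

/-- Instantiation of a variable that does not occur under binders. -/
theorem inst_unbound {k : ℕ} {α : Ty} {A : Expr κ α} (hA : T.Lang A) {B : Expr κ oₜ}
    (h : T ⊢ₚ B) (hB : EvalFree B) (hp : Binds (fun _ _ => False) k α B) :
    T ⊢ₚ sub (idS.up k α A) B := inst hA h hB (hp.mono fun _ _ h => h.elim)

theorem eta_var (α β : Ty) : T ⊢ₚ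
    Expr.lam xN α (gv (α ⟶ₜ β) ⬝ xv α) =ₑ gv (α ⟶ₜ β) := by
  have h := inst (T := T) (k := fN) (A := Expr.lam xN α (gv (α ⟶ₜ β) ⬝ xv α)) (by simp)
    (extensionality α β) (by simp [EvalFree]) (by
      simp only [Binds, allE, eqE, closed_truE, _root_.true_and]
      exact ⟨fun _ h => h.elim, fun _ _ => ⟨pass_of_evalFree (by simp [EvalFree])
        fun h => h.1 rfl, trivial⟩⟩)
  simp [sub] at h
  refine h.mpr (gen ?_ _ _)
  exact beta_id (gv (α ⟶ₜ β) ⬝ xv α) ⟨trivial, trivial⟩ (by simp)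

/-- The η-reduced form of `a1` has no binder over g, so that functions with evaluations may be
substituted. -/
theorem truth_values_pointfree {G : Expr κ (oₜ ⟶ₜ oₜ)} (hG : T.Lang G) :
    T ⊢ₚ (G ⬝ truE ∧ₑ G ⬝ falE) =ₑ (Expr.lam xN oₜ truE =ₑ G) := by
  have h : T ⊢ₚ (gv (oₜ ⟶ₜ oₜ) ⬝ truE ∧ₑ gv (oₜ ⟶ₜ oₜ) ⬝ falE) =ₑ
      allE xN oₜ (gv (oₜ ⟶ₜ oₜ) ⬝ xv oₜ) := Provable.logic IsAxiom.a1 (by simp)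
  have h1 := h.trans ((refl (T := T) (A := Expr.lam xN oₜ truE) lang_truE).eq_congr (eta_var oₜ oₜ))
  have h2 := inst_unbound (k := gN) hG h1 (by simp [EvalFree])
    (by simp [Binds, andE, eqE, binds_of_not_free])
  simpa [sub] using h2

/-- The rule of cases. -/
theorem cases {G : Expr κ (oₜ ⟶ₜ oₜ)} (hT : T ⊢ₚ G ⬝ truE) (hF : T ⊢ₚ G ⬝ falE) {A : Expr κ oₜ}
    (hA : T.Lang A) : T ⊢ₚ G ⬝ A := by
  have h := (truth_values_pointfree hT.lang.1).mp
    ((and_congr (truth_eq hT) (truth_eq hF)).mp (true_and_true.mpr truth))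
  exact of_truth_eq
    ((beta_not_free evalFree_truE (closed_truE _ _) lang_truE hA).symm.trans (h.appL hA))

/-- Beta-reduction with the bound variable as argument, for all expressions. -/
theorem beta_same {k : ℕ} {α β : Ty} (B : Expr κ β) (hB : T.Lang B) :
    T ⊢ₚ Expr.lam k α B ⬝ Expr.var k α =ₑ B := by
  induction B with
  | var n β =>
    by_cases h : ((k, α) : ℕ × Ty) = (n, β)
    · obtain ⟨rfl, rfl⟩ := Prod.mk.inj h; exact beta_self trivial
    · exact beta_var trivial h
  | const c => exact beta_const trivial hB
  | app F A ihF ihA => exact beta_app (ihF hB.1) (ihA hB.2)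
  | lam n β B ih =>
    by_cases h : ((k, α) : ℕ × Ty) = (n, β)
    · obtain ⟨rfl, rfl⟩ := Prod.mk.inj h; exact beta_lam_self trivial hB
    · exact (pass_of_evalFree (m := n) (β := β) (A := (Expr.var k α : Expr κ α)) trivial
        (fun e => h (Prod.ext e.1 e.2)) k B h hB trivial).trans ((ih hB).lam n β)
  | quote B => exact beta_quote trivial hB
  | eval β B => exact Provable.logic (IsAxiom.b11_1 k α β B) (lang_eqE ⟨hB, trivial⟩ hB)

/-- Cases are applied to λk.M at k itself; this redex reduces to M for every M, although a general
substitution for k in M could not be computed. -/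
theorem of_lam_cases {k : ℕ} {M : Expr κ oₜ} (hT : T ⊢ₚ Expr.lam k oₜ M ⬝ truE)
    (hF : T ⊢ₚ Expr.lam k oₜ M ⬝ falE) : T ⊢ₚ M :=
  (beta_same M hT.lang.1).mp (cases hT hF (A := Expr.var k oₜ) trivial)

/-- F is the equation λx.T = λx.x, and Leibniz' law for the predicate λf.(f A) turns it into T = A.
-/
theorem false_imp_closed {A : Expr κ oₜ} (hA : T.Lang A) (hE : EvalFree A)
    (hc : ∀ m β, ¬ FreeIn m β A) : T ⊢ₚ (falE ⊃ₑ (truE =ₑ A)) := by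
  have h : T ⊢ₚ (xv (oₜ ⟶ₜ oₜ) =ₑ yv (oₜ ⟶ₜ oₜ) ⊃ₑ
      hv ((oₜ ⟶ₜ oₜ) ⟶ₜ oₜ) ⬝ xv (oₜ ⟶ₜ oₜ) =ₑ hv ((oₜ ⟶ₜ oₜ) ⟶ₜ oₜ) ⬝ yv (oₜ ⟶ₜ oₜ)) :=
    Provable.logic (IsAxiom.a2 (oₜ ⟶ₜ oₜ)) (by simp)
  have hl : T.Lang (Expr.lam fN (oₜ ⟶ₜ oₜ) (fv (oₜ ⟶ₜ oₜ) ⬝ A)) := ⟨trivial, hA⟩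
  have h1 := inst_unbound (k := hN) hl h (by simp [EvalFree])
    (by simp [Binds, eqE, impE, binds_of_not_free])
  have hs : ∀ σ, sub σ A = A := fun σ => sub_closed A hE σ hc
  simp [sub] at h1
  have h2 := inst_unbound (k := xN) (A := Expr.lam xN oₜ truE) (by simp) h1 (by simp [EvalFree, hE])
    (by simp [Binds, eqE, impE, binds_of_not_free, FreeIn, hc])
  simp [sub, hs] at h2
  have h3 := inst_unbound (k := yN) (A := Expr.lam xN oₜ (xv oₜ)) (by simp) h2
    (by simp [EvalFree, hE]) (by simp [Binds, eqE, impE, binds_of_not_free, FreeIn, hc])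
  simp [sub, hs] at h3
  have b1 : ∀ {B : Expr κ (oₜ ⟶ₜ oₜ)} {C : Expr κ oₜ}, T ⊢ₚ B ⬝ A =ₑ C →
      T ⊢ₚ Expr.lam fN (oₜ ⟶ₜ oₜ) (fv (oₜ ⟶ₜ oₜ) ⬝ A) ⬝ B =ₑ C := fun hB =>
    (beta_app (beta_self hB.left.1) (beta_not_free hE (hc _ _) hA hB.left.1)).trans hB
  exact (imp_congr (refl lang_falE) ((b1 (beta_not_free evalFree_truE (closed_truE _ _) lang_truE hA)).eq_congr
    (b1 (beta_self hA)))).mp h3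

theorem imp_unfold_closed {A : Expr κ oₜ} (hA : T.Lang A) (hE : EvalFree A)
    (hc : ∀ m β, ¬ FreeIn m β A) {B : Expr κ oₜ} (hB : T.Lang B) :
    T ⊢ₚ (A ⊃ₑ B) =ₑ (A =ₑ (A ∧ₑ B)) := by
  have h1 := beta_closed (T := T) (k := xN) hA hE hc
    (Expr.lam yN oₜ (Expr.var xN oₜ =ₑ (Expr.var xN oₜ ∧ₑ Expr.var yN oₜ)))
    (by simp [EvalFree]) (by simp)
  simp [sub] at h1
  have h2 := beta (T := T) (k := yN) hB (A =ₑ (A ∧ₑ Expr.var yN oₜ)) (by simp [EvalFree, hE])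
    (by simp [hA]) (by simp [Binds, eqE, andE, binds_of_not_free, hc])
  simp [sub, sub_closed A hE _ hc] at h2
  exact (h1.appL hB).trans h2

theorem false_and_true : T ⊢ₚ (falE ∧ₑ truE) =ₑ (falE : Expr κ oₜ) :=
  ((imp_unfold_closed lang_falE evalFree_falE closed_falE lang_truE).mp
    ((imp_congr (refl lang_falE) (truth_eq_self lang_truE).symm).mp
      (false_imp_closed lang_truE evalFree_truE closed_truE))).symm

theorem false_and_false : T ⊢ₚ (falE ∧ₑ falE) =ₑ (falE : Expr κ oₜ) :=
  ((imp_unfold_closed lang_falE evalFree_falE closed_falE lang_falE).mp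
    ((imp_congr (refl lang_falE) true_eq_false).mp
      (false_imp_closed lang_falE evalFree_falE closed_falE))).symm

/-- Leibniz' law for λz.(z = F) turns F = T into (F = F) = (T = F), which reduces to F. Hence (F =
T) ⊃ F, that is, F = T equals (F = T) ∧ F, and a conjunction with F is F. -/
theorem false_eq_true : T ⊢ₚ (falE =ₑ truE) =ₑ (falE : Expr κ oₜ) := by
  have h : T ⊢ₚ (xv oₜ =ₑ yv oₜ ⊃ₑ hv (oₜ ⟶ₜ oₜ) ⬝ xv oₜ =ₑ hv (oₜ ⟶ₜ oₜ) ⬝ yv oₜ) :=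
    Provable.logic (IsAxiom.a2 oₜ) (by simp)
  have h1 := inst_unbound (k := hN) (A := Expr.lam zN oₜ (zv oₜ =ₑ falE)) (by simp) h
    (by simp [EvalFree]) (by simp [Binds, eqE, impE, binds_of_not_free])
  simp [sub] at h1
  have h2 := inst_unbound (k := xN) (A := falE) (by simp) h1 (by simp [EvalFree])
    (by simp [Binds, eqE, impE, binds_of_not_free, FreeIn])
  simp [sub] at h2
  have h3 := inst_unbound (k := yN) (A := truE) (by simp) h2 (by simp [EvalFree])
    (by simp [Binds, eqE, impE, binds_of_not_free, FreeIn])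
  simp [sub] at h3
  have b : ∀ {B : Expr κ oₜ}, T.Lang B → T ⊢ₚ Expr.lam zN oₜ (zv oₜ =ₑ falE) ⬝ B =ₑ (B =ₑ falE) :=
    fun hB => beta_app (beta_app (beta_const hB (T.lang_eq _)) (beta_self hB))
      (beta_not_free evalFree_falE (closed_falE _ _) lang_falE hB)
  have h4 : T ⊢ₚ ((falE =ₑ truE) ⊃ₑ falE) := (imp_congr (refl (lang_eqE lang_falE lang_truE))
    ((((b lang_falE).trans (truth_eq_self lang_falE).symm).eq_congr
      ((b lang_truE).trans true_eq_false)).trans true_eq_false)).mp h3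
  have hL : T.Lang (falE =ₑ truE : Expr κ oₜ) := lang_eqE lang_falE lang_truE
  have h5 := (imp_unfold_closed hL (by simp) (by simp) lang_falE).mp h4
  refine h5.trans ?_
  have h6 := forall_of_truth_values (T := T) ((xv oₜ ∧ₑ falE) =ₑ falE) (by simp [EvalFree]) (by simp)
    (by simpa [sub] using truth_eq true_and_false)
    (by simpa [sub] using truth_eq false_and_false)
  have h7 := inst_closed (k := xN) hL (by simp) (by simp)
    ((beta_id ((xv oₜ ∧ₑ falE) =ₑ falE) (by simp [EvalFree]) (by simp)).mp
      (spec h6 (A := xv oₜ) trivial)) (by simp [EvalFree])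
  simpa [sub] using h7

/-- Truth values as expressions. -/
def _root_.CTTqe.boolE (b : Bool) : Expr κ oₜ := if b then truE else falE

@[simp] theorem lang_boolE (b : Bool) : InLang T.consts (boolE b) := by cases b <;> simp [boolE]
@[simp] theorem evalFree_boolE (b : Bool) : EvalFree (boolE b : Expr κ oₜ) := by
  cases b <;> simp [boolE]
@[simp] theorem closed_boolE (b : Bool) (n : ℕ) (α : Ty) : ¬ FreeIn n α (boolE b : Expr κ oₜ) := by
  cases b <;> simp [boolE]

theorem and_bool (a b : Bool) : T ⊢ₚ (boolE a ∧ₑ boolE b) =ₑ boolE (a && b) := by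
  cases a <;> cases b
  · exact false_and_false
  · exact false_and_true
  · exact true_and_false
  · exact true_and_true

theorem eq_bool (a b : Bool) : T ⊢ₚ (boolE a =ₑ boolE b) =ₑ boolE (a == b) := by
  cases a <;> cases b
  · exact (truth_eq_self lang_falE).symm
  · exact false_eq_true
  · exact true_eq_false
  · exact (truth_eq_self lang_truE).symm

theorem neg_bool (a : Bool) : T ⊢ₚ (¬ₑ boolE a) =ₑ boolE (!a) := by
  have := eq_bool (T := T) false a
  cases a <;> exact this

theorem imp_bool (a b : Bool) : T ⊢ₚ (boolE a ⊃ₑ boolE b) =ₑ boolE (!a || b) := by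
  have h1 := imp_unfold_closed (T := T) (lang_boolE a) (evalFree_boolE a) (closed_boolE a)
    (lang_boolE b)
  have h2 := (h1.trans ((refl (lang_boolE a)).eq_congr (and_bool a b))).trans (eq_bool a (a && b))
  cases a <;> cases b <;> exact h2

theorem neg_congr {A A' : Expr κ oₜ} (h : T ⊢ₚ A =ₑ A') : T ⊢ₚ (¬ₑ A) =ₑ (¬ₑ A') :=
  (refl lang_negC).app h

theorem or_congr {A A' B B' : Expr κ oₜ} (h : T ⊢ₚ A =ₑ A') (h' : T ⊢ₚ B =ₑ B') :
    T ⊢ₚ (A ∨ₑ B) =ₑ (A' ∨ₑ B') := ((refl lang_orC).app h).app h'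

theorem or_bool (a b : Bool) : T ⊢ₚ (boolE a ∨ₑ boolE b) =ₑ boolE (a || b) := by
  have hs : ∀ (c : Bool) (σ : Subst κ), sub σ (boolE c) = boolE c := fun c σ =>
    sub_closed _ (evalFree_boolE c) σ (closed_boolE c)
  have h1 := beta_closed (T := T) (k := xN) (lang_boolE a) (evalFree_boolE a) (closed_boolE a)
    (Expr.lam yN oₜ (¬ₑ (¬ₑ Expr.var xN oₜ ∧ₑ ¬ₑ Expr.var yN oₜ)))
    (by simp [EvalFree]) (by simp)
  simp [sub] at h1
  have h2 := beta_closed (T := T) (k := yN) (lang_boolE b) (evalFree_boolE b) (closed_boolE b)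
    (¬ₑ (¬ₑ boolE a ∧ₑ ¬ₑ Expr.var yN oₜ)) (by simp [EvalFree]) (by simp)
  simp [sub, hs] at h2
  have h3 := ((h1.appL (lang_boolE b)).trans h2).trans
    ((neg_congr ((and_congr (neg_bool a) (neg_bool b)).trans (and_bool _ _))).trans (neg_bool _))
  cases a <;> cases b <;> exact h3

end Theory

/-! ## Tautologies -/

/-- Propositional schemata. -/
inductive PropForm where
  | atom (i : ℕ)
  | tru
  | fls
  | neg (p : PropForm)
  | and (p q : PropForm)
  | or (p q : PropForm)
  | imp (p q : PropForm)
  | iff (p q : PropForm)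

namespace PropForm

/-- The formula resulting from a schema by filling in formulas for its atoms. -/
def toExpr (A : ℕ → Expr κ oₜ) : PropForm → Expr κ oₜ
  | atom i => A i
  | tru => truE
  | fls => falE
  | neg p => ¬ₑ p.toExpr A
  | and p q => p.toExpr A ∧ₑ q.toExpr A
  | or p q => p.toExpr A ∨ₑ q.toExpr A
  | imp p q => p.toExpr A ⊃ₑ q.toExpr A
  | iff p q => p.toExpr A =ₑ q.toExpr A

/-- The truth value of a schema. -/
def value (v : ℕ → Bool) : PropForm → Bool
  | atom i => v i
  | tru => true
  | fls => false
  | neg p => !p.value v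
  | and p q => p.value v && q.value v
  | or p q => p.value v || q.value v
  | imp p q => !p.value v || q.value v
  | iff p q => p.value v == q.value v

theorem toExpr_bool (v : ℕ → Bool) (p : PropForm) :
    T ⊢ₚ p.toExpr (fun i => boolE (v i)) =ₑ boolE (p.value v) := by
  induction p with
  | atom i => exact Theory.refl (Theory.lang_boolE _)
  | tru => exact Theory.refl lang_truE
  | fls => exact Theory.refl lang_falE
  | neg p ih => exact (Theory.neg_congr ih).trans (Theory.neg_bool _)
  | and p q ih ih' => exact (Theory.and_congr ih ih').trans (Theory.and_bool _ _)
  | or p q ih ih' => exact (Theory.or_congr ih ih').trans (Theory.or_bool _ _)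
  | imp p q ih ih' => exact (Theory.imp_congr ih ih').trans (Theory.imp_bool _ _)
  | iff p q ih ih' => exact (ih.eq_congr ih').trans (Theory.eq_bool _ _)

theorem toExpr_beta {k : ℕ} {α : Ty} {C : Expr κ α} (hC : T.Lang C) {A B : ℕ → Expr κ oₜ}
    (h : ∀ i, T ⊢ₚ Expr.lam k α (A i) ⬝ C =ₑ B i) (p : PropForm) :
    T ⊢ₚ Expr.lam k α (p.toExpr A) ⬝ C =ₑ p.toExpr B := by
  have hc : ∀ {γ : Ty} {X : Expr κ γ}, EvalFree X → (∀ m β, ¬ FreeIn m β X) → T.Lang X →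
      T ⊢ₚ Expr.lam k α X ⬝ C =ₑ X := fun h1 h2 h3 => Theory.beta_not_free h1 (h2 _ _) h3 hC
  induction p with
  | atom i => exact h i
  | tru => exact hc evalFree_truE closed_truE lang_truE
  | fls => exact hc evalFree_falE closed_falE lang_falE
  | neg p ih => exact Theory.beta_app (hc (by simp) (by simp) (by simp)) ih
  | and p q ih ih' =>
    exact Theory.beta_app (Theory.beta_app (hc (by simp) (by simp) (by simp)) ih) ih'
  | or p q ih ih' =>
    exact Theory.beta_app (Theory.beta_app (hc (by simp) (by simp) (by simp)) ih) ih'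
  | imp p q ih ih' =>
    exact Theory.beta_app (Theory.beta_app (hc (by simp) (by simp) (by simp)) ih) ih'
  | iff p q ih ih' =>
    exact Theory.beta_app (Theory.beta_app (Theory.beta_const hC (T.lang_eq _)) ih) ih'

/-- Check of all assignments that agree with `v` from `n` on. -/
def check (p : PropForm) : ℕ → (ℕ → Bool) → Bool
  | 0, v => p.value v
  | n + 1, v => p.check n (fun i => if i = n then true else v i) &&
      p.check n (fun i => if i = n then false else v i)

theorem value_of_check (p : PropForm) (n : ℕ) (v w : ℕ → Bool) (h : p.check n v = true)
    (hw : ∀ i, n ≤ i → w i = v i) : p.value w = true := by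
  induction n generalizing v with
  | zero => rwa [show w = v from funext fun i => hw i (Nat.zero_le i)]
  | succ n ih =>
    simp only [check, Bool.and_eq_true] at h
    cases hn : w n
    · refine ih _ h.2 fun i hi => ?_
      split_ifs with h'
      · rw [h', hn]
      · exact hw i (by omega)
    · refine ih _ h.1 fun i hi => ?_
      split_ifs with h'
      · rw [h', hn]
      · exact hw i (by omega)

/-- The atoms below `j` are turned one at a time into the variable `k` and then into both truth
values. As the remaining atoms are unaffected by substitution for `k`, the same variable serves for
each of them. -/
theorem provable_of_inert {k : ℕ} (p : PropForm) (n : ℕ)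
    (hp : p.check n (fun _ => true) = true) (j : ℕ)
    (A : ℕ → Expr κ oₜ) (hA : ∀ i, T.Lang (A i))
    (hk : ∀ i, ∀ C : Expr κ oₜ, T.Lang C → T ⊢ₚ Expr.lam k oₜ (A i) ⬝ C =ₑ A i)
    (hj : ∀ i, j ≤ i → ∃ b, A i = boolE b) (hn : ∀ i, n ≤ i → A i = truE) (hjn : j ≤ n) :
    T ⊢ₚ p.toExpr A := by
  induction j generalizing A with
  | zero =>
    choose v hv using fun i => hj i (Nat.zero_le i)
    obtain rfl : A = fun i => boolE (v i) := funext hv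
    have h := toExpr_bool (T := T) v p
    -- From `n` on the atoms are the default `truE`, which gives them the values of the assignment
    -- from which `check` starts.
    rw [value_of_check p n _ v hp fun i hi => by
      have := hn i hi
      cases hv : v i
      · simp [hv, boolE, truE, falE, eqE] at this
      · rfl] at h
    exact h.mpr Theory.truth
  | succ j ih =>
    have key : ∀ C : Expr κ oₜ, T.Lang C →
        T ⊢ₚ Expr.lam k oₜ (p.toExpr (Function.update A j (Expr.var k oₜ))) ⬝ C =ₑ
          p.toExpr (Function.update A j C) := by
      intro C hC
      refine toExpr_beta hC (fun i => ?_) p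
      by_cases h : i = j
      · subst h; simpa using Theory.beta_self hC
      · simpa [h] using hk i C hC
    have hb : ∀ b, T ⊢ₚ p.toExpr (Function.update A j (boolE b)) := by
      intro b
      refine ih _ (fun i => ?_) (fun i C hC => ?_) (fun i hi => ?_) (fun i hi => ?_) (by omega)
      · by_cases h : i = j
        · subst h; simp
        · simpa [h] using hA i
      · by_cases h : i = j
        · subst h
          simpa using Theory.beta_not_free (Theory.evalFree_boolE b) (Theory.closed_boolE b _ _)
            (Theory.lang_boolE b) hC
        · simpa [h] using hk i C hC
      · by_cases h : i = j
        · subst h; exact ⟨b, by simp⟩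
        · simpa [h] using hj i (by omega)
      · rw [Function.update_of_ne (by omega)]; exact hn i hi
    have := (key (A j) (hA j)).mp (Theory.cases ((key truE lang_truE).mpr (hb true))
      ((key falE lang_falE).mpr (hb false)) (hA j))
    rwa [Function.update_eq_self] at this

/-- Substitution instances of tautologies are theorems. -/
theorem provable (p : PropForm) (L : List (Expr κ oₜ)) (hL : ∀ A ∈ L, T.Lang A)
    (hp : p.check L.length (fun _ => true) = true := by rfl) : T ⊢ₚ p.toExpr fun i => L.getD i truE := by
  have hlang : ∀ i, T.Lang (L.getD i truE) := fun i => by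
    by_cases h : i < L.length
    · rw [List.getD_eq_getElem _ _ h]; exact hL _ (List.getElem_mem h)
    · rw [List.getD_eq_default _ _ (by omega)]; exact lang_truE
  -- The variable 0 may be effective in the given formulas. After a case distinction on it they
  -- become (λ0.A)b, and in these it is inert by `a4_6`.
  have key : ∀ b : Bool, T ⊢ₚ Expr.lam 0 oₜ (p.toExpr fun i => L.getD i truE) ⬝ boolE b := by
    intro b
    refine (toExpr_beta (Theory.lang_boolE b) (B := fun i => if i < L.length then
      Expr.lam 0 oₜ (L.getD i truE) ⬝ boolE b else truE) (fun i => ?_) p).mpr ?_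
    · by_cases h : i < L.length
      · simp only [h, if_true]
        exact Theory.refl ⟨hlang i, Theory.lang_boolE b⟩
      · simp only [h, if_false]
        rw [List.getD_eq_default _ _ (by omega)]
        exact Theory.beta_not_free (by simp) (by simp) (by simp) (Theory.lang_boolE b)
    · refine provable_of_inert (k := 0) p _ hp L.length _ (fun i => ?_) (fun i C hC => ?_)
        (fun i hi => ⟨true, by simp [Nat.not_lt.mpr hi, boolE]⟩)
        (fun i hi => by simp [Nat.not_lt.mpr hi]) le_rfl
      · split_ifs
        · exact ⟨hlang i, Theory.lang_boolE b⟩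
        · exact lang_truE
      · split_ifs
        · exact Theory.beta_app (Theory.beta_lam_self hC (hlang i)) (Theory.beta_not_free
            (Theory.evalFree_boolE b) (Theory.closed_boolE b _ _) (Theory.lang_boolE b) hC)
        · exact Theory.beta_not_free (by simp) (by simp) (by simp) hC
  exact Theory.of_lam_cases (key true) (key false)

end PropForm
end CTTqe

namespace CTTqe
variable {κ : Ty → Type u} {T : Theory κ}

namespace Theory

/-! ## Noneffective variables -/

/-- `T.Rigid k α X`: the variable `k` of type `α` is noneffective in `X`, for all arguments. -/
def Rigid (T : Theory κ) (k : ℕ) (α : Ty) {γ : Ty} (X : Expr κ γ) : Prop :=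
  ∀ A : Expr κ α, T.Lang A → T ⊢ₚ Expr.lam k α X ⬝ A =ₑ X

section Rigid
variable {k : ℕ} {α : Ty}

/-- The source of noneffective variables in terms with evaluations: `a4_6` has no condition on the
body. -/
theorem rigid_lam_self {β : Ty} {M : Expr κ β} (hM : T.Lang M) :
    T.Rigid k α (Expr.lam k α M) := fun _ hA => beta_lam_self hA hM

theorem rigid_of_evalFree {γ : Ty} {X : Expr κ γ} (hX : EvalFree X) (hk : ¬ FreeIn k α X)
    (hL : T.Lang X) : T.Rigid k α X := fun _ hA => beta_not_free hX hk hL hA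

theorem Rigid.app {β γ : Ty} {F : Expr κ (β ⟶ₜ γ)} {C : Expr κ β} (hF : T.Rigid k α F)
    (hC : T.Rigid k α C) : T.Rigid k α (F ⬝ C) := fun A hA => beta_app (hF A hA) (hC A hA)

theorem not_not {A : Expr κ oₜ} (h : T ⊢ₚ A) : T ⊢ₚ ¬ₑ ¬ₑ A :=
  modus_ponens (PropForm.provable (.imp (.atom 0) (.neg (.neg (.atom 0)))) [A]
    (by simpa using h.lang)) h

/-- Noneffectiveness unfolds to ¬¬∀y.¬¬((λx.X)y = X). -/
theorem Rigid.not_effective {γ : Ty} {X : Expr κ γ} (hX : T.Rigid k α X) (m : ℕ) :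
    T ⊢ₚ ¬ₑ effE m k α X :=
  not_not (gen (not_not (hX (Expr.var m α) trivial)) _ _)

theorem or_inl {A B : Expr κ oₜ} (h : T ⊢ₚ A) (hB : T.Lang B) : T ⊢ₚ (A ∨ₑ B) :=
  modus_ponens (PropForm.provable (.imp (.atom 0) (.or (.atom 0) (.atom 1))) [A, B]
    (by simpa using ⟨h.lang, hB⟩)) h

theorem or_inr {A B : Expr κ oₜ} (hA : T.Lang A) (h : T ⊢ₚ B) : T ⊢ₚ (A ∨ₑ B) :=
  modus_ponens (PropForm.provable (.imp (.atom 1) (.or (.atom 0) (.atom 1))) [A, B]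
    (by simpa using ⟨hA, h.lang⟩)) h

theorem lang_effE {m n : ℕ} {γ : Ty} {X : Expr κ γ} (hX : T.Lang X) : T.Lang (effE m n α X) := by
  simp [effE, exE, neE, hX]

/-- The first alternative of `b13`. The auxiliary bound names `m + 1` and `k + 1` only have to
differ from `m` and `k`. -/
theorem Rigid.pass {m : ℕ} {β : Ty} {A : Expr κ α} (hA : T.Rigid m β A) : T.Pass m β A := by
  intro k γ B hne hB hLA
  have h : T ⊢ₚ (allE m β (¬ₑ effE (m + 1) m β A) ∨ₑ
      allE k α (allE m β (¬ₑ effE (k + 1) k α B))) :=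
    or_inl (gen (hA.not_effective _) _ _) (by simp [lang_effE hB])
  exact modus_ponens (Provable.logic (IsAxiom.b13 k α m β B A (m + 1) (k + 1) hne
    (by omega) (by omega)) (by simp [lang_effE, hB, hLA])) h

/-- The second alternative of `b13`, with the noneffective variable in the body instead of the
argument. -/
theorem Rigid.inert {γ : Ty} {X : Expr κ γ} (hX : T.Rigid k α X) (hL : T.Lang X) :
    T.Inert k α X where
  beta := hX
  pass m β A hne hA := by
    have h : T ⊢ₚ (allE m β (¬ₑ effE (m + 1) m β A) ∨ₑ
        allE k α (allE m β (¬ₑ effE (k + 1) k α X))) :=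
      or_inr (by simp [lang_effE hA]) (gen (gen (hX.not_effective _) _ _) _ _)
    exact modus_ponens (Provable.logic (IsAxiom.b13 k α m β X A (m + 1) (k + 1) hne
      (by omega) (by omega)) (by simp [lang_effE, hL, hA])) h

theorem Rigid.lam {γ : Ty} {X : Expr κ γ} (hX : T.Rigid k α X) (hL : T.Lang X) (m : ℕ) (β : Ty) :
    T.Rigid k α (Expr.lam m β X) := by
  by_cases h : ((k, α) : ℕ × Ty) = (m, β)
  · obtain ⟨rfl, rfl⟩ := Prod.mk.inj h; exact rigid_lam_self hL
  · exact fun A hA => ((hX.inert hL).pass m β A h hA).trans ((hX A hA).lam m β)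

end Rigid

/-! ## Quantifiers -/

/-- With a fresh propositional variable `b` in place of `H` the law holds by cases on `b`. Putting
`H` back requires only that it pass the quantifier. -/
theorem all_imp_distrib {n b : ℕ} {α : Ty} {A : Expr κ oₜ} (hA : EvalFree A) (hL : T.Lang A)
    (hb : ¬ FreeIn b oₜ A) (hn : b ≠ n) {H : Expr κ oₜ} (hH : T.Lang H) (hp : T.Pass n α H) :
    T ⊢ₚ (allE n α (H ⊃ₑ A) ⊃ₑ (H ⊃ₑ allE n α A)) := by
  set M : Expr κ oₜ := (allE n α (Expr.var b oₜ ⊃ₑ A) ⊃ₑ (Expr.var b oₜ ⊃ₑ allE n α A)) with hM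
  have key : ∀ C : Expr κ oₜ, T.Lang C → T.Pass n α C → T ⊢ₚ Expr.lam b oₜ M ⬝ C =ₑ
      (allE n α (C ⊃ₑ A) ⊃ₑ (C ⊃ₑ allE n α A)) := by
    intro C hC hp
    have h := beta (T := T) (k := b) hC M (by simp [hM, hA, EvalFree]) (by simp [hM, hL]) (by
      simp only [hM, Binds, impE, allE, eqE, binds_of_not_free _ (closed_impC _ _), FreeIn, hb,
        closed_truE, binds_of_not_free A hb]
      simp [hp])
    have hs : sub ((idS.up b oₜ C).up n α (Expr.var n α)) A = A := by
      rw [sub_congr A hA _ idS fun p hp => ?_, sub_idS]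
      by_cases h1 : p = (n, α)
      · subst h1; simp
      · rw [Subst.up_ne _ _ h1, Subst.up_ne]
        rintro rfl; exact hb hp
    have hs' : ((idS.up b oₜ C).up n α (Expr.var n α)) (b, oₜ) = C := by
      rw [Subst.up_ne _ _ (by simp [hn]), Subst.up_self]
    simpa [hM, sub, hs, hs'] using h
  have hall : T.Lang (allE n α A) := by simpa using hL
  refine (key H hH hp).mp (cases ((key truE lang_truE (pass_of_evalFree (by simp) (by simp))).mpr ?_)
    ((key falE lang_falE (pass_of_evalFree (by simp) (by simp))).mpr ?_) hH)
  · refine (imp_congr ?_ (true_imp hall)).mpr (PropForm.provable (.imp (.atom 0) (.atom 0))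
      [allE n α A] (by simpa using hL))
    exact (refl (A := Expr.lam n α truE) lang_truE).eq_congr ((true_imp hL).lam n α)
  · exact PropForm.provable (.imp (.atom 0) (.imp .fls (.atom 1)))
      [allE n α (falE ⊃ₑ A), allE n α A] (by simpa using hL)

theorem _root_.CTTqe.Expr.exists_bound {β : Ty} (A : Expr κ β) :
    ∃ N, ∀ n α, FreeIn n α A → n < N := by
  induction A with
  | var m β => exact ⟨m + 1, fun n α h => by have := h.1; omega⟩
  | const c => exact ⟨0, fun _ _ h => h.elim⟩
  | app F C ihF ihC =>
    obtain ⟨N, hN⟩ := ihF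
    obtain ⟨M, hM⟩ := ihC
    refine ⟨max N M, fun n α h => ?_⟩
    rcases h with h | h
    · exact lt_max_of_lt_left (hN n α h)
    · exact lt_max_of_lt_right (hM n α h)
  | lam m β B ih => exact ih.imp fun N h n α h' => h n α h'.2
  | quote B => exact ⟨0, fun _ _ h => h.elim⟩
  | eval β B ih => exact ih

theorem imp_gen {n : ℕ} {α : Ty} {H A : Expr κ oₜ} (h : T ⊢ₚ (H ⊃ₑ A)) (hA : EvalFree A)
    (hH : EvalFree H) (hn : ¬ FreeIn n α H) : T ⊢ₚ (H ⊃ₑ allE n α A) := by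
  obtain ⟨N, hN⟩ := A.exists_bound
  obtain ⟨hlH, hlA⟩ : T.Lang H ∧ T.Lang A := by simpa using h.lang
  exact modus_ponens (all_imp_distrib (b := max N (n + 1)) hA hlA
    (fun h => absurd (hN _ _ h) (by omega)) (by omega) hlH (pass_of_evalFree hH hn)) (gen h n α)

/-! ## Simultaneous instantiation -/

theorem _root_.CTTqe.Expr.exists_list {β : Ty} (A : Expr κ β) :
    ∃ L : List (ℕ × Ty), ∀ p : ℕ × Ty, FreeIn p.1 p.2 A → p ∈ L := by
  induction A with
  | var m β => exact ⟨[(m, β)], fun p h => by simp [h.1, h.2]⟩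
  | const c => exact ⟨[], fun _ h => h.elim⟩
  | app F C ihF ihC =>
    obtain ⟨L, hL⟩ := ihF
    obtain ⟨M, hM⟩ := ihC
    exact ⟨L ++ M, fun p h => List.mem_append.mpr (h.imp (hL p) (hM p))⟩
  | lam m β B ih => exact ih.imp fun N h p h' => h p h'.2
  | quote B => exact ⟨[], fun _ h => h.elim⟩
  | eval β B ih => exact ih

/-- Simultaneous substitution of expressions whose free variables satisfy `P` into a theorem whose
variables do not. -/
theorem inst_all {P : ℕ → Prop} {B : Expr κ oₜ} (h : T ⊢ₚ B) (hB : EvalFree B)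
    (hfree : ∀ n α, FreeIn n α B → ¬ P n)
    (hbind : ∀ k α, Binds (fun m _ => ¬ P m) k α B) (σ : Subst κ) (hL : T.LangS σ)
    (hσ : ∀ p, EvalFree (σ p) ∧ ∀ n α, FreeIn n α (σ p) → P n) : T ⊢ₚ sub σ B := by
  classical
  obtain ⟨L, hmem⟩ := B.exists_list
  -- The variables are treated one after the other. The inserted values contain only variables
  -- satisfying `P`, none of which is free in `B`, so later substitutions leave earlier values
  -- alone.
  have key : ∀ M : List (ℕ × Ty), T ⊢ₚ sub (fun p => if p ∈ M then σ p else idS p) B := by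
    intro M
    induction M with
    | nil => simpa using (by rw [show (fun p => idS p) = (idS : Subst κ) from rfl, sub_idS]; exact h)
    | cons q M ih =>
      set τ : Subst κ := fun p => if p ∈ M then σ p else idS p with hτ
      have hτL : T.LangS τ := fun p => by simp only [hτ]; split_ifs; exacts [hL p, trivial]
      by_cases hq : q ∈ M
      · convert ih using 2
        funext p
        by_cases hp : p ∈ M
        · simp [hτ, hp]
        · have : p ≠ q := fun e => hp (e ▸ hq)
          simp [hτ, hp, this]
      by_cases hf : FreeIn q.1 q.2 B
      · obtain ⟨k, α⟩ := q
        have h1 := (T.inertClass_evalFree k α).beta (A := σ (k, α)) (hL _) B hB h.lang τ hτL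
          (by simp only [hτ, hq, if_false]; rfl) (fun p hp hpB => by
            simp only [hτ]; split_ifs
            · exact ⟨(hσ p).1, fun e => hfree _ _ hf ((hσ p).2 _ _ e), hL p⟩
            · exact ⟨trivial, fun e => hp (Prod.ext e.1 e.2), trivial⟩)
          ((hbind k α).mono fun m β hm => pass_of_evalFree (hσ _).1 fun e => hm ((hσ _).2 _ _ e))
        have h2 := h1.mp (lam_app ih k (hL _))
        convert h2 using 2
        funext p
        by_cases hp : p = (k, α)
        · subst hp; simp
        · rw [Subst.up_ne _ _ hp]; simp [hτ, hp]
      · rwa [sub_congr B hB _ τ fun p hp => ?_]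
        have : p ≠ q := fun e => hf (e ▸ hp)
        simp [hτ, this]
  rw [sub_congr B hB σ _ fun p hp => ?_]
  · exact key L
  · simp [hmem p hp]

end Theory
end CTTqe

namespace CTTqe
variable {κ : Ty → Type u} {T : Theory κ}

/-! ## Pure expressions -/

/-- The constants of the theory of the real numbers and the logical constants. -/
def Const.Pure : {α : Ty} → Const κ α → Prop
  | _, Const.other _ => False
  | _, _ => True

/-- Eval-free expressions without further nonlogical constants. -/
def Expr.Pure : {α : Ty} → Expr κ α → Prop
  | _, Expr.var _ _ => True
  | _, Expr.const c => c.Pure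
  | _, Expr.app F A => F.Pure ∧ A.Pure
  | _, Expr.lam _ _ B => B.Pure
  | _, Expr.quote A => A.Pure
  | _, Expr.eval _ _ => False

/-- Variables with a name from here on are reserved for parameters. -/
abbrev paramN : ℕ := 100

/-- All names of variables outside quotations lie below the names of parameters. -/
def Expr.Small : {α : Ty} → Expr κ α → Prop
  | _, Expr.var n _ => n < paramN
  | _, Expr.const _ => True
  | _, Expr.app F A => F.Small ∧ A.Small
  | _, Expr.lam n _ B => n < paramN ∧ B.Small
  | _, Expr.quote _ => True
  | _, Expr.eval _ _ => False

theorem Expr.Pure.evalFree {α : Ty} {A : Expr κ α} (h : A.Pure) : EvalFree A := by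
  induction A with
  | app F A ihF ihA => exact ⟨ihF h.1, ihA h.2⟩
  | lam n β B ih => exact ih h
  | quote B ih => exact ih h
  | eval β B => exact h
  | _ => trivial

theorem Const.Pure.mem (hT : IsRealTheory T) {α : Ty} {c : Const κ α} (h : c.Pure) :
    (⟨α, c⟩ : Σ α : Ty, Const κ α) ∈ T.consts := by
  cases c with
  | other c => exact h.elim
  | real c => exact hT.const_mem c
  | _ => exact T.logical_mem _ (by constructor)

theorem Expr.Pure.lang (hT : IsRealTheory T) {α : Ty} {A : Expr κ α} (h : A.Pure) : T.Lang A := by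
  induction A with
  | var n α => trivial
  | const c => exact Const.Pure.mem hT h
  | app F A ihF ihA => exact ⟨ihF h.1, ihA h.2⟩
  | lam n β B ih => exact ih h
  | quote B ih => exact ⟨Expr.Pure.evalFree (A := B) h, ih h⟩
  | eval β B => exact h.elim

theorem Expr.Pure.sub {α : Ty} {B : Expr κ α} (h : B.Pure) {σ : Subst κ}
    (hσ : ∀ p : ℕ × Ty, FreeIn p.1 p.2 B → (σ p).Pure) : (sub σ B).Pure := by
  induction B generalizing σ with
  | var n α => exact hσ (n, α) ⟨rfl, rfl⟩
  | const c => exact h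
  | app F A ihF ihA =>
    exact ⟨ihF h.1 fun p hp => hσ p (Or.inl hp), ihA h.2 fun p hp => hσ p (Or.inr hp)⟩
  | lam n α B ih =>
    refine ih (σ := σ.up n α (Expr.var n α)) h fun p hp => ?_
    by_cases hpn : p = (n, α)
    · subst hpn; simp only [Subst.up_self]; trivial
    · rw [Subst.up_ne _ _ hpn]; exact hσ p ⟨fun e => hpn e.symm, hp⟩
  | quote A => exact h
  | eval β A => exact h.elim

theorem freeIn_sub {k : ℕ} {γ : Ty} {α : Ty} (B : Expr κ α) (hB : EvalFree B) (σ : Subst κ)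
    (h : FreeIn k γ (sub σ B)) : ∃ p : ℕ × Ty, FreeIn p.1 p.2 B ∧ FreeIn k γ (σ p) := by
  by_contra! hc
  exact not_freeIn_sub B hB σ hc h

theorem Expr.Small.freeIn_lt {α : Ty} {B : Expr κ α} (h : B.Small) {n : ℕ} {β : Ty}
    (hf : FreeIn n β B) : n < paramN := by
  induction B with
  | var m γ => obtain ⟨rfl, rfl⟩ := hf; exact h
  | const c => exact hf.elim
  | app F A ihF ihA => exact hf.elim (ihF h.1) (ihA h.2)
  | lam m γ B ih => exact ih h.2 hf.2
  | quote A => exact hf.elim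
  | eval β A => exact h.elim

theorem Expr.Small.binds {α : Ty} {B : Expr κ α} (h : B.Small) (k : ℕ) (γ : Ty) :
    Binds (fun m _ => m < paramN) k γ B := by
  induction B with
  | app F A ihF ihA => exact ⟨ihF h.1, ihA h.2⟩
  | lam m γ B ih => exact fun _ _ => ⟨h.1, ih h.2⟩
  | _ => trivial

/-! ## Countability -/

/-- A numbering of the types. -/
def Ty.code : Ty → ℕ
  | ind => 0
  | bool => 1
  | constr => 2
  | arr α β => 3 + Nat.pair α.code β.code

theorem Ty.code_injective : Function.Injective Ty.code := by
  intro α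
  induction α with
  | arr α β ihα ihβ =>
    intro γ h
    cases γ with
    | arr γ δ =>
      obtain ⟨h1, h2⟩ := Nat.pair_eq_pair.mp (Nat.add_left_cancel h)
      rw [ihα h1, ihβ h2]
    | _ => simp only [Ty.code] at h; omega
  | _ =>
    intro γ h
    cases γ <;> simp only [Ty.code] at h <;> first | rfl | omega

instance : Countable Ty := Ty.code_injective.countable

theorem countable_realConst : (Set.univ : Set (Σ α : Ty, RealConst α)).Countable := by
  have : Set.Finite ({⟨_, .zero⟩, ⟨_, .one⟩, ⟨_, .minus⟩, ⟨_, .plus⟩, ⟨_, .times⟩, ⟨_, .recip⟩,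
    ⟨_, .pos⟩, ⟨_, .less⟩, ⟨_, .lesseq⟩, ⟨_, .ub⟩, ⟨_, .lub⟩, ⟨_, .fminus⟩, ⟨_, .fplus⟩,
    ⟨_, .ftimes⟩, ⟨_, .isDiff⟩, ⟨_, .derivative⟩, ⟨_, .isPoly⟩, ⟨_, .polyDiff⟩} :
    Set (Σ α : Ty, RealConst α)) := Set.toFinite _
  refine this.countable.mono ?_
  rintro ⟨_, c⟩ -
  cases c <;> simp

/-- The supply `κ` may be uncountable. Without it there remain finitely many constants and four
families indexed by the types. -/
theorem countable_pureConst : {c : Σ α : Ty, Const κ α | c.2.Pure}.Countable := by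
  have hf : Set.Finite ({⟨_, .isVar⟩, ⟨_, .isCon⟩, ⟨_, .app⟩, ⟨_, .abs⟩, ⟨_, .quo⟩, ⟨_, .isExpr⟩,
    ⟨_, .subexpr⟩, ⟨_, .isFreeIn⟩} : Set (Σ α : Ty, Const κ α)) := Set.toFinite _
  refine ((((hf.countable.union (Set.countable_range fun α : Ty => ⟨_, Const.eq α⟩)).union
    (Set.countable_range fun α : Ty => ⟨_, Const.isVarT α⟩)).union
    (Set.countable_range fun α : Ty => ⟨_, Const.isConT α⟩)).union
    (Set.countable_range fun α : Ty => ⟨_, Const.isExprT α⟩)).union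
    (countable_realConst.image fun c => ⟨c.1, Const.real c.2⟩) |>.mono ?_
  rintro ⟨_, c⟩ h
  cases c with
  | other c => exact h.elim
  | real c => exact Or.inr ⟨⟨_, c⟩, trivial, rfl⟩
  | _ => simp

/-- The pure expressions of bounded depth. -/
def pureExprs (κ : Ty → Type u) : ℕ → Set (Σ α : Ty, Expr κ α)
  | 0 => ∅
  | d + 1 => Set.range (fun p : ℕ × Ty => ⟨p.2, Expr.var p.1 p.2⟩) ∪
      (fun c : Σ α : Ty, Const κ α => ⟨c.1, Expr.const c.2⟩) '' {c | c.2.Pure} ∪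
      {x | ∃ f ∈ pureExprs κ d, ∃ a ∈ pureExprs κ d, ∃ (α β : Ty) (F : Expr κ (α ⟶ₜ β))
        (A : Expr κ α), f = ⟨_, F⟩ ∧ a = ⟨_, A⟩ ∧ x = ⟨_, F ⬝ A⟩} ∪
      {x | ∃ p : ℕ × Ty, ∃ b ∈ pureExprs κ d, x = ⟨_, Expr.lam p.1 p.2 b.2⟩} ∪
      {x | ∃ b ∈ pureExprs κ d, x = ⟨_, Expr.quote b.2⟩}

theorem countable_pureExprs_depth (d : ℕ) : (pureExprs κ d).Countable := by
  induction d with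
  | zero => exact Set.countable_empty
  | succ d ih =>
    refine ((((Set.countable_range _).union (countable_pureConst.image _)).union ?_).union ?_).union ?_
    · have : (⋃ f ∈ pureExprs κ d, ⋃ a ∈ pureExprs κ d, {x : Σ α : Ty, Expr κ α |
          ∃ (α β : Ty) (F : Expr κ (α ⟶ₜ β)) (A : Expr κ α),
            f = ⟨_, F⟩ ∧ a = ⟨_, A⟩ ∧ x = ⟨_, F ⬝ A⟩}).Countable := by
        -- Not every pair of typed expressions can be applied, but each pair yields at most one
        -- application.
        refine ih.biUnion fun f _ => ih.biUnion fun a _ => Set.Subsingleton.countable ?_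
        rintro x ⟨α, β, F, A, rfl, rfl, rfl⟩ y ⟨α', β', F', A', h1, h2, rfl⟩
        cases h1; cases h2; rfl
      refine this.mono ?_
      rintro x ⟨f, hf, a, ha, h⟩
      simp only [Set.mem_iUnion]
      exact ⟨f, hf, a, ha, h⟩
    · have : (⋃ p : ℕ × Ty, (fun b : Σ α : Ty, Expr κ α => (⟨_, Expr.lam p.1 p.2 b.2⟩ :
          Σ α : Ty, Expr κ α)) '' pureExprs κ d).Countable :=
        Set.countable_iUnion fun p => ih.image _
      refine this.mono ?_
      rintro x ⟨p, b, hb, rfl⟩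
      exact Set.mem_iUnion.mpr ⟨p, b, hb, rfl⟩
    · refine (ih.image fun b : Σ α : Ty, Expr κ α => (⟨_, Expr.quote b.2⟩ :
          Σ α : Ty, Expr κ α)).mono ?_
      rintro x ⟨b, hb, rfl⟩
      exact ⟨b, hb, rfl⟩

theorem pureExprs_succ (d : ℕ) : pureExprs κ d ⊆ pureExprs κ (d + 1) := by
  induction d with
  | zero => exact Set.empty_subset _
  | succ d ih =>
    rintro x ((((h | h) | ⟨f, hf, a, ha, h⟩) | ⟨p, b, hb, h⟩) | ⟨b, hb, h⟩)
    · exact Or.inl (Or.inl (Or.inl (Or.inl h)))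
    · exact Or.inl (Or.inl (Or.inl (Or.inr h)))
    · exact Or.inl (Or.inl (Or.inr ⟨f, ih hf, a, ih ha, h⟩))
    · exact Or.inl (Or.inr ⟨p, b, ih hb, h⟩)
    · exact Or.inr ⟨b, ih hb, h⟩

theorem Expr.Pure.mem_pureExprs {α : Ty} {A : Expr κ α} (h : A.Pure) :
    ∃ d, (⟨α, A⟩ : Σ α : Ty, Expr κ α) ∈ pureExprs κ d := by
  have hm : Monotone (pureExprs κ) := monotone_nat_of_le_succ pureExprs_succ
  induction A with
  | var n α => exact ⟨1, Or.inl (Or.inl (Or.inl (Or.inl ⟨(n, α), rfl⟩)))⟩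
  | const c => exact ⟨1, Or.inl (Or.inl (Or.inl (Or.inr ⟨⟨_, c⟩, h, rfl⟩)))⟩
  | app F A ihF ihA =>
    obtain ⟨d, hd⟩ := ihF h.1
    obtain ⟨e, he⟩ := ihA h.2
    exact ⟨max d e + 1, Or.inl (Or.inl (Or.inr ⟨_, hm (le_max_left d e) hd, _,
      hm (le_max_right d e) he, _, _, F, A, rfl, rfl, rfl⟩))⟩
  | lam n β B ih =>
    obtain ⟨d, hd⟩ := ih h
    exact ⟨d + 1, Or.inl (Or.inr ⟨(n, β), _, hd, rfl⟩)⟩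
  | quote B ih =>
    obtain ⟨d, hd⟩ := ih h
    exact ⟨d + 1, Or.inr ⟨_, hd, rfl⟩⟩
  | eval β B => exact h.elim

instance countable_pure : Countable {x : Σ α : Ty, Expr κ α // x.2.Pure} := by
  refine Set.Countable.to_subtype (s := {x : Σ α : Ty, Expr κ α | x.2.Pure})
    ((Set.countable_iUnion (countable_pureExprs_depth (κ := κ))).mono ?_)
  rintro ⟨α, A⟩ h
  exact Set.mem_iUnion.mpr (Expr.Pure.mem_pureExprs h)

/-! ## Complete consistent sets with witnesses -/

/-- Pure expressions all of whose free variables are parameters. -/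
def Expr.IsParam {α : Ty} (A : Expr κ α) : Prop :=
  A.Pure ∧ ∀ n β, FreeIn n β A → paramN ≤ n

theorem Expr.IsParam.app {α β : Ty} {F : Expr κ (α ⟶ₜ β)} {A : Expr κ α} (hF : F.IsParam)
    (hA : A.IsParam) : (F ⬝ A).IsParam :=
  ⟨⟨hF.1, hA.1⟩, fun n γ h => h.elim (hF.2 n γ) (hA.2 n γ)⟩

section Pure
variable {α : Ty} {n : ℕ} {A B : Expr κ oₜ} {C D : Expr κ α}

theorem pure_truE : (truE : Expr κ oₜ).Pure := by simp [truE, eqE, Expr.Pure, Const.Pure]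
theorem pure_falE : (falE : Expr κ oₜ).Pure := by simp [falE, eqE, Expr.Pure, Const.Pure, pure_truE]
theorem pure_andC : (andC : Expr κ _).Pure := by simp [andC, eqE, Expr.Pure, Const.Pure, pure_truE]
theorem pure_impC : (impC : Expr κ _).Pure := by
  simp [impC, andE, eqE, Expr.Pure, Const.Pure, pure_andC]
theorem pure_negC : (negC : Expr κ _).Pure := by simp [negC, Expr.Pure, Const.Pure, pure_falE]
theorem pure_orC : (orC : Expr κ _).Pure := by
  simp [orC, negE, andE, Expr.Pure, pure_andC, pure_negC]
attribute [simp] pure_truE pure_falE pure_andC pure_impC pure_negC pure_orC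

@[simp] theorem pure_eqE : (C =ₑ D).Pure ↔ C.Pure ∧ D.Pure := by simp [eqE, Expr.Pure, Const.Pure]
@[simp] theorem pure_andE : (A ∧ₑ B).Pure ↔ A.Pure ∧ B.Pure := by simp [andE, Expr.Pure]
@[simp] theorem pure_impE : (A ⊃ₑ B).Pure ↔ A.Pure ∧ B.Pure := by simp [impE, Expr.Pure]
@[simp] theorem pure_negE : (¬ₑ A).Pure ↔ A.Pure := by simp [negE, Expr.Pure]
@[simp] theorem pure_allE : (allE n α A).Pure ↔ A.Pure := by simp [allE, Expr.Pure]
theorem isParam_eqE : (C =ₑ D).IsParam ↔ C.IsParam ∧ D.IsParam := by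
  simp only [Expr.IsParam, pure_eqE, freeIn_eqE]; grind
theorem isParam_andE : (A ∧ₑ B).IsParam ↔ A.IsParam ∧ B.IsParam := by
  simp only [Expr.IsParam, pure_andE, freeIn_andE]; grind
theorem isParam_impE : (A ⊃ₑ B).IsParam ↔ A.IsParam ∧ B.IsParam := by
  simp only [Expr.IsParam, pure_impE, freeIn_impE]; grind
theorem isParam_negE : (¬ₑ A).IsParam ↔ A.IsParam := by
  simp only [Expr.IsParam, pure_negE, freeIn_negE]

end Pure

namespace Theory

/-- Complete consistent sets of formulas with witnesses for inequalities of functions. -/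
structure IsHenkin (T : Theory κ) (Δ : Expr κ oₜ → Prop) : Prop where
  consistent : ¬ Δ falE
  thm : ∀ {A}, T ⊢ₚ A → Δ A
  mp : ∀ {A B}, Δ (A ⊃ₑ B) → Δ A → Δ B
  decides : ∀ {A}, A.IsParam → Δ A ∨ Δ (¬ₑ A)
  witness : ∀ {α β : Ty} {F G : Expr κ (α ⟶ₜ β)}, F.IsParam → G.IsParam →
    ∃ y, paramN ≤ y ∧ Δ (F ⬝ Expr.var y α =ₑ G ⬝ Expr.var y α ⊃ₑ F =ₑ G)

/-- Extensionality under a hypothesis. -/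
theorem imp_ext (hT : IsRealTheory T) {H : Expr κ oₜ} (hH : H.IsParam) {α β : Ty}
    {F G : Expr κ (α ⟶ₜ β)} (hF : F.IsParam) (hG : G.IsParam) {y : ℕ} (hyH : ¬ FreeIn y α H)
    (hyF : ¬ FreeIn y α F) (hyG : ¬ FreeIn y α G)
    (h : T ⊢ₚ (H ⊃ₑ F ⬝ Expr.var y α =ₑ G ⬝ Expr.var y α)) : T ⊢ₚ (H ⊃ₑ F =ₑ G) := by
  have hx : ∀ {γ : Ty} {A : Expr κ γ}, A.IsParam → ¬ FreeIn xN α A := fun hA h =>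
    absurd (hA.2 _ _ h) (by decide)
  have heH := hH.1.evalFree
  have heF := hF.1.evalFree
  have heG := hG.1.evalFree
  have hs : ∀ {γ : Ty} {A : Expr κ γ}, EvalFree A → ¬ FreeIn y α A → ∀ C : Expr κ α,
      sub (idS.up y α C) A = A := by
    intro γ A hA hy C
    rw [sub_congr A hA _ idS fun p hp => ?_, sub_idS]
    rw [Subst.up_ne]; rintro rfl; exact hy hp
  -- The parameter is renamed to x, the variable bound in the extensionality axiom. Its name is
  -- small, so it is not free in `H`, `F`, `G`.
  have h1 := inst_unbound (k := y) (A := (Expr.var xN α : Expr κ α)) (by simp) h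
    (by simp [EvalFree, heH, heF, heG]) (by
      simp [Binds, impE, eqE, binds_of_not_free, hyH, hyF, hyG])
  simp only [sub_impE, sub_eqE, sub, hs heH hyH, hs heF hyF, hs heG hyG, Subst.up_self] at h1
  have h2 := imp_gen h1 (n := xN) (by simp [EvalFree, heF, heG]) heH (hx hH)
  have hs' : ∀ {γ : Ty} {A : Expr κ γ}, A.IsParam → ∀ {m : ℕ} {δ : Ty} (_ : m < paramN)
      (C : Expr κ δ), sub (idS.up m δ C) A = A := by
    intro γ A hA m δ hm C
    rw [sub_congr A hA.1.evalFree _ idS fun p hp => ?_, sub_idS]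
    rw [Subst.up_ne]; rintro rfl; exact absurd (hA.2 _ _ hp) (by omega)
  have hp : ∀ {γ : Ty} {A : Expr κ γ}, A.IsParam → T.Pass xN α A := fun hA =>
    pass_of_evalFree hA.1.evalFree (hx hA)
  have h3 := inst (k := fN) (hF.1.lang hT) (extensionality α β) (by simp [EvalFree])
    (by simp [Binds, eqE, allE, binds_of_not_free, FreeIn, hp hF])
  simp [sub] at h3
  have h4 := inst (k := gN) (hG.1.lang hT) h3 (by simp [EvalFree, heF]) (by
    have hg : ¬ FreeIn gN (α ⟶ₜ β) F := fun h => absurd (hF.2 _ _ h) (by decide)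
    simp [Binds, eqE, allE, binds_of_not_free, FreeIn, hp hG, hg])
  have hc := Subst.up_comm (κ := κ) idS (n := gN) (m := xN) (α := α ⟶ₜ β) (β := α) (by simp) G
    (Expr.var xN α)
  rw [idS_up] at hc
  simp only [sub_eqE, sub_allE, sub, hc, hs' hF (show gN < paramN by decide), Subst.up_self] at h4
  simp at h4
  exact (imp_congr (refl (hH.1.lang hT)) h4).mpr h2

end Theory
end CTTqe

/-! ### Extension of consistent formulas to Henkin sets -/

namespace CTTqe
variable {κ : Ty → Type u} {T : Theory κ}

namespace Theory

/-- Consistency of a formula with the theory. -/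
def Consistent (T : Theory κ) (H : Expr κ oₜ) : Prop := ¬ (T ⊢ₚ ¬ₑ H)

theorem Consistent.decide {H C : Expr κ oₜ} (hH : T.Consistent H) (hL : T.Lang H)
    (hC : T.Lang C) : T.Consistent (H ∧ₑ C) ∨ T.Consistent (H ∧ₑ ¬ₑ C) := by
  by_contra! h
  simp only [Consistent, Classical.not_not] at h
  refine hH (modus_ponens (modus_ponens (PropForm.provable (.imp (.neg (.and (.atom 0) (.atom 1)))
    (.imp (.neg (.and (.atom 0) (.neg (.atom 1)))) (.neg (.atom 0)))) [H, C] ?_) h.1) h.2)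
  simpa using ⟨hL, hC⟩

/-- A parameter beyond all free names is fresh. If the witness formula were refuted under `H`, then
`H` would imply both F y = G y and F ≠ G; but the former generalizes to F = G by `imp_ext`. -/
theorem Consistent.witness (hT : IsRealTheory T) {H : Expr κ oₜ} (hH : T.Consistent H)
    (hp : H.IsParam) {α β : Ty} {F G : Expr κ (α ⟶ₜ β)} (hF : F.IsParam) (hG : G.IsParam) :
    ∃ y, paramN ≤ y ∧
      T.Consistent (H ∧ₑ (F ⬝ Expr.var y α =ₑ G ⬝ Expr.var y α ⊃ₑ F =ₑ G)) := by
  obtain ⟨N, hN⟩ := (H ∧ₑ F =ₑ G).exists_bound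
  simp only [freeIn_andE, freeIn_eqE] at hN
  refine ⟨max N paramN, le_max_right _ _, fun h => hH ?_⟩
  have hlt : ∀ δ, ¬ (FreeIn (max N paramN) δ H ∨ FreeIn (max N paramN) δ F ∨
      FreeIn (max N paramN) δ G) := fun δ h => absurd (hN _ _ h) (by omega)
  simp only [not_or] at hlt
  set y := max N paramN
  set E1 : Expr κ oₜ := F ⬝ Expr.var y α =ₑ G ⬝ Expr.var y α with hE1
  have l0 := hp.1.lang hT
  have l1 : T.Lang E1 := by simp [hE1, hF.1.lang hT, hG.1.lang hT]
  have l2 : T.Lang (F =ₑ G) := by simp [hF.1.lang hT, hG.1.lang hT]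
  have hL : ∀ A ∈ [H, E1, F =ₑ G], T.Lang A := by simpa using ⟨l0, l1, by simpa using l2⟩
  have h1 : T ⊢ₚ (H ⊃ₑ E1) := modus_ponens (PropForm.provable (.imp (.neg (.and (.atom 0)
    (.imp (.atom 1) (.atom 2)))) (.imp (.atom 0) (.atom 1))) [H, E1, F =ₑ G] hL) h
  have h2 := imp_ext hT hp hF hG (hlt _).1 (hlt _).2.1 (hlt _).2.2 h1
  exact modus_ponens (modus_ponens (PropForm.provable (.imp (.neg (.and (.atom 0)
    (.imp (.atom 1) (.atom 2)))) (.imp (.imp (.atom 0) (.atom 2)) (.neg (.atom 0))))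
    [H, E1, F =ₑ G] hL) h) h2

/-- The requirements on a Henkin set: decisions and witnesses. -/
abbrev Task (κ : Ty → Type u) : Type u :=
  {C : Expr κ oₜ // C.IsParam} ⊕
    {x : (Σ α : Ty, Expr κ α) × (Σ α : Ty, Expr κ α) // x.1.2.Pure ∧ x.2.2.Pure}

instance : Countable (Task κ) := by
  have h1 : Countable {C : Expr κ oₜ // C.IsParam} := by
    refine Function.Injective.countable (β := {x : Σ α : Ty, Expr κ α // x.2.Pure})
      (f := fun C => ⟨⟨oₜ, C.1⟩, C.2.1⟩) fun C D h => ?_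
    simpa [Subtype.ext_iff] using h
  have h2 : Countable
      {x : (Σ α : Ty, Expr κ α) × (Σ α : Ty, Expr κ α) // x.1.2.Pure ∧ x.2.2.Pure} := by
    refine Function.Injective.countable (β := {x : Σ α : Ty, Expr κ α // x.2.Pure} ×
      {x : Σ α : Ty, Expr κ α // x.2.Pure}) (f := fun x => (⟨x.1.1, x.2.1⟩, ⟨x.1.2, x.2.2⟩))
      fun x y h => ?_
    simp only [Prod.mk.injEq, Subtype.mk.injEq] at h
    exact Subtype.ext (Prod.ext h.1 h.2)
  infer_instance

instance : Nonempty (Task κ) := ⟨Sum.inl ⟨truE, by simp, by simp⟩⟩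

/-- `H` settles a requirement. -/
def Settles (T : Theory κ) (H : Expr κ oₜ) : Task κ → Prop
  | Sum.inl C => (T ⊢ₚ (H ⊃ₑ C.1)) ∨ (T ⊢ₚ (H ⊃ₑ ¬ₑ C.1))
  | Sum.inr x => ∀ (α β : Ty) (F G : Expr κ (α ⟶ₜ β)), x.1.1 = ⟨_, F⟩ → x.1.2 = ⟨_, G⟩ →
      F.IsParam → G.IsParam → ∃ y, paramN ≤ y ∧
        (T ⊢ₚ (H ⊃ₑ (F ⬝ Expr.var y α =ₑ G ⬝ Expr.var y α ⊃ₑ F =ₑ G)))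

theorem and_imp_right {A B : Expr κ oₜ} (hA : T.Lang A) (hB : T.Lang B) :
    T ⊢ₚ ((A ∧ₑ B) ⊃ₑ B) :=
  PropForm.provable (.imp (.and (.atom 0) (.atom 1)) (.atom 1)) [A, B] (by simpa using ⟨hA, hB⟩)

theorem and_imp_left {A B : Expr κ oₜ} (hA : T.Lang A) (hB : T.Lang B) :
    T ⊢ₚ ((A ∧ₑ B) ⊃ₑ A) :=
  PropForm.provable (.imp (.and (.atom 0) (.atom 1)) (.atom 0)) [A, B] (by simpa using ⟨hA, hB⟩)

theorem imp_trans {A B C : Expr κ oₜ} (h : T ⊢ₚ (A ⊃ₑ B)) (h' : T ⊢ₚ (B ⊃ₑ C)) :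
    T ⊢ₚ (A ⊃ₑ C) := by
  have h1 : T.Lang A ∧ T.Lang B := by simpa using h.lang
  have h2 : T.Lang B ∧ T.Lang C := by simpa using h'.lang
  exact modus_ponens (modus_ponens (PropForm.provable (.imp (.imp (.atom 0) (.atom 1))
    (.imp (.imp (.atom 1) (.atom 2)) (.imp (.atom 0) (.atom 2)))) [A, B, C]
    (by simpa using ⟨h1.1, h1.2, h2.2⟩)) h) h'

theorem Consistent.settle (hT : IsRealTheory T) {H : Expr κ oₜ} (hH : T.Consistent H)
    (hp : H.IsParam) (t : Task κ) :
    ∃ H' : Expr κ oₜ, T.Consistent H' ∧ H'.IsParam ∧ (T ⊢ₚ (H' ⊃ₑ H)) ∧ T.Settles H' t := by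
  have hL := hp.1.lang hT
  have key : ∀ C : Expr κ oₜ, C.IsParam → T.Consistent (H ∧ₑ C) → (H ∧ₑ C).IsParam ∧
      (T ⊢ₚ ((H ∧ₑ C) ⊃ₑ H)) ∧ (T ⊢ₚ ((H ∧ₑ C) ⊃ₑ C)) := fun C hC _ =>
    ⟨isParam_andE.mpr ⟨hp, hC⟩, and_imp_left hL (hC.1.lang hT), and_imp_right hL (hC.1.lang hT)⟩
  rcases t with ⟨C, hC⟩ | ⟨⟨⟨γ, F⟩, ⟨δ, G⟩⟩, hx⟩
  · rcases hH.decide hL (hC.1.lang hT) with h | h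
    · obtain ⟨h1, h2, h3⟩ := key _ hC h
      exact ⟨_, h, h1, h2, Or.inl h3⟩
    · obtain ⟨h1, h2, h3⟩ := key _ (isParam_negE.mpr hC) h
      exact ⟨_, h, h1, h2, Or.inr h3⟩
  -- A pair that does not consist of two functions of the same type, with parameters only, requires
  -- nothing.
  · by_cases hc : ∃ (α β : Ty) (F' G' : Expr κ (α ⟶ₜ β)), (⟨γ, F⟩ : Σ α, Expr κ α) = ⟨_, F'⟩ ∧
        (⟨δ, G⟩ : Σ α, Expr κ α) = ⟨_, G'⟩ ∧ F'.IsParam ∧ G'.IsParam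
    · obtain ⟨α, β, F', G', h1, h2, hF, hG⟩ := hc
      obtain ⟨y, hy, h⟩ := hH.witness hT hp hF hG
      have hyp : (Expr.var y α : Expr κ α).IsParam := ⟨trivial, fun n γ e => e.1 ▸ hy⟩
      obtain ⟨h4, h5, h6⟩ := key _ (isParam_impE.mpr ⟨isParam_eqE.mpr ⟨hF.app hyp, hG.app hyp⟩,
        isParam_eqE.mpr ⟨hF, hG⟩⟩) h
      refine ⟨_, h, h4, h5, ?_⟩
      intro α' β' F'' G'' e1 e2 _ _
      cases h1; cases h2; cases e1; cases e2
      exact ⟨y, hy, h6⟩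
    · refine ⟨H, hH, hp, PropForm.provable (.imp (.atom 0) (.atom 0)) [H] (by simpa using hL), ?_⟩
      intro α β F' G' e1 e2 hF hG
      exact (hc ⟨α, β, F', G', e1, e2, hF, hG⟩).elim

/-- Every consistent formula with parameters belongs to a Henkin set. -/
theorem exists_henkin (hT : IsRealTheory T) {H : Expr κ oₜ} (hH : T.Consistent H)
    (hp : H.IsParam) : ∃ Δ, T.IsHenkin Δ ∧ Δ H := by
  obtain ⟨t, ht⟩ := exists_surjective_nat (Task κ)
  choose! nxt h1 h2 h3 h4 using fun (H : Expr κ oₜ) (h : T.Consistent H ∧ H.IsParam) (t : Task κ) =>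
    Consistent.settle hT h.1 h.2 t
  -- Each stage is a single formula, so only finitely many parameters are in use and a fresh one
  -- always exists. Since there are countably many requirements, a sequence of stages meets them
  -- all.
  let s : ℕ → Expr κ oₜ := fun i => Nat.rec H (fun i K => nxt K (t i)) i
  have hs : ∀ i, T.Consistent (s i) ∧ (s i).IsParam := by
    intro i
    induction i with
    | zero => exact ⟨hH, hp⟩
    | succ i ih => exact ⟨h1 _ ih _, h2 _ ih _⟩
  have hL : ∀ i, T.Lang (s i) := fun i => (hs i).2.1.lang hT
  have hmono : ∀ i j, i ≤ j → T ⊢ₚ (s j ⊃ₑ s i) := by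
    intro i j hij
    induction j, hij using Nat.le_induction with
    | base => exact PropForm.provable (.imp (.atom 0) (.atom 0)) [s i] (by simpa using hL i)
    | succ j _ ih => exact imp_trans (h3 _ (hs j) (t j)) ih
  -- The Henkin set consists of the consequences of the stages. Later stages imply earlier ones, so
  -- any two consequences follow from a common stage.
  refine ⟨fun A => ∃ i, T ⊢ₚ (s i ⊃ₑ A), ⟨?_, ?_, ?_, ?_, ?_⟩, 0, hmono 0 0 le_rfl⟩
  · rintro ⟨i, h⟩
    exact (hs i).1 (modus_ponens (PropForm.provable (.imp (.imp (.atom 0) .fls) (.neg (.atom 0)))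
      [s i] (by simpa using hL i)) h)
  · intro A hA
    exact ⟨0, modus_ponens (PropForm.provable (.imp (.atom 0) (.imp (.atom 1) (.atom 0)))
      [A, s 0] (by simpa using ⟨hA.lang, hL 0⟩)) hA⟩
  · rintro A B ⟨i, hi⟩ ⟨j, hj⟩
    have hi' := imp_trans (hmono i (max i j) (le_max_left _ _)) hi
    have hj' := imp_trans (hmono j (max i j) (le_max_right _ _)) hj
    refine ⟨max i j, modus_ponens (modus_ponens (PropForm.provable
      (.imp (.imp (.atom 0) (.imp (.atom 1) (.atom 2))) (.imp (.imp (.atom 0) (.atom 1))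
        (.imp (.atom 0) (.atom 2)))) [s (max i j), A, B] ?_) hi') hj'⟩
    have := hi.lang
    simp only [inLang_impE] at this
    simpa using ⟨hL _, this.2⟩
  · intro A hA
    obtain ⟨i, hi⟩ := ht (Sum.inl ⟨A, hA⟩)
    have h : (T ⊢ₚ (s (i + 1) ⊃ₑ A)) ∨ (T ⊢ₚ (s (i + 1) ⊃ₑ ¬ₑ A)) := by
      have h := h4 _ (hs i) (t i)
      have key : ∀ (K : Expr κ oₜ) (x : Task κ), T.Settles K x → x = Sum.inl ⟨A, hA⟩ →
          (T ⊢ₚ (K ⊃ₑ A)) ∨ (T ⊢ₚ (K ⊃ₑ ¬ₑ A)) := by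
        rintro K _ h rfl; exact h
      exact key _ _ h hi
    exact h.imp (fun h => ⟨i + 1, h⟩) fun h => ⟨i + 1, h⟩
  · intro α β F G hF hG
    obtain ⟨i, hi⟩ := ht (Sum.inr ⟨(⟨_, F⟩, ⟨_, G⟩), hF.1, hG.1⟩)
    have := h4 _ (hs i) (t i)
    have key : ∀ (K : Expr κ oₜ) (x : Task κ), T.Settles K x →
        x = Sum.inr ⟨(⟨_, F⟩, ⟨_, G⟩), hF.1, hG.1⟩ → ∃ y, paramN ≤ y ∧
        (T ⊢ₚ (K ⊃ₑ (F ⬝ Expr.var y α =ₑ G ⬝ Expr.var y α ⊃ₑ F =ₑ G))) := by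
      rintro K _ h rfl
      exact h α β F G rfl rfl hF hG
    obtain ⟨y, hy, h⟩ := key _ _ this hi
    exact ⟨y, hy, i + 1, h⟩

end Theory
end CTTqe

/-! ### Term models and completeness -/

namespace CTTqe
variable {κ : Ty → Type u} {T : Theory κ}

/-- Pure expressions with small names. -/
def Expr.IsLaw {α : Ty} (A : Expr κ α) : Prop := A.Pure ∧ A.Small

/-- Henkin models of the pure theorems of a theory. -/
structure Model (T : Theory κ) where
  D : Ty → Type u
  app : {α β : Ty} → D (α ⟶ₜ β) → D α → D β
  den : ((p : ℕ × Ty) → D p.2) → {α : Ty} → Expr κ α → D α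
  Tr : D oₜ → Prop
  ext : ∀ {α β : Ty} {f g : D (α ⟶ₜ β)}, (∀ d, app f d = app g d) → f = g
  Tr_ext : ∀ {a b : D oₜ}, (Tr a ↔ Tr b) → a = b
  den_var : ∀ ρ n α, den ρ (Expr.var n α) = ρ (n, α)
  den_app : ∀ ρ {α β : Ty} (F : Expr κ (α ⟶ₜ β)) (A : Expr κ α),
    den ρ (F ⬝ A) = app (den ρ F) (den ρ A)
  -- The restriction to small names is due to substitution without renaming: the values inserted in
  -- the term model contain free only variables from `paramN` on, which small binders cannot
  -- capture.
  den_lam : ∀ ρ n α {β : Ty} (B : Expr κ β) (d : D α), n < paramN → B.IsLaw →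
    app (den ρ (Expr.lam n α B)) d = den (Function.update ρ (n, α) d) B
  env : (p : ℕ × Ty) → D p.2
  con : {α : Ty} → Const κ α → D α
  quo : {α : Ty} → Expr κ α → D εₜ
  den_const : ∀ ρ {α : Ty} (c : Const κ α), den ρ (Expr.const c) = con c
  den_quote : ∀ ρ {α : Ty} (A : Expr κ α), den ρ (Expr.quote A) = quo A
  Tr_eq : ∀ {α : Ty} (a b : D α), Tr (app (app (con (Const.eq α)) a) b) ↔ a = b
  sound : ∀ ρ (A : Expr κ oₜ), T ⊢ₚ A → A.IsLaw → Tr (den ρ A)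
  not_false : ∀ ρ, ¬ Tr (den ρ falE)

namespace Theory

theorem sub_param {γ : Ty} {A : Expr κ γ} (hA : A.IsParam) {m : ℕ} {δ : Ty}
    (hm : m < paramN) (C : Expr κ δ) : sub (idS.up m δ C) A = A := by
  rw [sub_congr A hA.1.evalFree _ idS fun p hp => ?_, sub_idS]
  rw [Subst.up_ne]; rintro rfl; exact absurd (hA.2 _ _ hp) (by omega)

theorem leibniz (hT : IsRealTheory T) {α : Ty} {A B : Expr κ α} (hA : A.IsParam) (hB : B.IsParam)
    {H : Expr κ (α ⟶ₜ oₜ)} (hH : H.IsParam) : T ⊢ₚ (A =ₑ B ⊃ₑ (H ⬝ A =ₑ H ⬝ B)) := by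
  have h : T ⊢ₚ (xv α =ₑ yv α ⊃ₑ hv (α ⟶ₜ oₜ) ⬝ xv α =ₑ hv (α ⟶ₜ oₜ) ⬝ yv α) :=
    Provable.logic (IsAxiom.a2 α) (by simp)
  have h1 := inst_unbound (k := xN) (hA.1.lang hT) h (by simp [EvalFree])
    (by simp [Binds, eqE, impE, binds_of_not_free])
  have hy : (idS.up xN α A) (yN, α) = Expr.var yN α := by rw [Subst.up_ne]; rfl; simp
  simp [sub, hy] at h1
  have hb : ∀ {β : Ty} {C : Expr κ β}, C.IsParam → ∀ {m : ℕ} {δ : Ty}, m < paramN →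
      Binds (fun _ _ => False) m δ C := fun hC m δ hm =>
    binds_of_not_free _ fun h => absurd (hC.2 _ _ h) (by omega)
  have h2 := inst_unbound (k := yN) (hB.1.lang hT) h1 (by simp [EvalFree, hA.1.evalFree])
    (by simp [Binds, eqE, impE, binds_of_not_free, hb hA (show yN < paramN by decide)])
  simp [sub, sub_param hA (show yN < paramN by decide)] at h2
  have h3 := inst_unbound (k := hN) (hH.1.lang hT) h2
    (by simp [EvalFree, hA.1.evalFree, hB.1.evalFree])
    (by simp [Binds, eqE, impE, binds_of_not_free, hb hA (show hN < paramN by decide),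
      hb hB (show hN < paramN by decide)])
  simpa [sub, sub_param hA (show hN < paramN by decide),
    sub_param hB (show hN < paramN by decide)] using h3

namespace IsHenkin
variable {Δ : Expr κ oₜ → Prop}

theorem eq_iff (hΔ : T.IsHenkin Δ) {A B : Expr κ oₜ} (h : T ⊢ₚ A =ₑ B) : Δ A ↔ Δ B := by
  have hL : ∀ C ∈ [A, B], T.Lang C := by simpa using ⟨h.left, h.right⟩
  refine ⟨hΔ.mp (hΔ.thm (modus_ponens (PropForm.provable (.imp (.iff (.atom 0) (.atom 1))
    (.imp (.atom 0) (.atom 1))) [A, B] hL) h)), hΔ.mp (hΔ.thm (modus_ponens (PropForm.provable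
    (.imp (.iff (.atom 0) (.atom 1)) (.imp (.atom 1) (.atom 0))) [A, B] hL) h))⟩

theorem of_eq (hT : IsRealTheory T) (hΔ : T.IsHenkin Δ) {A B : Expr κ oₜ} (hA : A.IsParam)
    (hB : B.IsParam) (h : Δ (A =ₑ B)) : Δ A ↔ Δ B := by
  have hL : ∀ C ∈ [A, B], T.Lang C := by simpa using ⟨hA.1.lang hT, hB.1.lang hT⟩
  exact ⟨hΔ.mp (hΔ.mp (hΔ.thm (PropForm.provable (.imp (.iff (.atom 0) (.atom 1))
    (.imp (.atom 0) (.atom 1))) [A, B] hL)) h), hΔ.mp (hΔ.mp (hΔ.thm (PropForm.provable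
    (.imp (.iff (.atom 0) (.atom 1)) (.imp (.atom 1) (.atom 0))) [A, B] hL)) h)⟩

theorem subst (hT : IsRealTheory T) (hΔ : T.IsHenkin Δ) {α : Ty} {A B : Expr κ α}
    (hA : A.IsParam) (hB : B.IsParam) {H : Expr κ (α ⟶ₜ oₜ)} (hH : H.IsParam)
    {A' B' : Expr κ oₜ} (hA' : T ⊢ₚ H ⬝ A =ₑ A') (hB' : T ⊢ₚ H ⬝ B =ₑ B') (h : Δ (A =ₑ B)) :
    Δ A' → Δ B' := by
  rw [← hΔ.eq_iff hA', ← hΔ.eq_iff hB', hΔ.of_eq hT (hH.app hA) (hH.app hB)]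
  · exact id
  · exact hΔ.mp (hΔ.thm (leibniz hT hA hB hH)) h

theorem isParam_lam {β : Ty} {B : Expr κ β} {n : ℕ} {α : Ty} (hB : B.Pure)
    (h : ∀ m γ, FreeIn m γ B → (n, α) = (m, γ) ∨ paramN ≤ m) : (Expr.lam n α B).IsParam :=
  ⟨hB, fun m γ hf => (h m γ hf.2).resolve_left hf.1⟩

theorem beta_param (hT : IsRealTheory T) {α β : Ty} {C : Expr κ β} (hC : C.IsParam) {k : ℕ}
    (hk : k < paramN) {A : Expr κ α} (hA : A.IsParam) : T ⊢ₚ Expr.lam k α C ⬝ A =ₑ C :=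
  beta_not_free hC.1.evalFree (fun h => absurd (hC.2 _ _ h) (by omega)) (hC.1.lang hT)
    (hA.1.lang hT)

theorem refl (hT : IsRealTheory T) (hΔ : T.IsHenkin Δ) {α : Ty} {A : Expr κ α}
    (hA : A.IsParam) : Δ (A =ₑ A) := hΔ.thm (Theory.refl (hA.1.lang hT))

theorem symm (hT : IsRealTheory T) (hΔ : T.IsHenkin Δ) {α : Ty} {A B : Expr κ α}
    (hA : A.IsParam) (hB : B.IsParam) (h : Δ (A =ₑ B)) : Δ (B =ₑ A) := by
  have hH : (Expr.lam zN α (zv α =ₑ A)).IsParam := isParam_lam (by simp [Expr.Pure, hA.1])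
    fun m γ hf => by
      rw [freeIn_eqE] at hf
      exact hf.imp (fun e => Prod.ext e.1 e.2) (hA.2 m γ)
  have hb : ∀ {C : Expr κ α}, C.IsParam → T ⊢ₚ Expr.lam zN α (zv α =ₑ A) ⬝ C =ₑ (C =ₑ A) :=
    fun hC => beta_app (beta_app (beta_const (hC.1.lang hT) (T.lang_eq _))
      (beta_self (hC.1.lang hT))) (beta_param hT hA (by decide) hC)
  exact hΔ.subst hT hA hB hH (hb hA) (hb hB) h (hΔ.refl hT hA)

theorem trans (hT : IsRealTheory T) (hΔ : T.IsHenkin Δ) {α : Ty} {A B C : Expr κ α}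
    (hA : A.IsParam) (hB : B.IsParam) (hC : C.IsParam) (h : Δ (A =ₑ B)) (h' : Δ (B =ₑ C)) :
    Δ (A =ₑ C) := by
  have hH : (Expr.lam zN α (A =ₑ zv α)).IsParam := isParam_lam (by simp [Expr.Pure, hA.1])
    fun m γ hf => by
      rw [freeIn_eqE] at hf
      exact hf.symm.imp (fun e => Prod.ext e.1 e.2) (hA.2 m γ)
  have hb : ∀ {C : Expr κ α}, C.IsParam → T ⊢ₚ Expr.lam zN α (A =ₑ zv α) ⬝ C =ₑ (A =ₑ C) :=
    fun hC => beta_app (beta_app (beta_const (hC.1.lang hT) (T.lang_eq _))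
      (beta_param hT hA (by decide) hC)) (beta_self (hC.1.lang hT))
  exact hΔ.subst hT hB hC hH (hb hB) (hb hC) h' h

theorem app (hT : IsRealTheory T) (hΔ : T.IsHenkin Δ) {α β : Ty} {F G : Expr κ (α ⟶ₜ β)}
    {A B : Expr κ α} (hF : F.IsParam) (hG : G.IsParam) (hA : A.IsParam) (hB : B.IsParam)
    (h : Δ (F =ₑ G)) (h' : Δ (A =ₑ B)) : Δ (F ⬝ A =ₑ G ⬝ B) := by
  have h1 : Δ (F ⬝ A =ₑ F ⬝ B) := by
    have hH : (Expr.lam zN α (F ⬝ A =ₑ F ⬝ zv α)).IsParam :=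
      isParam_lam (by simp [Expr.Pure, hA.1, hF.1]) fun m γ hf => by
        rw [freeIn_eqE] at hf
        rcases hf with hf | hf | hf
        exacts [Or.inr ((hF.app hA).2 m γ hf), Or.inr (hF.2 m γ hf),
          Or.inl (Prod.ext hf.1 hf.2)]
    have hb : ∀ {C : Expr κ α}, C.IsParam →
        T ⊢ₚ Expr.lam zN α (F ⬝ A =ₑ F ⬝ zv α) ⬝ C =ₑ (F ⬝ A =ₑ F ⬝ C) :=
      fun hC => beta_app (beta_app (beta_const (hC.1.lang hT) (T.lang_eq _))
        (beta_param hT (hF.app hA) (by decide) hC))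
        (beta_app (beta_param hT hF (by decide) hC) (beta_self (hC.1.lang hT)))
    exact hΔ.subst hT hA hB hH (hb hA) (hb hB) h' (hΔ.refl hT (hF.app hA))
  have h2 : Δ (F ⬝ B =ₑ G ⬝ B) := by
    have hH : (Expr.lam zN (α ⟶ₜ β) (F ⬝ B =ₑ zv (α ⟶ₜ β) ⬝ B)).IsParam :=
      isParam_lam (by simp [Expr.Pure, hB.1, hF.1]) fun m γ hf => by
        rw [freeIn_eqE] at hf
        rcases hf with hf | hf | hf
        exacts [Or.inr ((hF.app hB).2 m γ hf), Or.inl (Prod.ext hf.1 hf.2),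
          Or.inr (hB.2 m γ hf)]
    have hb : ∀ {C : Expr κ (α ⟶ₜ β)}, C.IsParam →
        T ⊢ₚ Expr.lam zN (α ⟶ₜ β) (F ⬝ B =ₑ zv (α ⟶ₜ β) ⬝ B) ⬝ C =ₑ (F ⬝ B =ₑ C ⬝ B) :=
      fun hC => beta_app (beta_app (beta_const (hC.1.lang hT) (T.lang_eq _))
        (beta_param hT (hF.app hB) (by decide) hC))
        (beta_app (beta_self (hC.1.lang hT)) (beta_param hT hB (by decide) hC))
    exact hΔ.subst hT hF hG hH (hb hF) (hb hG) h (hΔ.refl hT (hF.app hB))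
  exact hΔ.trans hT (hF.app hA) (hF.app hB) (hG.app hB) h1 h2

/-- Provable equality relative to a Henkin set. -/
def setoid (hT : IsRealTheory T) (hΔ : T.IsHenkin Δ) (α : Ty) :
    Setoid {A : Expr κ α // A.IsParam} where
  r A B := Δ (A.1 =ₑ B.1)
  iseqv := ⟨fun A => hΔ.refl hT A.2, fun {A B} => hΔ.symm hT A.2 B.2,
    fun {A B C} => hΔ.trans hT A.2 B.2 C.2⟩

/-- The domains of the term model. -/
def Dom (hT : IsRealTheory T) (hΔ : T.IsHenkin Δ) (α : Ty) : Type u := Quotient (hΔ.setoid hT α)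

variable (hT : IsRealTheory T) (hΔ : T.IsHenkin Δ)

/-- The element of the term model given by an expression with parameters. -/
def cls {α : Ty} (A : Expr κ α) (hA : A.IsParam) : hΔ.Dom hT α := Quotient.mk _ ⟨A, hA⟩

theorem cls_eq {α : Ty} {A B : Expr κ α} {hA : A.IsParam} {hB : B.IsParam} :
    hΔ.cls hT A hA = hΔ.cls hT B hB ↔ Δ (A =ₑ B) := Quotient.eq (r := hΔ.setoid hT α)

/-- A representative of an element of the term model. -/
noncomputable def rep {α : Ty} (d : hΔ.Dom hT α) : Expr κ α := (Quotient.out d).1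

theorem rep_isParam {α : Ty} (d : hΔ.Dom hT α) : (hΔ.rep hT d).IsParam := (Quotient.out d).2

theorem cls_rep {α : Ty} (d : hΔ.Dom hT α) : hΔ.cls hT (hΔ.rep hT d) (hΔ.rep_isParam hT d) = d :=
  Quotient.out_eq d

noncomputable def appD {α β : Ty} (f : hΔ.Dom hT (α ⟶ₜ β)) (d : hΔ.Dom hT α) : hΔ.Dom hT β :=
  hΔ.cls hT (hΔ.rep hT f ⬝ hΔ.rep hT d) ((hΔ.rep_isParam hT f).app (hΔ.rep_isParam hT d))

theorem appD_cls {α β : Ty} {F : Expr κ (α ⟶ₜ β)} {A : Expr κ α} (hF : F.IsParam)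
    (hA : A.IsParam) :
    hΔ.appD hT (hΔ.cls hT F hF) (hΔ.cls hT A hA) = hΔ.cls hT (F ⬝ A) (hF.app hA) :=
  (hΔ.cls_eq hT).mpr (hΔ.app hT (hΔ.rep_isParam hT _) hF (hΔ.rep_isParam hT _) hA
    ((hΔ.cls_eq hT (hA := hΔ.rep_isParam hT _) (hB := hF)).mp (hΔ.cls_rep hT _))
    ((hΔ.cls_eq hT (hA := hΔ.rep_isParam hT _) (hB := hA)).mp (hΔ.cls_rep hT _)))

/-- The substitution of representatives given by an assignment. -/
noncomputable def repS (ρ : (p : ℕ × Ty) → hΔ.Dom hT p.2) : Subst κ := fun p => hΔ.rep hT (ρ p)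

theorem isParam_sub (ρ : (p : ℕ × Ty) → hΔ.Dom hT p.2) {α : Ty} {A : Expr κ α} (hA : A.Pure) :
    (sub (hΔ.repS hT ρ) A).IsParam :=
  ⟨hA.sub fun p _ => (hΔ.rep_isParam hT (ρ p)).1, fun n β h => by
    obtain ⟨p, _, hp⟩ := freeIn_sub A hA.evalFree _ h
    exact (hΔ.rep_isParam hT (ρ p)).2 _ _ hp⟩

open Classical in
/-- The denotation of an expression in the term model. -/
noncomputable def denD (ρ : (p : ℕ × Ty) → hΔ.Dom hT p.2) : {α : Ty} → Expr κ α → hΔ.Dom hT α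
  -- Variables and applications are treated recursively, so that `den_var` and `den_app` hold for
  -- all expressions. Other impure expressions receive a parameter as a default value.
  | _, Expr.var n α => ρ (n, α)
  | _, Expr.app F A => hΔ.appD hT (denD ρ F) (denD ρ A)
  | α, A => if hA : A.Pure then hΔ.cls hT _ (hΔ.isParam_sub hT ρ hA) else
    hΔ.cls hT (Expr.var paramN α) ⟨trivial, fun _ _ e => e.1 ▸ le_rfl⟩

theorem denD_eq (ρ : (p : ℕ × Ty) → hΔ.Dom hT p.2) {α : Ty} (A : Expr κ α) (hA : A.Pure) :
    hΔ.denD hT ρ A = hΔ.cls hT _ (hΔ.isParam_sub hT ρ hA) := by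
  induction A with
  | var n α => exact (hΔ.cls_rep hT _).symm
  | app F A ihF ihA => rw [denD, ihF hA.1, ihA hA.2, appD_cls]; rfl
  | eval β A => exact hA.elim
  | _ => rw [denD, dif_pos hA] <;> simp

theorem denD_congr (ρ ρ' : (p : ℕ × Ty) → hΔ.Dom hT p.2) {α : Ty} (A : Expr κ α) (hA : A.Pure)
    (h : ∀ σ : Subst κ, sub σ A = A) : hΔ.denD hT ρ A = hΔ.denD hT ρ' A := by
  rw [denD_eq _ _ _ _ hA, denD_eq _ _ _ _ hA]
  congr 1
  rw [h, h]

theorem repS_update (ρ : (p : ℕ × Ty) → hΔ.Dom hT p.2) (n : ℕ) (α : Ty) (d : hΔ.Dom hT α) :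
    hΔ.repS hT (Function.update ρ (n, α) d) = (hΔ.repS hT ρ).up n α (hΔ.rep hT d) := by
  funext p
  by_cases h : p = (n, α)
  · subst h; rw [Subst.up_self]; simp only [repS, Function.update_self]
  · rw [Subst.up_ne _ _ h]; simp only [repS, Function.update_of_ne h]

theorem denD_lam (ρ : (p : ℕ × Ty) → hΔ.Dom hT p.2) (n : ℕ) (α : Ty) {β : Ty} (B : Expr κ β)
    (d : hΔ.Dom hT α) (hn : n < paramN) (hB : B.IsLaw) :
    hΔ.appD hT (hΔ.denD hT ρ (Expr.lam n α B)) d =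
      hΔ.denD hT (Function.update ρ (n, α) d) B := by
  have hp : ∀ (γ : Ty) (e : hΔ.Dom hT γ) m δ, m < paramN → ¬ FreeIn m δ (hΔ.rep hT e) :=
    fun γ e m δ hm h => absurd ((hΔ.rep_isParam hT e).2 _ _ h) (by omega)
  rw [denD_eq _ _ _ (Expr.lam n α B) hB.1, denD_eq _ _ _ _ hB.1]
  nth_rewrite 1 [← hΔ.cls_rep hT d]
  rw [appD_cls, cls_eq]
  refine hΔ.thm ?_
  rw [repS_update]
  have h := (T.inertClass_evalFree n α).beta (A := hΔ.rep hT d) ((hΔ.rep_isParam hT d).1.lang hT)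
    B hB.1.evalFree (hB.1.lang hT) ((hΔ.repS hT ρ).up n α (Expr.var n α))
    (Theory.LangS.up (fun p => (hΔ.rep_isParam hT (ρ p)).1.lang hT) trivial) (Subst.up_self _ _ _ _)
    (fun p hp' _ => by
      rw [Subst.up_ne _ _ hp']
      exact ⟨(hΔ.rep_isParam hT (ρ p)).1.evalFree, hp _ _ _ _ hn,
        (hΔ.rep_isParam hT (ρ p)).1.lang hT⟩)
    ((hB.2.binds n α).mono fun m γ hm => pass_of_evalFree (hΔ.rep_isParam hT d).1.evalFree
      (hp _ _ _ _ hm))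
  rwa [Subst.up_up] at h

/-- The elements of the term model that are true. -/
def TrD (a : hΔ.Dom hT oₜ) : Prop := Δ (hΔ.rep hT a)

theorem trD_cls {A : Expr κ oₜ} (hA : A.IsParam) : hΔ.TrD hT (hΔ.cls hT A hA) ↔ Δ A :=
  hΔ.of_eq hT (hΔ.rep_isParam hT _) hA ((hΔ.cls_eq hT).mp (hΔ.cls_rep hT _))

/-- Functions with the same values agree at their witness parameter, and the witness formula then
makes them equal. -/
theorem ext {α β : Ty} {f g : hΔ.Dom hT (α ⟶ₜ β)}
    (h : ∀ d, hΔ.appD hT f d = hΔ.appD hT g d) : f = g := by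
  obtain ⟨y, hy, hw⟩ := hΔ.witness (hΔ.rep_isParam hT f) (hΔ.rep_isParam hT g)
  have hv : (Expr.var y α : Expr κ α).IsParam := ⟨trivial, fun n γ e => e.1 ▸ hy⟩
  have h1 := h (hΔ.cls hT _ hv)
  rw [← hΔ.cls_rep hT f, ← hΔ.cls_rep hT g, appD_cls, appD_cls, cls_eq] at h1
  rw [← hΔ.cls_rep hT f, ← hΔ.cls_rep hT g, cls_eq]
  exact hΔ.mp hw h1

theorem TrD_ext {a b : hΔ.Dom hT oₜ} (h : hΔ.TrD hT a ↔ hΔ.TrD hT b) : a = b := by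
  have ha := hΔ.rep_isParam hT a
  have hb := hΔ.rep_isParam hT b
  rw [← hΔ.cls_rep hT a, ← hΔ.cls_rep hT b, cls_eq]
  have hL : ∀ C ∈ [hΔ.rep hT a, hΔ.rep hT b], T.Lang C := by
    simpa using ⟨ha.1.lang hT, hb.1.lang hT⟩
  have hnot : ∀ {A : Expr κ oₜ}, A.IsParam → Δ (¬ₑ A) → ¬ Δ A := fun {A} hA h h' =>
    hΔ.consistent (hΔ.mp (hΔ.mp (hΔ.thm (PropForm.provable (.imp (.neg (.atom 0))
      (.imp (.atom 0) .fls)) [A] (by simpa using hA.1.lang hT))) h) h')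
  rcases hΔ.decides ha with h1 | h1
  · exact hΔ.mp (hΔ.mp (hΔ.thm (PropForm.provable (.imp (.atom 0) (.imp (.atom 1)
      (.iff (.atom 0) (.atom 1)))) _ hL)) h1) (h.mp h1)
  · have h2 := (hΔ.decides hb).resolve_left fun h2 => hnot ha h1 (h.mpr h2)
    exact hΔ.mp (hΔ.mp (hΔ.thm (PropForm.provable (.imp (.neg (.atom 0)) (.imp (.neg (.atom 1))
      (.iff (.atom 0) (.atom 1)))) _ hL)) h1) h2

/-- The assignment of parameters to all variables. -/
def paramEnv : (p : ℕ × Ty) → hΔ.Dom hT p.2 := fun p =>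
  hΔ.cls hT (Expr.var paramN p.2) ⟨trivial, fun _ _ e => e.1 ▸ le_rfl⟩

/-- The term model. -/
noncomputable def model : Model T where
  D := hΔ.Dom hT
  app := hΔ.appD hT
  den := hΔ.denD hT
  Tr := hΔ.TrD hT
  ext := hΔ.ext hT
  Tr_ext := hΔ.TrD_ext hT
  den_var _ _ _ := rfl
  den_app _ _ _ _ _ := rfl
  den_lam := fun ρ n α _ B d hn hB => hΔ.denD_lam hT ρ n α B d hn hB
  env := hΔ.paramEnv hT
  con c := hΔ.denD hT (hΔ.paramEnv hT) (Expr.const c)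
  quo A := hΔ.denD hT (hΔ.paramEnv hT) (Expr.quote A)
  den_const ρ α c := by
    by_cases hc : c.Pure
    · exact hΔ.denD_congr hT ρ _ _ hc fun _ => rfl
    · rw [denD, denD, dif_neg (show ¬ (Expr.const c).Pure from hc),
        dif_neg (show ¬ (Expr.const c).Pure from hc)] <;> simp
  den_quote ρ α A := by
    by_cases hc : A.Pure
    · exact hΔ.denD_congr hT ρ _ _ hc fun _ => rfl
    · rw [denD, denD, dif_neg (show ¬ (Expr.quote A).Pure from hc),
        dif_neg (show ¬ (Expr.quote A).Pure from hc)] <;> simp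
  Tr_eq a b := by
    rw [denD_eq _ _ _ (Expr.const _) (by simp [Expr.Pure, Const.Pure]), ← hΔ.cls_rep hT a, ← hΔ.cls_rep hT b,
      appD_cls, appD_cls, trD_cls, cls_eq]
    rfl
  sound ρ A h hA := by
    rw [denD_eq _ _ _ _ hA.1, trD_cls]
    -- The free variables of a law are small and its binders do not capture parameters, so the
    -- instance by representatives is itself a theorem.
    refine hΔ.thm (inst_all (P := fun n => paramN ≤ n) h hA.1.evalFree
      (fun n α hf => not_le.mpr (hA.2.freeIn_lt hf))
      (fun k α => (hA.2.binds k α).mono fun m _ hm => not_le.mpr hm) _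
      (fun p => (hΔ.rep_isParam hT (ρ p)).1.lang hT)
      fun p => ⟨(hΔ.rep_isParam hT (ρ p)).1.evalFree, (hΔ.rep_isParam hT (ρ p)).2⟩)
  not_false ρ := by
    rw [denD_eq _ _ _ _ pure_falE, trD_cls, sub_falE]
    exact hΔ.consistent

end IsHenkin

/-- If A is not provable, then ¬A is consistent and the term model of a Henkin set containing it
refutes A. A closed formula has parameters only, and the insertion of representatives does not
change it. -/
theorem completeness_closed (hT : IsRealTheory T) {A : Expr κ oₜ} (hA : A.Pure)
    (hc : ∀ n α, ¬ FreeIn n α A) (h : ∀ (M : Model T) ρ, M.Tr (M.den ρ A)) : T ⊢ₚ A := by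
  by_contra hn
  have hL := hA.lang hT
  have hcons : T.Consistent (¬ₑ A) := fun h' => hn (modus_ponens (PropForm.provable
    (.imp (.neg (.neg (.atom 0))) (.atom 0)) [A] (by simpa using hL)) h')
  obtain ⟨Δ, hΔ, hneg⟩ := exists_henkin hT hcons ⟨by simpa using hA, by simp [hc]⟩
  have h1 := h (hΔ.model hT) (hΔ.paramEnv hT)
  change hΔ.TrD hT (hΔ.denD hT _ A) at h1
  rw [IsHenkin.denD_eq _ _ _ _ hA, IsHenkin.trD_cls, sub_closed A hA.evalFree _ hc] at h1
  exact hΔ.consistent (hΔ.mp (hΔ.mp (hΔ.thm (PropForm.provable (.imp (.neg (.atom 0))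
      (.imp (.atom 0) .fls)) [A] (by simpa using hL))) hneg) h1)

/-- Removal of universal quantifiers. -/
theorem of_allE {n : ℕ} {α : Ty} {A : Expr κ oₜ} (h : T ⊢ₚ allE n α A) : T ⊢ₚ A :=
  (beta_same A (by simpa using h.lang)).mp (spec h (A := Expr.var n α) trivial)

theorem _root_.CTTqe.Model.tr_allE (M : Model T) (ρ : (p : ℕ × Ty) → M.D p.2) {n : ℕ} {α : Ty}
    {A : Expr κ oₜ} (hn : n < paramN) (hA : A.IsLaw) :
    M.Tr (M.den ρ (allE n α A)) ↔ ∀ d, M.Tr (M.den (Function.update ρ (n, α) d) A) := by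
  have ht : (truE : Expr κ oₜ).IsLaw := ⟨pure_truE, by simp [truE, eqE, Expr.Small]⟩
  have htr : ∀ ρ, M.Tr (M.den ρ truE) := fun ρ => M.sound ρ _ truth ht
  rw [allE, eqE, M.den_app, M.den_app, M.den_const, M.Tr_eq]
  constructor
  · intro h d
    rw [← M.den_lam ρ n α A d hn hA, ← h, M.den_lam ρ n α _ d hn ht]
    exact htr _
  · intro h
    refine M.ext fun d => ?_
    rw [M.den_lam ρ n α A d hn hA, M.den_lam ρ n α _ d hn ht]
    exact M.Tr_ext (iff_of_true (htr _) (h d))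

theorem small_allE {n : ℕ} {α : Ty} {A : Expr κ oₜ} (hn : n < paramN) (hA : A.Small) :
    (allE n α A).Small := by
  simp [allE, eqE, truE, Expr.Small, hn, hA]

/-- Pure formulas that hold in all models are theorems. -/
theorem completeness (hT : IsRealTheory T) {A : Expr κ oₜ} (hA : A.IsLaw)
    (h : ∀ (M : Model T) ρ, M.Tr (M.den ρ A)) : T ⊢ₚ A := by
  obtain ⟨L, hL⟩ := A.exists_list
  -- Small free variables are not parameters, hence they are first removed by universal
  -- quantification, one at a time.
  have key : ∀ (L : List (ℕ × Ty)) (B : Expr κ oₜ), B.IsLaw →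
      (∀ p : ℕ × Ty, FreeIn p.1 p.2 B → p ∈ L) → (∀ (M : Model T) ρ, M.Tr (M.den ρ B)) →
      T ⊢ₚ B := by
    intro L
    induction L with
    | nil =>
      intro B hB hf h
      exact completeness_closed hT hB.1 (fun n α hf' => by simpa using hf (n, α) hf') h
    | cons p L ih =>
      intro B hB hf h
      by_cases hp : p.1 < paramN
      · refine of_allE (n := p.1) (α := p.2) (ih _ ⟨by simpa using hB.1, small_allE hp hB.2⟩ ?_ ?_)
        · intro q hq
          rw [freeIn_allE] at hq
          exact (List.mem_cons.mp (hf q hq.2)).resolve_left fun e => hq.1 (by rw [e])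
        · intro M ρ
          rw [M.tr_allE ρ hp hB]
          exact fun d => h M _
      · refine ih _ hB (fun q hq => (List.mem_cons.mp (hf q hq)).resolve_left ?_) h
        rintro rfl
        exact hp (hB.2.freeIn_lt hq)
  exact key L A hA hL h

end Theory
end CTTqe

namespace CTTqe

/-! ## Derivatives in ordered fields -/

section OrderedField
variable {K : Type u} [Field K] [LinearOrder K] [IsStrictOrderedRing K]

/-- The element `d` is the limit of the difference quotients of `f` at `x`. -/
def HasDerivLim (f : K → K) (x d : K) : Prop :=
  ∀ u, 0 < u → ∃ v, 0 < v ∧ ∀ h, h ≠ 0 ∧ -v < h ∧ h < v →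
    -u < (f (x + h) + -f x) * h⁻¹ + -d ∧ (f (x + h) + -f x) * h⁻¹ + -d < u

open Filter Topology

/-- The sets |y − a| < u form a neighbourhood basis for the order topology of any ordered field. The
rules for derivatives become limit rules, and the individuals of a model need not be the standard
real numbers. -/
theorem hasDerivLim_iff [TopologicalSpace K] [OrderTopology K] {f : K → K} {x d : K} :
    HasDerivLim f x d ↔ Tendsto (fun h => (f (x + h) + -f x) * h⁻¹) (𝓝[≠] 0) (𝓝 d) := by
  rw [((nhdsWithin_hasBasis (nhds_basis_abs_sub_lt (0 : K)) {0}ᶜ).tendsto_iff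
    (nhds_basis_abs_sub_lt d))]
  unfold HasDerivLim
  refine forall_congr' fun u => imp_congr_right fun _ => exists_congr fun v =>
    and_congr_right fun _ => ?_
  simp only [Set.mem_inter_iff, Set.mem_ofPred_eq, abs_lt, Set.mem_compl_iff,
    Set.mem_singleton_iff, sub_eq_add_neg, neg_zero, add_zero]
  exact forall_congr' fun h => by tauto

theorem HasDerivLim.unique {f : K → K} {x d d' : K} (h : HasDerivLim f x d)
    (h' : HasDerivLim f x d') : d = d' := by
  let _ : TopologicalSpace K := Preorder.topology K
  have : OrderTopology K := ⟨rfl⟩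
  exact tendsto_nhds_unique (hasDerivLim_iff.mp h) (hasDerivLim_iff.mp h')

theorem HasDerivLim.const (c x : K) : HasDerivLim (fun _ => c) x 0 := by
  let _ : TopologicalSpace K := Preorder.topology K
  have : OrderTopology K := ⟨rfl⟩
  exact hasDerivLim_iff.mpr (by simp)

theorem HasDerivLim.id (x : K) : HasDerivLim (fun y => y) x 1 := by
  let _ : TopologicalSpace K := Preorder.topology K
  have : OrderTopology K := ⟨rfl⟩
  refine hasDerivLim_iff.mpr (tendsto_const_nhds.congr' ?_)
  filter_upwards [self_mem_nhdsWithin] with h hh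
  have : h ≠ 0 := hh
  field_simp
  ring

theorem HasDerivLim.neg {f : K → K} {x d : K} (h : HasDerivLim f x d) :
    HasDerivLim (fun y => -f y) x (-d) := by
  let _ : TopologicalSpace K := Preorder.topology K
  have : OrderTopology K := ⟨rfl⟩
  refine hasDerivLim_iff.mpr ((hasDerivLim_iff.mp h).neg.congr fun h => ?_)
  ring

theorem HasDerivLim.add {f g : K → K} {x d e : K} (hf : HasDerivLim f x d)
    (hg : HasDerivLim g x e) : HasDerivLim (fun y => f y + g y) x (d + e) := by
  let _ : TopologicalSpace K := Preorder.topology K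
  have : OrderTopology K := ⟨rfl⟩
  refine hasDerivLim_iff.mpr
    (((hasDerivLim_iff.mp hf).add (hasDerivLim_iff.mp hg)).congr fun h => ?_)
  ring

theorem HasDerivLim.mul {f g : K → K} {x d e : K} (hf : HasDerivLim f x d)
    (hg : HasDerivLim g x e) :
    HasDerivLim (fun y => f y * g y) x (d * g x + f x * e) := by
  let _ : TopologicalSpace K := Preorder.topology K
  have : OrderTopology K := ⟨rfl⟩
  have hf' := hasDerivLim_iff.mp hf
  have hg' := hasDerivLim_iff.mp hg
  have hid : Tendsto (fun h : K => h) (𝓝[≠] 0) (𝓝 0) := nhdsWithin_le_nhds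
  -- Continuity of g at x: for h ≠ 0, g(x + h) is the difference quotient times h, plus g(x).
  have hcont : Tendsto (fun h => g (x + h)) (𝓝[≠] 0) (𝓝 (g x)) := by
    have := ((hg'.mul hid).add_const (g x))
    simp only [mul_zero, zero_add] at this
    refine this.congr' ?_
    filter_upwards [self_mem_nhdsWithin] with h hh
    have : h ≠ 0 := hh
    field_simp
    ring
  -- The increment of the product is (f(x + h) − f(x)) g(x + h) + f(x) (g(x + h) − g(x)).
  refine hasDerivLim_iff.mpr (((hf'.mul hcont).add (hg'.const_mul (f x))).congr fun h => ?_)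
  ring

end OrderedField

end CTTqe

namespace CTTqe
variable {κ : Ty → Type u} {T : Theory κ}

/-! ## Pure expressions with small names -/

@[simp] theorem hN_lt : hN < paramN := by decide
@[simp] theorem uN_lt : uN < paramN := by decide
@[simp] theorem vN_lt : vN < paramN := by decide
@[simp] theorem wN_lt : wN < paramN := by decide
@[simp] theorem xN_lt : xN < paramN := by decide
@[simp] theorem yN_lt : yN < paramN := by decide
@[simp] theorem zN_lt : zN < paramN := by decide
@[simp] theorem pN_lt : pN < paramN := by decide

section IsLaw
variable {α β : Ty} {n : ℕ} {A B : Expr κ oₜ} {C D : Expr κ α}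

@[simp] theorem isLaw_var : (Expr.var n α : Expr κ α).IsLaw ↔ n < paramN := by
  simp [Expr.IsLaw, Expr.Pure, Expr.Small]
@[simp] theorem isLaw_const {c : Const κ α} : (Expr.const c).IsLaw ↔ c.Pure := by
  simp [Expr.IsLaw, Expr.Pure, Expr.Small]
@[simp] theorem isLaw_app {F : Expr κ (α ⟶ₜ β)} : (F ⬝ C).IsLaw ↔ F.IsLaw ∧ C.IsLaw := by
  simp only [Expr.IsLaw, Expr.Pure, Expr.Small]; tauto
@[simp] theorem isLaw_lam {F : Expr κ β} : (Expr.lam n α F).IsLaw ↔ n < paramN ∧ F.IsLaw := by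
  simp only [Expr.IsLaw, Expr.Pure, Expr.Small]; tauto
@[simp] theorem isLaw_quote : (Expr.quote C).IsLaw ↔ C.Pure := by
  simp [Expr.IsLaw, Expr.Pure, Expr.Small]

theorem isLaw_truE : (truE : Expr κ oₜ).IsLaw := ⟨by simp, by simp [truE, eqE, Expr.Small]⟩
theorem isLaw_falE : (falE : Expr κ oₜ).IsLaw :=
  ⟨by simp, by simp [falE, truE, eqE, Expr.Small]⟩
theorem isLaw_andC : (andC : Expr κ _).IsLaw :=
  ⟨by simp, by simp [andC, truE, eqE, Expr.Small]⟩
theorem isLaw_impC : (impC : Expr κ _).IsLaw :=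
  ⟨by simp, by have := (isLaw_andC (κ := κ)).2; simp [impC, andE, eqE, Expr.Small, this]⟩
theorem isLaw_negC : (negC : Expr κ _).IsLaw :=
  ⟨by simp, by have := (isLaw_falE (κ := κ)).2; simp [negC, Expr.Small, this]⟩
theorem isLaw_orC : (orC : Expr κ _).IsLaw :=
  ⟨by simp, by
    have h1 := (isLaw_andC (κ := κ)).2
    have h2 := (isLaw_negC (κ := κ)).2
    simp [orC, andE, negE, Expr.Small, h1, h2]⟩
attribute [simp] isLaw_truE isLaw_falE isLaw_andC isLaw_impC isLaw_negC isLaw_orC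

@[simp] theorem isLaw_eqE : (C =ₑ D).IsLaw ↔ C.IsLaw ∧ D.IsLaw := by
  simp [eqE, Const.Pure]
@[simp] theorem isLaw_andE : (A ∧ₑ B).IsLaw ↔ A.IsLaw ∧ B.IsLaw := by simp [andE]
@[simp] theorem isLaw_impE : (A ⊃ₑ B).IsLaw ↔ A.IsLaw ∧ B.IsLaw := by simp [impE]
@[simp] theorem isLaw_orE : (A ∨ₑ B).IsLaw ↔ A.IsLaw ∧ B.IsLaw := by simp [orE]
@[simp] theorem isLaw_negE : (¬ₑ A).IsLaw ↔ A.IsLaw := by simp [negE]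
@[simp] theorem isLaw_allE : (allE n α A).IsLaw ↔ n < paramN ∧ A.IsLaw := by
  simp only [allE, isLaw_eqE, isLaw_lam, isLaw_truE]; tauto
@[simp] theorem isLaw_exE : (exE n α A).IsLaw ↔ n < paramN ∧ A.IsLaw := by simp [exE]
@[simp] theorem isLaw_neE : (C ≠ₑ D).IsLaw ↔ C.IsLaw ∧ D.IsLaw := by simp [neE]

end IsLaw

/-! ## Truth in models -/

namespace Model
variable (M : Model T)

/-- The assignments of a model. -/
abbrev Env : Type u := (p : ℕ × Ty) → M.D p.2

/-- Change of an assignment at one variable. -/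
noncomputable def up (ρ : M.Env) (n : ℕ) (α : Ty) (d : M.D α) : M.Env := Function.update ρ (n, α) d

variable (ρ : M.Env) {α β : Ty} {n m : ℕ}

@[simp] theorem up_self (d : M.D α) : M.up ρ n α d (n, α) = d := Function.update_self _ _ _
@[simp] theorem up_ne (d : M.D α) (h : ¬ ((m, β) : ℕ × Ty) = (n, α)) :
    M.up ρ n α d (m, β) = ρ (m, β) := Function.update_of_ne h _ _

attribute [simp] Model.den_var Model.den_app Model.den_const Model.den_quote Model.Tr_eq

@[simp] theorem app_lam {B : Expr κ β} {d : M.D α} (hn : n < paramN) (hB : B.IsLaw) :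
    M.app (M.den ρ (Expr.lam n α B)) d = M.den (M.up ρ n α d) B := M.den_lam ρ n α B d hn hB

@[simp] theorem tr_eqE {C D : Expr κ α} : M.Tr (M.den ρ (C =ₑ D)) ↔ M.den ρ C = M.den ρ D := by
  simp [eqE]

@[simp] theorem tr_truE : M.Tr (M.den ρ truE) := M.sound ρ _ Theory.truth isLaw_truE
@[simp] theorem tr_falE : ¬ M.Tr (M.den ρ falE) := M.not_false ρ

theorem isLaw_boolE (b : Bool) : (boolE b : Expr κ oₜ).IsLaw := by cases b <;> simp [boolE]

theorem tr_boolE (b : Bool) : M.Tr (M.den ρ (boolE b)) ↔ b = true := by cases b <;> simp [boolE]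

theorem exists_bool (a : M.D oₜ) : ∃ b, a = M.den ρ (boolE b) ∧ (M.Tr a ↔ b = true) := by
  by_cases h : M.Tr a
  · exact ⟨true, M.Tr_ext (iff_of_true h ((M.tr_boolE ρ true).mpr rfl)), by simp [h]⟩
  · exact ⟨false, M.Tr_ext (iff_of_false h (by simp [tr_boolE])), by simp [h]⟩

theorem den_eq_of_provable {C D : Expr κ α} (h : T ⊢ₚ C =ₑ D) (hC : C.IsLaw) (hD : D.IsLaw) :
    M.den ρ C = M.den ρ D := (M.tr_eqE ρ).mp (M.sound ρ _ h (by simp [hC, hD]))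

section Connectives
variable {A B : Expr κ oₜ}

/-- The truth table of the connective consists of theorems, which hold in the model, and every
element of type o is denoted by T or by F. -/
theorem tr_binary {O : Expr κ (oₜ ⟶ₜ oₜ ⟶ₜ oₜ)} (hO : O.IsLaw) {f : Bool → Bool → Bool}
    (h : ∀ a b, T ⊢ₚ O ⬝ boolE a ⬝ boolE b =ₑ boolE (f a b)) {P : Prop → Prop → Prop}
    (hf : ∀ a b, f a b = true ↔ P (a = true) (b = true)) :
    M.Tr (M.den ρ (O ⬝ A ⬝ B)) ↔ P (M.Tr (M.den ρ A)) (M.Tr (M.den ρ B)) := by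
  obtain ⟨a, ha, ha'⟩ := M.exists_bool ρ (M.den ρ A)
  obtain ⟨b, hb, hb'⟩ := M.exists_bool ρ (M.den ρ B)
  have h1 := M.den_eq_of_provable ρ (h a b) (by simp [hO, isLaw_boolE]) (isLaw_boolE _)
  rw [M.den_app, M.den_app, ← ha, ← hb] at h1
  rw [M.den_app, M.den_app, h1, tr_boolE, hf, propext ha', propext hb']

@[simp] theorem tr_andE : M.Tr (M.den ρ (A ∧ₑ B)) ↔ M.Tr (M.den ρ A) ∧ M.Tr (M.den ρ B) :=
  M.tr_binary ρ isLaw_andC Theory.and_bool (P := And) (by simp)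
@[simp] theorem tr_orE : M.Tr (M.den ρ (A ∨ₑ B)) ↔ M.Tr (M.den ρ A) ∨ M.Tr (M.den ρ B) :=
  M.tr_binary ρ isLaw_orC Theory.or_bool (P := Or) (by simp)
@[simp] theorem tr_impE : M.Tr (M.den ρ (A ⊃ₑ B)) ↔ (M.Tr (M.den ρ A) → M.Tr (M.den ρ B)) :=
  M.tr_binary ρ isLaw_impC Theory.imp_bool (P := fun a b => a → b) (by
    intro a b; cases a <;> cases b <;> simp)
@[simp] theorem tr_negE : M.Tr (M.den ρ (¬ₑ A)) ↔ ¬ M.Tr (M.den ρ A) := by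
  change M.Tr (M.den ρ (falE =ₑ A)) ↔ _
  rw [tr_eqE]
  refine ⟨fun h h' => M.tr_falE ρ (h ▸ h'), fun h => M.Tr_ext (iff_of_false (M.tr_falE ρ) h)⟩

theorem den_eq_iff : M.den ρ A = M.den ρ B ↔ (M.Tr (M.den ρ A) ↔ M.Tr (M.den ρ B)) :=
  ⟨fun h => by rw [h], M.Tr_ext⟩

@[simp] theorem tr_neE {C D : Expr κ α} : M.Tr (M.den ρ (C ≠ₑ D)) ↔ M.den ρ C ≠ M.den ρ D := by
  simp [neE]

@[simp] theorem tr_allE' (hn : n < paramN) (hA : A.IsLaw) :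
    M.Tr (M.den ρ (allE n α A)) ↔ ∀ d, M.Tr (M.den (M.up ρ n α d) A) := M.tr_allE ρ hn hA

@[simp] theorem tr_exE (hn : n < paramN) (hA : A.IsLaw) :
    M.Tr (M.den ρ (exE n α A)) ↔ ∃ d, M.Tr (M.den (M.up ρ n α d) A) := by
  rw [exE, tr_negE, tr_allE' _ _ hn (by simpa using hA)]
  simp

end Connectives

end Model

/-! ## The ordered field of individuals -/

@[simp] theorem pure_real {α : Ty} (c : RealConst α) : (Const.real c : Const κ α).Pure := trivial

section RealLaws
variable {A B : Expr κ ιₜ} {F : Expr κ (ιₜ ⟶ₜ ιₜ)} {C D : Expr κ εₜ}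

@[simp] theorem isLaw_zeroE : (zeroE : Expr κ ιₜ).IsLaw := by simp [zeroE]
@[simp] theorem isLaw_oneE : (oneE : Expr κ ιₜ).IsLaw := by simp [oneE]
@[simp] theorem isLaw_minusE : (-ₑ A).IsLaw ↔ A.IsLaw := by simp [minusE]
@[simp] theorem isLaw_plusE : (A +ₑ B).IsLaw ↔ A.IsLaw ∧ B.IsLaw := by simp [plusE]
@[simp] theorem isLaw_timesE : (A *ₑ B).IsLaw ↔ A.IsLaw ∧ B.IsLaw := by simp [timesE]
@[simp] theorem isLaw_recipE : (recipE A).IsLaw ↔ A.IsLaw := by simp [recipE]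
@[simp] theorem isLaw_posE : (posE A).IsLaw ↔ A.IsLaw := by simp [posE]
@[simp] theorem isLaw_lessE : (A <ₑ B).IsLaw ↔ A.IsLaw ∧ B.IsLaw := by simp [lessE]
@[simp] theorem isLaw_isDiffE : (isDiffE F).IsLaw ↔ F.IsLaw := by simp [isDiffE]
@[simp] theorem isLaw_derivE : (derivE F).IsLaw ↔ F.IsLaw := by simp [derivE]
@[simp] theorem isLaw_isPolyE : (isPolyE C).IsLaw ↔ C.IsLaw := by simp [isPolyE]
@[simp] theorem isLaw_polyDiffE : (polyDiffE C D).IsLaw ↔ C.IsLaw ∧ D.IsLaw := by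
  simp [polyDiffE]
@[simp] theorem isLaw_hasDerivE : (hasDerivE F A B).IsLaw ↔ F.IsLaw ∧ A.IsLaw ∧ B.IsLaw := by
  simp only [hasDerivE, isLaw_allE, isLaw_impE, isLaw_exE, isLaw_andE, isLaw_lessE, isLaw_neE,
    isLaw_minusE, isLaw_plusE, isLaw_timesE, isLaw_recipE, isLaw_app, isLaw_var, isLaw_zeroE]
  simp only [uN_lt, vN_lt, hN_lt]
  tauto

end RealLaws

namespace Model
variable (M : Model T) (hT : IsRealTheory T)

/-- The denotation of a constant of the theory of the real numbers. -/
abbrev rcon {α : Ty} (c : RealConst α) : M.D α := M.con (Const.real c)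

include hT in
theorem tr_field {A : Expr κ oₜ} (h : IsFieldFormula A) (hA : A.IsLaw) (ρ : M.Env) :
    M.Tr (M.den ρ A) := M.sound ρ A (Theory.Provable.hyp (hT.field_mem A h)) hA

def add (a b : M.D ιₜ) : M.D ιₜ := M.app (M.app (M.rcon .plus) a) b
def mul (a b : M.D ιₜ) : M.D ιₜ := M.app (M.app (M.rcon .times) a) b
def neg (a : M.D ιₜ) : M.D ιₜ := M.app (M.rcon .minus) a
def recip (a : M.D ιₜ) : M.D ιₜ := M.app (M.rcon .recip) a
def pos (a : M.D ιₜ) : Prop := M.Tr (M.app (M.rcon .pos) a)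
def less (a b : M.D ιₜ) : Prop := M.Tr (M.app (M.app (M.rcon .less) a) b)

section
variable (ρ : M.Env) {A B : Expr κ ιₜ}
@[simp] theorem den_plusE : M.den ρ (A +ₑ B) = M.add (M.den ρ A) (M.den ρ B) := by
  simp [plusE, add]
@[simp] theorem den_timesE : M.den ρ (A *ₑ B) = M.mul (M.den ρ A) (M.den ρ B) := by
  simp [timesE, mul]
@[simp] theorem den_minusE : M.den ρ (-ₑ A) = M.neg (M.den ρ A) := by simp [minusE, neg]
@[simp] theorem den_recipE : M.den ρ (recipE A) = M.recip (M.den ρ A) := by simp [recipE, recip]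
@[simp] theorem den_zeroE : M.den ρ zeroE = M.rcon .zero := by simp [zeroE]
@[simp] theorem den_oneE : M.den ρ oneE = M.rcon .one := by simp [oneE]
@[simp] theorem tr_posE : M.Tr (M.den ρ (posE A)) ↔ M.pos (M.den ρ A) := by simp [posE, pos]
@[simp] theorem tr_lessE : M.Tr (M.den ρ (A <ₑ B)) ↔ M.less (M.den ρ A) (M.den ρ B) := by
  simp [lessE, less]
end

end Model

/-- The field of individuals of a model. -/
@[reducible] noncomputable def Model.field (M : Model T) (hT : IsRealTheory T) :
    Field (M.D ιₜ) := by
  have hf : ∀ {A : Expr κ oₜ}, IsFieldFormula A → A.IsLaw → ∀ ρ : M.Env, M.Tr (M.den ρ A) :=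
    fun h hA ρ => M.tr_field hT h hA ρ
  let e : M.D ιₜ → M.D ιₜ → M.D ιₜ → M.Env := fun a b c =>
    M.up (M.up (M.up M.env xN ιₜ a) yN ιₜ b) zN ιₜ c
  have add_assoc : ∀ a b c, M.add (M.add a b) c = M.add a (M.add b c) := fun a b c => by
    simpa [e] using hf .add_assoc (by simp) (e a b c)
  have add_comm : ∀ a b, M.add a b = M.add b a := fun a b => by
    simpa [e] using hf .add_comm (by simp) (e a b a)
  have add_zero : ∀ a, M.add a (M.rcon .zero) = a := fun a => by
    simpa [e] using hf .add_zero (by simp) (e a a a)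
  have add_neg : ∀ a, M.add a (M.neg a) = M.rcon .zero := fun a => by
    simpa [e] using hf .add_neg (by simp) (e a a a)
  have mul_assoc : ∀ a b c, M.mul (M.mul a b) c = M.mul a (M.mul b c) := fun a b c => by
    simpa [e] using hf .mul_assoc (by simp) (e a b c)
  have mul_comm : ∀ a b, M.mul a b = M.mul b a := fun a b => by
    simpa [e] using hf .mul_comm (by simp) (e a b a)
  have mul_one : ∀ a, M.mul a (M.rcon .one) = a := fun a => by
    simpa [e] using hf .mul_one (by simp) (e a a a)
  have mul_recip : ∀ a, a ≠ M.rcon .zero → M.mul a (M.recip a) = M.rcon .one := fun a => by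
    simpa [e] using hf .mul_recip (by simp) (e a a a)
  have zero_ne_one : M.rcon .zero ≠ M.rcon .one := by
    simpa [e] using hf .zero_ne_one (by simp) M.env
  have distrib : ∀ a b c, M.mul a (M.add b c) = M.add (M.mul a b) (M.mul a c) := fun a b c => by
    simpa [e] using hf .distrib (by simp) (e a b c)
  have mul_zero : ∀ a, M.mul a (M.rcon .zero) = M.rcon .zero := fun a => by
    have h1 : M.add (M.mul a (M.rcon .zero)) (M.mul a (M.rcon .zero)) =
        M.mul a (M.rcon .zero) := by rw [← distrib, add_zero]
    have h2 := congrArg (fun b => M.add b (M.neg (M.mul a (M.rcon .zero)))) h1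
    simpa only [add_assoc, add_neg, add_zero] using h2
  let _ : Zero (M.D ιₜ) := ⟨M.rcon .zero⟩
  let _ : Add (M.D ιₜ) := ⟨M.add⟩
  let _ : Neg (M.D ιₜ) := ⟨M.neg⟩
  exact
    { add := M.add
      zero := M.rcon .zero
      neg := M.neg
      mul := M.mul
      one := M.rcon .one
      nsmul := nsmulRec
      zsmul := zsmulRec
      -- The axioms leave the reciprocal of 0 undetermined, so it is redefined as 0. Difference
      -- quotients only use the reciprocal of h ≠ 0.
      inv := fun a => open Classical in if a = M.rcon .zero then M.rcon .zero else M.recip a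
      nnqsmul := _
      qsmul := _
      add_assoc := add_assoc
      zero_add := fun a => (add_comm _ a).trans (add_zero a)
      add_zero := add_zero
      neg_add_cancel := fun a => (add_comm _ a).trans (add_neg a)
      add_comm := add_comm
      mul_assoc := mul_assoc
      mul_comm := mul_comm
      one_mul := fun a => (mul_comm _ a).trans (mul_one a)
      mul_one := mul_one
      left_distrib := distrib
      right_distrib := fun a b c => by
        change M.mul (M.add a b) c = M.add (M.mul a c) (M.mul b c)
        rw [mul_comm, distrib, mul_comm c a, mul_comm c b]
      zero_mul := fun a => (mul_comm _ a).trans (mul_zero a)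
      mul_zero := mul_zero
      exists_pair_ne := ⟨_, _, zero_ne_one⟩
      mul_inv_cancel := fun a ha => (congrArg (M.mul a) (if_neg ha)).trans (mul_recip a ha)
      inv_zero := if_pos rfl }

section OrderedField
variable (M : Model T) (hT : IsRealTheory T)

/-- The order of the field of individuals of a model. -/
@[reducible] noncomputable def Model.linearOrder : LinearOrder (M.D ιₜ) := by
  let _ := M.field hT
  have hf : ∀ {A : Expr κ oₜ}, IsFieldFormula A → A.IsLaw → ∀ ρ : M.Env, M.Tr (M.den ρ A) :=
    fun h hA ρ => M.tr_field hT h hA ρ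
  let e : M.D ιₜ → M.D ιₜ → M.Env := fun a b => M.up (M.up M.env xN ιₜ a) yN ιₜ b
  have tri : ∀ a : M.D ιₜ, (a = 0 ∧ ¬ M.pos a ∧ ¬ M.pos (-a)) ∨ (a ≠ 0 ∧ M.pos a ∧ ¬ M.pos (-a)) ∨
      (a ≠ 0 ∧ ¬ M.pos a ∧ M.pos (-a)) := fun a => by
    have := hf .trichotomy (by simp) (e a a)
    simp [e] at this
    exact this
  have pos_add : ∀ a b : M.D ιₜ, M.pos a → M.pos b → M.pos (a + b) := fun a b h h' => by
    have := hf .pos_add (by simp) (e a b)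
    simp [e] at this
    exact this h h'
  have less_def : ∀ a b : M.D ιₜ, M.less a b ↔ M.pos (b + -a) := fun a b => by
    have := hf .less_def (by simp) (e a b)
    simp [e, Model.den_eq_iff] at this
    exact this
  have irrefl : ∀ a, ¬ M.less a a := fun a => by
    rw [less_def, add_neg_cancel]
    have := tri 0
    tauto
  have trans : ∀ a b c, M.less a b → M.less b c → M.less a c := fun a b c h h' => by
    rw [less_def] at *
    have := pos_add _ _ h h'
    rwa [show b + -a + (c + -b) = c + -a by ring] at this
  have total : ∀ a b, M.less a b ∨ a = b ∨ M.less b a := fun a b => by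
    rw [less_def, less_def]
    have := tri (b + -a)
    rw [show -(b + -a) = a + -b by ring, show b + -a = 0 ↔ a = b by grind] at this
    tauto
  exact
    { le := fun a b => M.less a b ∨ a = b
      lt := M.less
      le_refl := fun a => Or.inr rfl
      le_trans := fun a b c h h' => by
        rcases h with h | rfl
        · rcases h' with h' | rfl
          · exact Or.inl (trans _ _ _ h h')
          · exact Or.inl h
        · exact h'
      lt_iff_le_not_ge := fun a b => by
        constructor
        · refine fun h => ⟨Or.inl h, ?_⟩
          rintro (h' | rfl)
          · exact irrefl _ (trans _ _ _ h h')
          · exact irrefl _ h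
        · rintro ⟨h | rfl, h'⟩
          · exact h
          · exact (h' (Or.inr rfl)).elim
      le_antisymm := fun a b h h' => by
        rcases h with h | rfl
        · rcases h' with h' | rfl
          · exact (irrefl _ (trans _ _ _ h h')).elim
          · rfl
        · rfl
      le_total := fun a b => by
        have := total a b
        change (M.less a b ∨ a = b) ∨ (M.less b a ∨ b = a)
        tauto
      toDecidableLE := Classical.decRel _ }

theorem Model.isStrictOrderedRing :
    letI := M.field hT
    letI := M.linearOrder hT
    IsStrictOrderedRing (M.D ιₜ) := by
  let _ := M.field hT
  let _ := M.linearOrder hT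
  have hf : ∀ {A : Expr κ oₜ}, IsFieldFormula A → A.IsLaw → ∀ ρ : M.Env, M.Tr (M.den ρ A) :=
    fun h hA ρ => M.tr_field hT h hA ρ
  let e : M.D ιₜ → M.D ιₜ → M.Env := fun a b => M.up (M.up M.env xN ιₜ a) yN ιₜ b
  have less_def : ∀ a b : M.D ιₜ, a < b ↔ M.pos (b + -a) := fun a b => by
    have := hf .less_def (by simp) (e a b)
    simp [e, Model.den_eq_iff] at this
    exact this
  have pos_mul : ∀ a b : M.D ιₜ, M.pos a → M.pos b → M.pos (a * b) := fun a b h h' => by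
    have := hf .pos_mul (by simp) (e a b)
    simp [e] at this
    exact this h h'
  have hadd : ∀ a b : M.D ιₜ, a ≤ b → ∀ c, a + c ≤ b + c := fun a b h c => by
    rcases eq_or_lt_of_le h with rfl | h
    · exact le_rfl
    · refine le_of_lt ?_
      rw [less_def] at *
      rwa [show b + c + -(a + c) = b + -a by ring]
  have : IsOrderedAddMonoid (M.D ιₜ) := { add_le_add_left := hadd }
  have : ZeroLEOneClass (M.D ιₜ) := ⟨by
    rcases lt_trichotomy (0 : M.D ιₜ) 1 with h | h | h
    · exact h.le
    · exact (zero_ne_one h).elim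
    -- If 1 were negative, then −1 would be positive and so would be its square, which is 1.
    · have h' : (0 : M.D ιₜ) < -1 * -1 := by
        rw [less_def] at *
        rw [neg_zero, add_zero]
        rw [zero_add] at h
        exact pos_mul _ _ h h
      simpa using h'.le⟩
  refine IsStrictOrderedRing.of_mul_pos fun a b ha hb => ?_
  rw [less_def] at *
  rw [neg_zero, add_zero] at *
  exact pos_mul a b ha hb

end OrderedField

end CTTqe

namespace CTTqe
variable {κ : Ty → Type u} {T : Theory κ}

/-! ## Constructions in models -/

section
variable {α : Ty} {A B : Expr κ εₜ}
@[simp] theorem isLaw_isVarE : (isVarE A).IsLaw ↔ A.IsLaw := by simp [isVarE, Const.Pure]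
@[simp] theorem isLaw_isVarTE : (isVarTE α A).IsLaw ↔ A.IsLaw := by simp [isVarTE, Const.Pure]
@[simp] theorem isLaw_isConE : (isConE A).IsLaw ↔ A.IsLaw := by simp [isConE, Const.Pure]
@[simp] theorem isLaw_isConTE : (isConTE α A).IsLaw ↔ A.IsLaw := by simp [isConTE, Const.Pure]
@[simp] theorem isLaw_isExprE : (isExprE A).IsLaw ↔ A.IsLaw := by simp [isExprE, Const.Pure]
@[simp] theorem isLaw_isExprTE : (isExprTE α A).IsLaw ↔ A.IsLaw := by simp [isExprTE, Const.Pure]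
@[simp] theorem isLaw_appE : (appE A B).IsLaw ↔ A.IsLaw ∧ B.IsLaw := by simp [appE, Const.Pure]
@[simp] theorem isLaw_isFreeInE : (isFreeInE A B).IsLaw ↔ A.IsLaw ∧ B.IsLaw := by
  simp [isFreeInE, Const.Pure]
@[simp] theorem isLaw_subE : (A ⊏ₑ B).IsLaw ↔ A.IsLaw ∧ B.IsLaw := by simp [subE, Const.Pure]
@[simp] theorem pure_rc (c : RealConst α) : (rc c : Expr κ α).Pure := trivial
@[simp] theorem pure_var (n : ℕ) : (Expr.var n α : Expr κ α).Pure := trivial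
@[simp] theorem pure_zeroE : (zeroE : Expr κ ιₜ).Pure := trivial
@[simp] theorem pure_oneE : (oneE : Expr κ ιₜ).Pure := trivial
@[simp] theorem isLaw_qMinus : (qMinus A).IsLaw ↔ A.IsLaw := by simp [qMinus]
@[simp] theorem isLaw_qPlus : (qPlus A B).IsLaw ↔ A.IsLaw ∧ B.IsLaw := by simp [qPlus]
@[simp] theorem isLaw_qTimes : (qTimes A B).IsLaw ↔ A.IsLaw ∧ B.IsLaw := by simp [qTimes]
end

namespace Model
variable (M : Model T)

def poly (a : M.D εₜ) : Prop := M.Tr (M.app (M.rcon .isPoly) a)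
def diff (a b : M.D εₜ) : M.D εₜ := M.app (M.app (M.rcon .polyDiff) a) b
def isVar (a : M.D εₜ) : Prop := M.Tr (M.app (M.con .isVar) a)
def isVarT (α : Ty) (a : M.D εₜ) : Prop := M.Tr (M.app (M.con (.isVarT α)) a)
def isCon (a : M.D εₜ) : Prop := M.Tr (M.app (M.con .isCon) a)
def isConT (α : Ty) (a : M.D εₜ) : Prop := M.Tr (M.app (M.con (.isConT α)) a)
def isExpr (a : M.D εₜ) : Prop := M.Tr (M.app (M.con .isExpr) a)
def isExprT (α : Ty) (a : M.D εₜ) : Prop := M.Tr (M.app (M.con (.isExprT α)) a)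
def isFreeIn (a b : M.D εₜ) : Prop := M.Tr (M.app (M.app (M.con .isFreeIn) a) b)
def subc (a b : M.D εₜ) : Prop := M.Tr (M.app (M.app (M.con .subexpr) a) b)
def appc (a b : M.D εₜ) : M.D εₜ := M.app (M.app (M.con .app) a) b

/-- The denotation of the quotation of a constant. -/
def qcon {α : Ty} (c : RealConst α) : M.D εₜ := M.quo (rc c)
/-- The denotation of the quotation of a variable. -/
def qvar (n : ℕ) (α : Ty) : M.D εₜ := M.quo (Expr.var n α)
def qneg (a : M.D εₜ) : M.D εₜ := M.appc (M.qcon .minus) a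
def qadd (a b : M.D εₜ) : M.D εₜ := M.appc (M.appc (M.qcon .plus) a) b
def qmul (a b : M.D εₜ) : M.D εₜ := M.appc (M.appc (M.qcon .times) a) b

section
variable (ρ : M.Env) {α : Ty} {A B : Expr κ εₜ}
@[simp] theorem tr_isPolyE : M.Tr (M.den ρ (isPolyE A)) ↔ M.poly (M.den ρ A) := by
  simp [isPolyE, poly]
@[simp] theorem den_polyDiffE : M.den ρ (polyDiffE A B) = M.diff (M.den ρ A) (M.den ρ B) := by
  simp [polyDiffE, diff]
@[simp] theorem tr_isVarE : M.Tr (M.den ρ (isVarE A)) ↔ M.isVar (M.den ρ A) := by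
  simp [isVarE, isVar]
@[simp] theorem tr_isVarTE : M.Tr (M.den ρ (isVarTE α A)) ↔ M.isVarT α (M.den ρ A) := by
  simp [isVarTE, isVarT]
@[simp] theorem tr_isConE : M.Tr (M.den ρ (isConE A)) ↔ M.isCon (M.den ρ A) := by
  simp [isConE, isCon]
@[simp] theorem tr_isConTE : M.Tr (M.den ρ (isConTE α A)) ↔ M.isConT α (M.den ρ A) := by
  simp [isConTE, isConT]
@[simp] theorem tr_isExprE : M.Tr (M.den ρ (isExprE A)) ↔ M.isExpr (M.den ρ A) := by
  simp [isExprE, isExpr]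
@[simp] theorem tr_isExprTE : M.Tr (M.den ρ (isExprTE α A)) ↔ M.isExprT α (M.den ρ A) := by
  simp [isExprTE, isExprT]
@[simp] theorem tr_isFreeInE :
    M.Tr (M.den ρ (isFreeInE A B)) ↔ M.isFreeIn (M.den ρ A) (M.den ρ B) := by
  simp [isFreeInE, isFreeIn]
@[simp] theorem tr_subE : M.Tr (M.den ρ (A ⊏ₑ B)) ↔ M.subc (M.den ρ A) (M.den ρ B) := by
  simp [subE, subc]
@[simp] theorem den_appE : M.den ρ (appE A B) = M.appc (M.den ρ A) (M.den ρ B) := by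
  simp [appE, appc]
@[simp] theorem quo_rc (c : RealConst α) : M.quo (rc c) = M.qcon c := rfl
@[simp] theorem quo_zeroE : M.quo zeroE = M.qcon .zero := rfl
@[simp] theorem quo_oneE : M.quo oneE = M.qcon .one := rfl
@[simp] theorem quo_var (n : ℕ) : M.quo (Expr.var n α) = M.qvar n α := rfl
@[simp] theorem den_qMinus : M.den ρ (qMinus A) = M.qneg (M.den ρ A) := by simp [qMinus, qneg]
@[simp] theorem den_qPlus : M.den ρ (qPlus A B) = M.qadd (M.den ρ A) (M.den ρ B) := by
  simp [qPlus, qadd]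
@[simp] theorem den_qTimes : M.den ρ (qTimes A B) = M.qmul (M.den ρ A) (M.den ρ B) := by
  simp [qTimes, qmul]
end

variable (hT : IsRealTheory T)
include hT

theorem tr_logic {A : Expr κ oₜ} (h : IsAxiom A) (hA : A.IsLaw) (ρ : M.Env) : M.Tr (M.den ρ A) :=
  M.sound ρ A (Theory.Provable.logic h (hA.1.lang hT)) hA

theorem tr_calculus {A : Expr κ oₜ} (h : IsCalculusFormula A) (hA : A.IsLaw) (ρ : M.Env) :
    M.Tr (M.den ρ A) := M.sound ρ A (Theory.Provable.hyp (hT.calculus_mem A h)) hA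

theorem tr_poly {A : Expr κ oₜ} (h : IsPolyFormula A) (hA : A.IsLaw) (ρ : M.Env) :
    M.Tr (M.den ρ A) := M.sound ρ A (Theory.Provable.hyp (hT.poly_mem A h)) hA

theorem poly_iff (c : M.D εₜ) : M.poly c ↔ c = M.qvar xN ιₜ ∨ c = M.qvar yN ιₜ ∨
    c = M.qcon .zero ∨ c = M.qcon .one ∨ (∃ v, M.poly v ∧ c = M.qneg v) ∨
    (∃ v w, M.poly v ∧ M.poly w ∧ c = M.qadd v w) ∨
    (∃ v w, M.poly v ∧ M.poly w ∧ c = M.qmul v w) := by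
  have hB : (isPolyBody : Expr κ oₜ).IsLaw := by simp [isPolyBody]
  have h := M.tr_poly hT .isPoly_def (by simp [hB]) M.env
  rw [tr_eqE, den_const] at h
  rw [poly, rcon, h, app_lam _ _ (by simp) hB]
  simp [isPolyBody]

/-- In a model the induction axiom ranges only over the elements of type ε→o. Induction is therefore
available for properties given by a formula: p is interpreted by the denotation of λu.φ. -/
theorem code_induction {φ : Expr κ oₜ} (hφ : φ.IsLaw) (ρ : M.Env)
    (h : ∀ c, (∀ v, M.subc v c → M.Tr (M.den (M.up ρ uN εₜ v) φ)) →
      M.Tr (M.den (M.up ρ uN εₜ c) φ)) (c : M.D εₜ) : M.Tr (M.den (M.up ρ uN εₜ c) φ) := by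
  have := M.tr_logic hT .b6 (by simp) (M.up M.env pN (εₜ ⟶ₜ oₜ) (M.den ρ (Expr.lam uN εₜ φ)))
  simp only [tr_impE, tr_allE', isLaw_allE, isLaw_impE, isLaw_subE, isLaw_app, isLaw_var, uN_lt,
    vN_lt, pN_lt, true_and, den_app, den_var, tr_subE] at this
  simp [hφ] at this
  exact this h c

theorem subc_appc_right (a b : M.D εₜ) : M.subc b (M.appc a b) := by
  simpa using M.tr_logic hT .b5_2 (by simp) (M.up (M.up M.env xN εₜ b) yN εₜ a)

theorem subc_appc_left (a b : M.D εₜ) : M.subc a (M.appc a b) := by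
  simpa using M.tr_logic hT .b5_1 (by simp) (M.up (M.up M.env xN εₜ a) yN εₜ b)

theorem subc_trans {a b c : M.D εₜ} (h : M.subc a b) (h' : M.subc b c) : M.subc a c := by
  have := M.tr_logic hT .b5_6 (by simp) (M.up (M.up (M.up M.env xN εₜ a) yN εₜ b) zN εₜ c)
  simp at this
  exact this h h'

/-- Induction on constructions for the formula is-poly u ⊃ φ. The parts of a polynomial are proper
subconstructions; the left operand of a binary operation lies two applications deep, whence the use
of transitivity. -/
theorem poly_induction {φ : Expr κ oₜ} (hφ : φ.IsLaw) (ρ : M.Env)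
    (hx : M.Tr (M.den (M.up ρ uN εₜ (M.qvar xN ιₜ)) φ))
    (hy : M.Tr (M.den (M.up ρ uN εₜ (M.qvar yN ιₜ)) φ))
    (h0 : M.Tr (M.den (M.up ρ uN εₜ (M.qcon .zero)) φ))
    (h1 : M.Tr (M.den (M.up ρ uN εₜ (M.qcon .one)) φ))
    (hneg : ∀ v, M.poly v → M.Tr (M.den (M.up ρ uN εₜ v) φ) →
      M.Tr (M.den (M.up ρ uN εₜ (M.qneg v)) φ))
    (hadd : ∀ v w, M.poly v → M.poly w → M.Tr (M.den (M.up ρ uN εₜ v) φ) →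
      M.Tr (M.den (M.up ρ uN εₜ w) φ) → M.Tr (M.den (M.up ρ uN εₜ (M.qadd v w)) φ))
    (hmul : ∀ v w, M.poly v → M.poly w → M.Tr (M.den (M.up ρ uN εₜ v) φ) →
      M.Tr (M.den (M.up ρ uN εₜ w) φ) → M.Tr (M.den (M.up ρ uN εₜ (M.qmul v w)) φ))
    (c : M.D εₜ) (hc : M.poly c) : M.Tr (M.den (M.up ρ uN εₜ c) φ) := by
  have key := M.code_induction hT (φ := isPolyE (uv εₜ) ⊃ₑ φ) (by simp [hφ]) ρ (fun c ih => ?_) c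
  · simp at key; exact key hc
  · simp only [tr_impE, tr_isPolyE, den_var, up_self] at ih ⊢
    intro hc
    rcases (M.poly_iff hT c).mp hc with rfl | rfl | rfl | rfl | ⟨v, hv, rfl⟩ | ⟨v, w, hv, hw, rfl⟩ |
      ⟨v, w, hv, hw, rfl⟩
    · exact hx
    · exact hy
    · exact h0
    · exact h1
    · exact hneg v hv (ih v (M.subc_appc_right hT _ _) hv)
    · exact hadd v w hv hw
        (ih v (M.subc_trans hT (M.subc_appc_right hT _ _) (M.subc_appc_left hT _ _)) hv)
        (ih w (M.subc_appc_right hT _ _) hw)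
    · exact hmul v w hv hw
        (ih v (M.subc_trans hT (M.subc_appc_right hT _ _) (M.subc_appc_left hT _ _)) hv)
        (ih w (M.subc_appc_right hT _ _) hw)

/-! ## Syntactic properties of polynomials -/

theorem isVarT_qvar (n : ℕ) (α : Ty) : M.isVarT α (M.qvar n α) := by
  simpa using M.tr_logic hT (.b1_2 n α) (by simp) M.env

theorem isVar_qvar (n : ℕ) (α : Ty) : M.isVar (M.qvar n α) := by
  have := M.tr_logic hT (.b1_1 α) (by simp) (M.up M.env xN εₜ (M.qvar n α))
  simp at this
  exact this (M.isVarT_qvar hT n α)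

theorem isConT_qcon {α : Ty} (c : RealConst α) : M.isConT α (M.qcon c) := by
  have := M.tr_logic hT (.b2_2 (Const.real c)) (by simp [Expr.Pure]) M.env
  simp only [tr_isConTE, den_quote] at this
  exact this

theorem isCon_qcon {α : Ty} (c : RealConst α) : M.isCon (M.qcon c) := by
  have := M.tr_logic hT (.b2_1 α) (by simp) (M.up M.env xN εₜ (M.qcon c))
  simp at this
  exact this (M.isConT_qcon hT c)

theorem isExprT_qvar (n : ℕ) (α : Ty) : M.isExprT α (M.qvar n α) := by
  have := M.tr_logic hT (.b3_2 α) (by simp) (M.up M.env xN εₜ (M.qvar n α))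
  simp at this
  exact this (Or.inl (M.isVarT_qvar hT n α))

theorem isExprT_qcon {α : Ty} (c : RealConst α) : M.isExprT α (M.qcon c) := by
  have := M.tr_logic hT (.b3_2 α) (by simp) (M.up M.env xN εₜ (M.qcon c))
  simp at this
  exact this (Or.inr (M.isConT_qcon hT c))

theorem isExprT_appc {α β : Ty} {a b : M.D εₜ} (ha : M.isExprT (α ⟶ₜ β) a)
    (hb : M.isExprT α b) : M.isExprT β (M.appc a b) := by
  have := M.tr_logic hT (.b3_3 α β) (by simp) (M.up (M.up M.env xN εₜ a) yN εₜ b)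
  simp at this
  exact this ha hb

theorem isExpr_of_isExprT {α : Ty} {a : M.D εₜ} (ha : M.isExprT α a) : M.isExpr a := by
  have := M.tr_logic hT (.b3_1 α) (by simp) (M.up M.env xN εₜ a)
  simp at this
  exact this ha

theorem isExprT_poly (c : M.D εₜ) (hc : M.poly c) : M.isExprT ιₜ c := by
  have h := M.poly_induction hT (φ := isExprTE ιₜ (uv εₜ)) (by simp) M.env
  simp only [tr_isExprTE, den_var, up_self] at h
  exact h (M.isExprT_qvar hT _ _) (M.isExprT_qvar hT _ _) (M.isExprT_qcon hT _)
    (M.isExprT_qcon hT _) (fun v _ h => M.isExprT_appc hT (M.isExprT_qcon hT _) h)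
    (fun v w _ _ h h' => M.isExprT_appc hT (M.isExprT_appc hT (M.isExprT_qcon hT _) h) h')
    (fun v w _ _ h h' => M.isExprT_appc hT (M.isExprT_appc hT (M.isExprT_qcon hT _) h) h') c hc

theorem not_isFreeIn_qvar {n m : ℕ} {α β : Ty} (h : ((n, α) : ℕ × Ty) ≠ (m, β)) :
    ¬ M.isFreeIn (M.qvar n α) (M.qvar m β) := by
  have h1 := M.tr_logic hT (.b4_6 n α m β h) (by simp) M.env
  simp at h1
  have := M.tr_logic hT .b7_2 (by simp)
    (M.up (M.up M.env xN εₜ (M.qvar n α)) yN εₜ (M.qvar m β))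
  simp at this
  exact this (M.isVar_qvar hT _ _) (M.isVar_qvar hT _ _) h1

theorem not_isFreeIn_qcon (n : ℕ) (α : Ty) {β : Ty} (c : RealConst β) :
    ¬ M.isFreeIn (M.qvar n α) (M.qcon c) := by
  have := M.tr_logic hT .b7_3 (by simp)
    (M.up (M.up M.env xN εₜ (M.qvar n α)) yN εₜ (M.qcon c))
  simp at this
  exact this (M.isVar_qvar hT _ _) (M.isCon_qcon hT _)

theorem not_isFreeIn_appc (n : ℕ) (α : Ty) {β γ : Ty} {a b : M.D εₜ}
    (h1 : M.isExprT (β ⟶ₜ γ) a) (h2 : M.isExprT β b)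
    (ha : ¬ M.isFreeIn (M.qvar n α) a) (hb : ¬ M.isFreeIn (M.qvar n α) b) :
    ¬ M.isFreeIn (M.qvar n α) (M.appc a b) := by
  have := M.tr_logic hT .b7_4 (by simp)
    (M.up (M.up (M.up M.env xN εₜ (M.qvar n α)) yN εₜ a) zN εₜ b)
  simp [den_eq_iff] at this
  rw [this (M.isVar_qvar hT _ _) (M.isExpr_of_isExprT hT (M.isExprT_appc hT h1 h2))]
  tauto

/-- Together with `isExprT_poly` this supplies the premises of `b11_2` for every variable other than
x and y of type ι. -/
theorem not_isFreeIn_poly {n : ℕ} {α : Ty} (hx : ((n, α) : ℕ × Ty) ≠ (xN, ιₜ))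
    (hy : ((n, α) : ℕ × Ty) ≠ (yN, ιₜ)) (c : M.D εₜ) (hc : M.poly c) :
    ¬ M.isFreeIn (M.qvar n α) c := by
  have h := M.poly_induction hT
    (φ := ¬ₑ isFreeInE (Expr.quote (Expr.var n α)) (uv εₜ)) (by simp) M.env
  simp only [tr_negE, tr_isFreeInE, den_var, up_self, den_quote, quo_var] at h
  have hbin : ∀ (b : RealConst (ιₜ ⟶ₜ ιₜ ⟶ₜ ιₜ)) v w, M.poly v → M.poly w →
      ¬ M.isFreeIn (M.qvar n α) v → ¬ M.isFreeIn (M.qvar n α) w →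
      ¬ M.isFreeIn (M.qvar n α) (M.appc (M.appc (M.qcon b) v) w) := fun b v w hv hw h h' =>
    M.not_isFreeIn_appc hT _ _ (M.isExprT_appc hT (M.isExprT_qcon hT _) (M.isExprT_poly hT v hv))
      (M.isExprT_poly hT w hw) (M.not_isFreeIn_appc hT _ _ (M.isExprT_qcon hT _)
        (M.isExprT_poly hT v hv) (M.not_isFreeIn_qcon hT _ _ _) h) h'
  exact h (M.not_isFreeIn_qvar hT hx) (M.not_isFreeIn_qvar hT hy) (M.not_isFreeIn_qcon hT _ _ _)
    (M.not_isFreeIn_qcon hT _ _ _) (fun v hv h => M.not_isFreeIn_appc hT _ _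
      (M.isExprT_qcon hT _) (M.isExprT_poly hT v hv) (M.not_isFreeIn_qcon hT _ _ _) h)
    (hbin .plus) (hbin .times) c hc

/-! ## Symbolic differentiation in models -/

theorem diff_var_same (n : ℕ) : M.diff (M.qvar n ιₜ) (M.qvar n ιₜ) = M.qcon .one := by
  have := M.tr_poly hT .diff_var_same (by simp) (M.up M.env xN εₜ (M.qvar n ιₜ))
  simp at this
  exact this (M.isVarT_qvar hT _ _)

theorem diff_var_other {n m : ℕ} (h : n ≠ m) :
    M.diff (M.qvar n ιₜ) (M.qvar m ιₜ) = M.qcon .zero := by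
  have h1 := M.tr_logic hT (.b4_6 n ιₜ m ιₜ (by simpa using h)) (by simp) M.env
  simp at h1
  have := M.tr_poly hT .diff_var_other (by simp)
    (M.up (M.up M.env xN εₜ (M.qvar n ιₜ)) yN εₜ (M.qvar m ιₜ))
  simp at this
  exact this (M.isVarT_qvar hT _ _) (M.isVarT_qvar hT _ _) h1

theorem diff_con (c : RealConst ιₜ) (n : ℕ) :
    M.diff (M.qcon c) (M.qvar n ιₜ) = M.qcon .zero := by
  have := M.tr_poly hT .diff_con (by simp)
    (M.up (M.up M.env xN εₜ (M.qcon c)) yN εₜ (M.qvar n ιₜ))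
  simp at this
  exact this (M.isConT_qcon hT _) (M.isVarT_qvar hT _ _)

theorem diff_neg {a : M.D εₜ} (ha : M.poly a) (n : ℕ) :
    M.diff (M.qneg a) (M.qvar n ιₜ) = M.qneg (M.diff a (M.qvar n ιₜ)) := by
  have := M.tr_poly hT .diff_minus (by simp)
    (M.up (M.up M.env xN εₜ a) yN εₜ (M.qvar n ιₜ))
  simp at this
  exact this ha (M.isVarT_qvar hT _ _)

theorem diff_add {a b : M.D εₜ} (ha : M.poly a) (hb : M.poly b) (n : ℕ) :
    M.diff (M.qadd a b) (M.qvar n ιₜ) =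
      M.qadd (M.diff a (M.qvar n ιₜ)) (M.diff b (M.qvar n ιₜ)) := by
  have := M.tr_poly hT .diff_plus (by simp)
    (M.up (M.up (M.up M.env xN εₜ a) yN εₜ b) zN εₜ (M.qvar n ιₜ))
  simp at this
  exact this ha hb (M.isVarT_qvar hT _ _)

theorem diff_mul {a b : M.D εₜ} (ha : M.poly a) (hb : M.poly b) (n : ℕ) :
    M.diff (M.qmul a b) (M.qvar n ιₜ) =
      M.qadd (M.qmul (M.diff a (M.qvar n ιₜ)) b) (M.qmul a (M.diff b (M.qvar n ιₜ))) := by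
  have := M.tr_poly hT .diff_times (by simp)
    (M.up (M.up (M.up M.env xN εₜ a) yN εₜ b) zN εₜ (M.qvar n ιₜ))
  simp at this
  exact this ha hb (M.isVarT_qvar hT _ _)

theorem poly_qneg {a : M.D εₜ} (ha : M.poly a) : M.poly (M.qneg a) :=
  (M.poly_iff hT _).mpr (Or.inr (Or.inr (Or.inr (Or.inr (Or.inl ⟨a, ha, rfl⟩)))))

theorem poly_qadd {a b : M.D εₜ} (ha : M.poly a) (hb : M.poly b) : M.poly (M.qadd a b) :=
  (M.poly_iff hT _).mpr (Or.inr (Or.inr (Or.inr (Or.inr (Or.inr (Or.inl ⟨a, b, ha, hb, rfl⟩))))))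

theorem poly_qmul {a b : M.D εₜ} (ha : M.poly a) (hb : M.poly b) : M.poly (M.qmul a b) :=
  (M.poly_iff hT _).mpr (Or.inr (Or.inr (Or.inr (Or.inr (Or.inr (Or.inr ⟨a, b, ha, hb, rfl⟩))))))

theorem poly_zero : M.poly (M.qcon .zero) := (M.poly_iff hT _).mpr (by simp)

theorem poly_one : M.poly (M.qcon .one) := (M.poly_iff hT _).mpr (by simp)

theorem poly_qvar {n : ℕ} (hn : n = xN ∨ n = yN) : M.poly (M.qvar n ιₜ) :=
  (M.poly_iff hT _).mpr (by rcases hn with rfl | rfl <;> simp)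

/-- The recursion clauses for evaluation are available on polynomials only, and they have to be
applied to symbolic derivatives too. -/
theorem poly_diff (n : ℕ) (c : M.D εₜ) (hc : M.poly c) :
    M.poly (M.diff c (M.qvar n ιₜ)) := by
  have h := M.poly_induction hT
    (φ := isPolyE (polyDiffE (uv εₜ) (Expr.quote (Expr.var n ιₜ)))) (by simp) M.env
  simp only [tr_isPolyE, den_polyDiffE, den_var, up_self, den_quote, quo_var] at h
  have hv : ∀ k, M.poly (M.diff (M.qvar k ιₜ) (M.qvar n ιₜ)) := fun k => by
    by_cases hk : k = n
    · rw [hk, M.diff_var_same hT]; exact M.poly_one hT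
    · rw [M.diff_var_other hT hk]; exact M.poly_zero hT
  refine h (hv _) (hv _) ?_ ?_ (fun v hv ih => ?_) (fun v w hv hw ih ih' => ?_)
    (fun v w hv hw ih ih' => ?_) c hc
  · rw [M.diff_con hT]; exact M.poly_zero hT
  · rw [M.diff_con hT]; exact M.poly_zero hT
  · rw [M.diff_neg hT hv]; exact M.poly_qneg hT ih
  · rw [M.diff_add hT hv hw]; exact M.poly_qadd hT ih ih'
  · rw [M.diff_mul hT hv hw]
    exact M.poly_qadd hT (M.poly_qmul hT ih hw) (M.poly_qmul hT hv ih')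

end Model
end CTTqe

namespace CTTqe
variable {κ : Ty → Type u} {T : Theory κ}

/-! ## Derivatives in models -/

namespace Model
variable (M : Model T) (hT : IsRealTheory T)

/-- The derivative condition in the field of individuals of a model. -/
def HasDeriv (f : M.D (ιₜ ⟶ₜ ιₜ)) (x d : M.D ιₜ) : Prop :=
  letI := M.field hT
  letI := M.linearOrder hT
  HasDerivLim (M.app f) x d

/-- The hypotheses `hF'`, `hX'`, `hD'` express semantically that the bound variables u, v, h do not
matter to the three terms. The reciprocal is taken only at h ≠ 0, where it is the inverse of the
field. -/
theorem tr_hasDerivE {F : Expr κ (ιₜ ⟶ₜ ιₜ)} {X D : Expr κ ιₜ} (hF : F.IsLaw) (hX : X.IsLaw)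
    (hD : D.IsLaw) (ρ : M.Env)
    (hF' : ∀ u v h, M.den (M.up (M.up (M.up ρ uN ιₜ u) vN ιₜ v) hN ιₜ h) F = M.den ρ F)
    (hX' : ∀ u v h, M.den (M.up (M.up (M.up ρ uN ιₜ u) vN ιₜ v) hN ιₜ h) X = M.den ρ X)
    (hD' : ∀ u v h, M.den (M.up (M.up (M.up ρ uN ιₜ u) vN ιₜ v) hN ιₜ h) D = M.den ρ D) :
    M.Tr (M.den ρ (hasDerivE F X D)) ↔ M.HasDeriv hT (M.den ρ F) (M.den ρ X) (M.den ρ D) := by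
  let _ := M.field hT
  let _ := M.linearOrder hT
  have hinv : ∀ h : M.D ιₜ, h ≠ 0 → M.recip h = h⁻¹ := fun h hh => (if_neg hh).symm
  have h1 : M.Tr (M.den ρ (hasDerivE F X D)) ↔ ∀ u : M.D ιₜ, 0 < u → ∃ v : M.D ιₜ, 0 < v ∧
      ∀ h : M.D ιₜ, h ≠ 0 ∧ -v < h ∧ h < v →
        -u < (M.app (M.den ρ F) (M.den ρ X + h) + -M.app (M.den ρ F) (M.den ρ X)) * M.recip h +
          -M.den ρ D ∧
        (M.app (M.den ρ F) (M.den ρ X + h) + -M.app (M.den ρ F) (M.den ρ X)) * M.recip h +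
          -M.den ρ D < u := by
    simp [hasDerivE, hF, hX, hD, hF', hX', hD']
    rfl
  rw [h1]
  unfold HasDeriv HasDerivLim
  refine forall_congr' fun u => imp_congr_right fun _ => exists_congr fun v =>
    and_congr_right fun _ => forall_congr' fun h => imp_congr_right fun hh => ?_
  rw [hinv h hh.1]

/-- The derivative of a function of a model. -/
def deriv (f : M.D (ιₜ ⟶ₜ ιₜ)) : M.D (ιₜ ⟶ₜ ιₜ) := M.app (M.rcon .derivative) f

def isDiff (f : M.D (ιₜ ⟶ₜ ιₜ)) : Prop := M.Tr (M.app (M.rcon .isDiff) f)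

section
variable (ρ : M.Env) {F : Expr κ (ιₜ ⟶ₜ ιₜ)}
@[simp] theorem den_derivE : M.den ρ (derivE F) = M.deriv (M.den ρ F) := by simp [derivE, deriv]
@[simp] theorem tr_isDiffE : M.Tr (M.den ρ (isDiffE F)) ↔ M.isDiff (M.den ρ F) := by
  simp [isDiffE, isDiff]
end

theorem isDiff_iff (f : M.D (ιₜ ⟶ₜ ιₜ)) : M.isDiff f ↔ ∀ x, ∃ d, M.HasDeriv hT f x d := by
  have h := M.tr_calculus hT .isDiff_def (by simp) (M.up M.env fN (ιₜ ⟶ₜ ιₜ) f)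
  rw [tr_eqE, den_eq_iff] at h
  simp only [tr_isDiffE, den_var, up_self] at h
  rw [h, tr_allE' _ _ (by simp) (by simp)]
  refine forall_congr' fun x => ?_
  rw [tr_exE _ _ (by simp) (by simp)]
  refine exists_congr fun d => ?_
  rw [M.tr_hasDerivE hT (by simp) (by simp) (by simp) _ (by simp) (by simp) (by simp)]
  simp

theorem hasDeriv_deriv {f : M.D (ιₜ ⟶ₜ ιₜ)} (hf : M.isDiff f) (x : M.D ιₜ) :
    M.HasDeriv hT f x (M.app (M.deriv f) x) := by
  have h := M.tr_calculus hT .deriv_spec (by simp) (M.up M.env fN (ιₜ ⟶ₜ ιₜ) f)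
  rw [tr_impE, tr_allE' _ _ (by simp) (by simp)] at h
  simp only [tr_isDiffE, den_var, up_self] at h
  have h1 := h hf x
  rw [M.tr_hasDerivE hT (by simp) (by simp) (by simp) _ (by simp) (by simp) (by simp)] at h1
  simpa using h1

/-- The derivative is determined by the limits of the difference quotients. -/
theorem deriv_eq {f g : M.D (ιₜ ⟶ₜ ιₜ)} (h : ∀ x, M.HasDeriv hT f x (M.app g x)) :
    M.deriv f = g := by
  refine M.ext fun x => ?_
  -- The values of `g` witness differentiability, so the specification of the derivative applies;
  -- the rest is uniqueness of limits.
  have h1 := M.hasDeriv_deriv hT ((M.isDiff_iff hT f).mpr fun x => ⟨_, h x⟩) x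
  let _ := M.field hT
  let _ := M.linearOrder hT
  let _ := M.isStrictOrderedRing hT
  exact HasDerivLim.unique h1 (h x)

end Model

/-! ## Correctness of symbolic differentiation for an interpretation of the constructions -/

section Interpretation
variable (n : ℕ) (E : Expr κ (εₜ ⟶ₜ ιₜ ⟶ₜ ιₜ))

/-- `E` interprets the quotation of the variable `k`. -/
def evalVarE (k : ℕ) : Expr κ oₜ :=
  allE n ιₜ (E ⬝ Expr.quote (Expr.var k ιₜ) ⬝ Expr.var n ιₜ =ₑ Expr.var k ιₜ)

/-- `E` interprets the quotation of the constant `c`. -/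
def evalConE (c : RealConst ιₜ) : Expr κ oₜ :=
  allE n ιₜ (E ⬝ Expr.quote (rc c) ⬝ Expr.var n ιₜ =ₑ rc c)

/-- `E` interprets quasiquotations of negations. -/
def evalNegE : Expr κ oₜ :=
  allE uN εₜ (allE n ιₜ (isPolyE (uv εₜ) ⊃ₑ
    E ⬝ qMinus (uv εₜ) ⬝ Expr.var n ιₜ =ₑ -ₑ (E ⬝ uv εₜ ⬝ Expr.var n ιₜ)))

/-- `E` interprets quasiquotations of applications of the binary operation `c`. -/
def evalBinE (c : RealConst (ιₜ ⟶ₜ ιₜ ⟶ₜ ιₜ)) : Expr κ oₜ :=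
  allE uN εₜ (allE wN εₜ (allE n ιₜ ((isPolyE (uv εₜ) ∧ₑ isPolyE (wv εₜ)) ⊃ₑ
    E ⬝ appE (appE (Expr.quote (rc c)) (uv εₜ)) (wv εₜ) ⬝ Expr.var n ιₜ =ₑ
      rc c ⬝ (E ⬝ uv εₜ ⬝ Expr.var n ιₜ) ⬝ (E ⬝ wv εₜ ⬝ Expr.var n ιₜ))))

/-- The meaning formula relative to `E`. -/
def evalMeaningE : Expr κ oₜ :=
  isPolyE (uv εₜ) ⊃ₑ
    derivE (Expr.lam n ιₜ (E ⬝ uv εₜ ⬝ Expr.var n ιₜ)) =ₑ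
      Expr.lam n ιₜ (E ⬝ polyDiffE (uv εₜ) (Expr.quote (Expr.var n ιₜ)) ⬝ Expr.var n ιₜ)

/-- Interpretations of the constructions satisfy the meaning formula. -/
def evalLawE (m : ℕ) : Expr κ oₜ :=
  evalVarE n E n ⊃ₑ evalVarE n E m ⊃ₑ evalConE n E .zero ⊃ₑ evalConE n E .one ⊃ₑ
    evalNegE n E ⊃ₑ evalBinE n E .plus ⊃ₑ evalBinE n E .times ⊃ₑ evalMeaningE n E

end Interpretation

theorem isLaw_evalLawE {n m : ℕ} (hn : n < paramN) (hm : m < paramN)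
    {E : Expr κ (εₜ ⟶ₜ ιₜ ⟶ₜ ιₜ)} (hE : E.IsLaw) : (evalLawE n E m).IsLaw := by
  simp [evalLawE, evalVarE, evalConE, evalNegE, evalBinE, evalMeaningE, hn, hm, hE]

/-- The premises say that e c x := f c x follows the recursion of polynomial evaluation, with `n` as
the argument and `m` as a constant. By induction over polynomials, e (d c ⌜n⌝) is the derivative of
e c. -/
theorem Model.tr_evalLawE (M : Model T) (hT : IsRealTheory T) {n m : ℕ}
    (h : n = xN ∧ m = yN ∨ n = yN ∧ m = xN) (ρ : M.Env) :
    M.Tr (M.den ρ (evalLawE n (fv (εₜ ⟶ₜ ιₜ ⟶ₜ ιₜ)) m)) := by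
  have hn : n < paramN := by rcases h with ⟨rfl, -⟩ | ⟨rfl, -⟩ <;> simp
  have hnm : n ≠ m := by rcases h with ⟨rfl, rfl⟩ | ⟨rfl, rfl⟩ <;> decide
  have hu : n ≠ uN := by rcases h with ⟨rfl, -⟩ | ⟨rfl, -⟩ <;> decide
  have hv : n ≠ vN := by rcases h with ⟨rfl, -⟩ | ⟨rfl, -⟩ <;> decide
  have hh : n ≠ hN := by rcases h with ⟨rfl, -⟩ | ⟨rfl, -⟩ <;> decide
  have hm : m < paramN := by rcases h with ⟨-, rfl⟩ | ⟨-, rfl⟩ <;> simp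
  simp only [evalLawE, tr_impE]
  intro e1 e2 e3 e4 e5 e6 e7
  set e : M.D εₜ → M.D ιₜ → M.D ιₜ :=
    fun c x => M.app (M.app (ρ (fN, εₜ ⟶ₜ ιₜ ⟶ₜ ιₜ)) c) x with he
  let _ := M.field hT
  let _ := M.linearOrder hT
  let _ := M.isStrictOrderedRing hT
  have s1 : ∀ x, e (M.qvar n ιₜ) x = x := by
    simpa [evalVarE, hn] using e1
  have s2 : ∀ x, e (M.qvar m ιₜ) x = ρ (m, ιₜ) := by
    simpa [evalVarE, hn, hm, hnm.symm] using e2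
  have s3 : ∀ x, e (M.qcon .zero) x = M.rcon .zero := by
    simpa [evalConE, hn] using e3
  have s4 : ∀ x, e (M.qcon .one) x = M.rcon .one := by
    simpa [evalConE, hn] using e4
  have s5 : ∀ c x, M.poly c → e (M.qneg c) x = - e c x := by
    simp [evalNegE, hn] at e5
    exact e5
  have s6 : ∀ c d x, M.poly c → M.poly d → e (M.qadd c d) x = e c x + e d x := by
    simp [evalBinE, hn] at e6
    exact e6
  have s7 : ∀ c d x, M.poly c → M.poly d → e (M.qmul c d) x = e c x * e d x := by
    simp [evalBinE, hn] at e7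
    exact e7
  have key : ∀ c, M.poly c → ∀ x, HasDerivLim (e c) x (e (M.diff c (M.qvar n ιₜ)) x) := by
    -- Induction needs a formula, so the derivative condition is expressed within the language. Its
    -- bound variables have type ι and do not interfere with u of type ε.
    have ind := M.poly_induction hT (φ := allE n ιₜ (hasDerivE (fv (εₜ ⟶ₜ ιₜ ⟶ₜ ιₜ) ⬝ uv εₜ)
      (Expr.var n ιₜ) (fv (εₜ ⟶ₜ ιₜ ⟶ₜ ιₜ) ⬝ polyDiffE (uv εₜ) (Expr.quote (Expr.var n ιₜ)) ⬝
        Expr.var n ιₜ))) (by simp [hn]) ρ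
    have hφ : ∀ c : M.D εₜ, M.Tr (M.den (M.up ρ uN εₜ c) (allE n ιₜ
        (hasDerivE (fv (εₜ ⟶ₜ ιₜ ⟶ₜ ιₜ) ⬝ uv εₜ) (Expr.var n ιₜ) (fv (εₜ ⟶ₜ ιₜ ⟶ₜ ιₜ) ⬝
          polyDiffE (uv εₜ) (Expr.quote (Expr.var n ιₜ)) ⬝ Expr.var n ιₜ)))) ↔
        ∀ x, HasDerivLim (e c) x (e (M.diff c (M.qvar n ιₜ)) x) := fun c => by
      rw [tr_allE' _ _ hn (by simp [hn])]
      refine forall_congr' fun x => ?_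
      rw [M.tr_hasDerivE hT (by simp) (by simp [hn]) (by simp [hn]) _ (by simp)
        (by simp [hu, hv, hh]) (by simp [hu, hv, hh])]
      simp [HasDeriv, he]
    simp only [hφ] at ind
    have hvar : ∀ k, k = n ∨ k = m →
        ∀ x, HasDerivLim (e (M.qvar k ιₜ)) x (e (M.diff (M.qvar k ιₜ) (M.qvar n ιₜ)) x) := by
      rintro k (rfl | rfl) x
      · rw [M.diff_var_same hT, s4, funext s1]
        exact HasDerivLim.id x
      · rw [M.diff_var_other hT hnm.symm, s3, funext s2]
        exact HasDerivLim.const _ x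
    refine ind (hvar _ ?_) (hvar _ ?_) (fun x => ?_) (fun x => ?_) (fun c hc ih x => ?_)
      (fun c d hc hd ihc ihd x => ?_) (fun c d hc hd ihc ihd x => ?_)
    · rcases h with ⟨rfl, rfl⟩ | ⟨rfl, rfl⟩ <;> simp
    · rcases h with ⟨rfl, rfl⟩ | ⟨rfl, rfl⟩ <;> simp
    · rw [M.diff_con hT, s3, funext s3]
      exact HasDerivLim.const _ x
    · rw [M.diff_con hT, s3, funext s4]
      exact HasDerivLim.const _ x
    · rw [M.diff_neg hT hc, s5 _ _ (M.poly_diff hT n c hc), funext fun x => s5 c x hc]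
      exact (ih x).neg
    · rw [M.diff_add hT hc hd, s6 _ _ _ (M.poly_diff hT n c hc) (M.poly_diff hT n d hd),
        funext fun x => s6 c d x hc hd]
      exact (ihc x).add (ihd x)
    · have hc' := M.poly_diff hT n c hc
      have hd' := M.poly_diff hT n d hd
      rw [M.diff_mul hT hc hd, s6 _ _ _ (M.poly_qmul hT hc' hd) (M.poly_qmul hT hc hd'),
        s7 _ _ _ hc' hd, s7 _ _ _ hc hd', funext fun x => s7 c d x hc hd]
      exact (ihc x).mul (ihd x)
  simp only [evalMeaningE, tr_impE, tr_isPolyE, den_var, tr_eqE, den_derivE]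
  intro hc
  refine M.deriv_eq hT fun x => ?_
  have hF : M.app (M.den ρ (Expr.lam n ιₜ (fv (εₜ ⟶ₜ ιₜ ⟶ₜ ιₜ) ⬝ uv εₜ ⬝ Expr.var n ιₜ))) =
      e (ρ (uN, εₜ)) := funext fun y => by simp [hn, he]
  have hG : M.app (M.den ρ (Expr.lam n ιₜ (fv (εₜ ⟶ₜ ιₜ ⟶ₜ ιₜ) ⬝
      polyDiffE (uv εₜ) (Expr.quote (Expr.var n ιₜ)) ⬝ Expr.var n ιₜ))) x =
      e (M.diff (ρ (uN, εₜ)) (M.qvar n ιₜ)) x := by simp [hn, he]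
  change HasDerivLim _ _ _
  rw [hF, hG]
  exact key _ hc x

end CTTqe

namespace CTTqe
variable {κ : Ty → Type u} {T : Theory κ}

/-! ## Simultaneous substitution of irregular functions -/

/-- The substitution `σ` fixes all small variables, and the binders of `B` are small, so entering a
binder does not change `σ`. -/
theorem sub_sub {α : Ty} (B : Expr κ α) (hB : EvalFree B) (hs : B.Small) {σ : Subst κ}
    (hσ : ∀ p : ℕ × Ty, p.1 < paramN → σ p = Expr.var p.1 p.2) (τ : Subst κ) :
    sub σ (sub τ B) = sub (fun p => sub σ (τ p)) B := by
  induction B generalizing τ with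
  | var n α => rfl
  | const c => rfl
  | app F A ihF ihA => simp only [sub, ihF hB.1 hs.1, ihA hB.2 hs.2]
  | lam n α B ih =>
    have hn : σ (n, α) = Expr.var n α := hσ (n, α) hs.1
    simp only [sub]
    rw [Subst.up_eq_self σ hn, ih hB hs.2]
    congr 2
    funext p
    by_cases hp : p = (n, α)
    · subst hp; simp only [Subst.up_self, sub, hn]
    · rw [Subst.up_ne _ _ hp, Subst.up_ne _ _ hp]
  | quote A => rfl
  | eval β A => exact hB.elim

theorem binds_sub {Q : ℕ → Ty → Prop} {k : ℕ} {α β : Ty} (B : Expr κ β) (hB : EvalFree B)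
    {σ : Subst κ} (h : ∀ p, Binds Q k α (σ p))
    (h' : ∀ p : ℕ × Ty, FreeIn k α (σ p) → Binds Q p.1 p.2 B) : Binds Q k α (sub σ B) := by
  induction B generalizing σ with
  | var n β => exact h (n, β)
  | const c => trivial
  | app F A ihF ihA =>
    exact ⟨ihF hB.1 h fun p hp => (h' p hp).1, ihA hB.2 h fun p hp => (h' p hp).2⟩
  | lam m β B ih =>
    intro hne hf
    have hup : ∀ p, FreeIn k α (σ.up m β (Expr.var m β) p) → p ≠ (m, β) ∧ FreeIn k α (σ p) := by
      intro p hp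
      by_cases hpm : p = (m, β)
      · subst hpm
        rw [Subst.up_self] at hp
        exact absurd (Prod.ext hp.1 hp.2) hne
      · rw [Subst.up_ne _ _ hpm] at hp; exact ⟨hpm, hp⟩
    constructor
    · by_contra hQ
      refine not_freeIn_sub B hB _ (fun p hp hp' => ?_) hf
      have h1 := hup p hp'
      exact hQ (h' p h1.2 (fun e => h1.1 e.symm) hp).1
    · refine ih hB (fun p => ?_) fun p hp => ?_
      · by_cases hpm : p = (m, β)
        · subst hpm; rw [Subst.up_self]; trivial
        · rw [Subst.up_ne _ _ hpm]; exact h p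
      · have h1 := hup p hp
        by_cases hpB : FreeIn p.1 p.2 B
        · exact (h' p h1.2 (fun e => h1.1 e.symm) hpB).2
        · exact Theory.binds_of_not_free B hpB
  | quote A => trivial
  | eval β A => exact hB.elim

namespace Theory

theorem sub_eq {α : Ty} (B : Expr κ α) (hB : EvalFree B) (hL : T.Lang B) {σ τ : Subst κ}
    (h : ∀ p : ℕ × Ty, FreeIn p.1 p.2 B → T ⊢ₚ σ p =ₑ τ p) : T ⊢ₚ sub σ B =ₑ sub τ B := by
  induction B generalizing σ τ with
  | var n α => exact h (n, α) ⟨rfl, rfl⟩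
  | const c => exact refl hL
  | app F A ihF ihA =>
    exact (ihF hB.1 hL.1 fun p hp => h p (Or.inl hp)).app (ihA hB.2 hL.2 fun p hp => h p (Or.inr hp))
  | lam n α B ih =>
    refine (ih hB hL fun p hpB => ?_).lam n α
    by_cases hp : p = (n, α)
    · subst hp; simp only [Subst.up_self]; exact refl trivial
    · rw [Subst.up_ne _ _ hp, Subst.up_ne _ _ hp]; exact h p ⟨fun e => hp e.symm, hpB⟩
  | quote A => exact refl hL
  | eval β A => exact hB.elim

/-- Extension of an eval-free substitution by one variable. -/
theorem inst_up {k : ℕ} {α : Ty} {A : Expr κ α} (hA : T.Lang A) {B : Expr κ oₜ} (hB : EvalFree B)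
    (hL : T.Lang B) {σ : Subst κ} (h : T ⊢ₚ sub σ B) (hσ : T.LangS σ)
    (hk : σ (k, α) = Expr.var k α)
    (hin : ∀ p : ℕ × Ty, p ≠ (k, α) → EvalFree (σ p) ∧ ¬ FreeIn k α (σ p))
    (hp : Binds (fun m γ => T.Pass m γ A) k α B) : T ⊢ₚ sub (σ.up k α A) B :=
  ((T.inertClass_evalFree k α).beta hA B hB hL σ hσ hk
    (fun p hpk _ => ⟨(hin p hpk).1, (hin p hpk).2, hσ p⟩) hp).mp (lam_app h k hA)

end Theory

/-- Polynomials that are indicator functions on the three indices. -/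
def indicatorE : Fin 3 → Expr κ ιₜ
  -- The Lagrange basis for the nodes 0, 1, −1.
  | 0 => oneE +ₑ -ₑ (xv ιₜ *ₑ xv ιₜ)
  | 1 => (xv ιₜ *ₑ (xv ιₜ +ₑ oneE)) *ₑ recipE (oneE +ₑ oneE)
  | 2 => (xv ιₜ *ₑ (xv ιₜ +ₑ -ₑ oneE)) *ₑ recipE (oneE +ₑ oneE)

/-- Three different individuals used as indices. -/
def indexE : Fin 3 → Expr κ ιₜ
  | 0 => zeroE
  | 1 => oneE
  | 2 => -ₑ oneE

/-- The multiplication of functions by an indicator. -/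
def selectE (i : Fin 3) : Expr κ (ιₜ ⟶ₜ (ιₜ ⟶ₜ ιₜ) ⟶ₜ (ιₜ ⟶ₜ ιₜ)) :=
  Expr.lam xN ιₜ (Expr.lam fN (ιₜ ⟶ₜ ιₜ) (Expr.lam yN ιₜ
    (indicatorE i *ₑ fv (ιₜ ⟶ₜ ιₜ) ⬝ yv ιₜ)))

/-- The function that is constantly zero. -/
def zeroF : Expr κ (ιₜ ⟶ₜ ιₜ) := Expr.lam yN ιₜ zeroE

/-- A function of two arguments with three given values at the indices. -/
def familyE (k : ℕ) (F : Fin 3 → Expr κ (ιₜ ⟶ₜ ιₜ)) : Expr κ (ιₜ ⟶ₜ ιₜ ⟶ₜ ιₜ) :=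
  -- Each `F i` is an argument of a closed function and stands under no binder but that of `k`.
  -- Hence `k` is the only variable whose noneffectiveness in the `F i` is required.
  Expr.lam k ιₜ (rc .fplus ⬝ (rc .fplus ⬝ (selectE 0 ⬝ Expr.var k ιₜ ⬝ F 0) ⬝
    (selectE 1 ⬝ Expr.var k ιₜ ⬝ F 1)) ⬝ (selectE 2 ⬝ Expr.var k ιₜ ⬝ F 2))

@[simp] theorem isLaw_indicatorE (i : Fin 3) : (indicatorE i : Expr κ ιₜ).IsLaw := by
  fin_cases i <;> simp [indicatorE]
@[simp] theorem isLaw_indexE (i : Fin 3) : (indexE i : Expr κ ιₜ).IsLaw := by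
  fin_cases i <;> simp [indexE]
@[simp] theorem isLaw_selectE (i : Fin 3) : (selectE i : Expr κ _).IsLaw := by
  simp [selectE]
@[simp] theorem isLaw_zeroF : (zeroF : Expr κ _).IsLaw := by simp [zeroF]

theorem closed_indexE (i : Fin 3) (n : ℕ) (α : Ty) : ¬ FreeIn n α (indexE i : Expr κ ιₜ) := by
  fin_cases i <;> simp [indexE, FreeIn, zeroE, oneE, minusE]

theorem closed_selectE (i : Fin 3) (n : ℕ) (α : Ty) : ¬ FreeIn n α (selectE i : Expr κ _) := by
  fin_cases i <;>
    simp [selectE, indicatorE, FreeIn, oneE, minusE, plusE, timesE, recipE] <;> tauto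

/-- The substitution of three functions for the variables `f`, `g`, `h`. -/
noncomputable def functionsS (F : Fin 3 → Expr κ (ιₜ ⟶ₜ ιₜ)) : Subst κ :=
  ((idS.up fN _ (F 0)).up gN _ (F 1)).up hN _ (F 2)

theorem functionsS_cases {P : (p : ℕ × Ty) → Expr κ p.2 → Expr κ p.2 → Prop}
    (F G : Fin 3 → Expr κ (ιₜ ⟶ₜ ιₜ))
    (h : ∀ a, a = fN ∨ a = gN ∨ a = hN → ∀ i, P (a, ιₜ ⟶ₜ ιₜ) (F i) (G i))
    (h' : ∀ p, P p (Expr.var p.1 p.2) (Expr.var p.1 p.2)) (p : ℕ × Ty) :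
    P p (functionsS F p) (functionsS G p) := by
  unfold functionsS
  by_cases h2 : p = (hN, ιₜ ⟶ₜ ιₜ)
  · subst h2; simp only [Subst.up_self]; exact h _ (by simp) 2
  rw [Subst.up_ne _ _ h2, Subst.up_ne _ _ h2]
  by_cases h1 : p = (gN, ιₜ ⟶ₜ ιₜ)
  · subst h1; simp only [Subst.up_self]; exact h _ (by simp) 1
  rw [Subst.up_ne _ _ h1, Subst.up_ne _ _ h1]
  by_cases h0 : p = (fN, ιₜ ⟶ₜ ιₜ)
  · subst h0; simp only [Subst.up_self]; exact h _ (by simp) 0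
  rw [Subst.up_ne _ _ h0, Subst.up_ne _ _ h0]
  exact h' p

namespace Theory
variable (hT : IsRealTheory T)
include hT

/-- The equation is eval-free, so by completeness it reduces to a computation in an ordered field,
where 1 + 1 is invertible. -/
theorem select_index (i j : Fin 3) : T ⊢ₚ selectE i ⬝ indexE j ⬝ fv (ιₜ ⟶ₜ ιₜ) =ₑ
    if i = j then fv (ιₜ ⟶ₜ ιₜ) else zeroF := by
  refine completeness hT (by split_ifs <;> simp) fun M ρ => ?_
  let _ := M.field hT
  let _ := M.linearOrder hT
  let _ := M.isStrictOrderedRing hT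
  have hadd : ∀ a b, M.add a b = a + b := fun _ _ => rfl
  have hmul : ∀ a b, M.mul a b = a * b := fun _ _ => rfl
  have hneg : ∀ a, M.neg a = -a := fun _ => rfl
  have h0 : M.rcon .zero = 0 := rfl
  have h1 : M.rcon .one = 1 := rfl
  have h2 : M.recip (1 + 1) = (1 + 1 : M.D ιₜ)⁻¹ :=
    (if_neg (by change (1 + 1 : M.D ιₜ) ≠ 0; norm_num)).symm
  have key : ∀ ρ : M.Env, ρ (xN, ιₜ) = M.den ρ (indexE j) →
      M.den ρ (indicatorE i) = if i = j then 1 else 0 := fun ρ h => by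
    fin_cases i <;> fin_cases j <;>
      simp [indicatorE, indexE, h0, h1, hadd, hmul, hneg, h2] at h ⊢ <;> simp [h]
  have hI : ∀ ρ' : M.Env, M.den ρ' (indexE j) = M.den ρ (indexE j) := fun ρ' => by
    fin_cases j <;> simp [indexE]
  rw [Model.tr_eqE]
  refine M.ext fun y => ?_
  simp only [selectE, Model.den_app]
  rw [M.app_lam _ (by simp) (by simp), M.app_lam _ (by simp) (by simp),
    M.app_lam _ (by simp) (by simp), Model.den_timesE, key _ (by simp [hI])]
  split_ifs
  · simp [hmul]
  · simp [hmul, zeroF, h0]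

theorem fplus_zero_right : T ⊢ₚ rc .fplus ⬝ fv (ιₜ ⟶ₜ ιₜ) ⬝ zeroF =ₑ fv (ιₜ ⟶ₜ ιₜ) := by
  refine completeness hT (by simp) fun M ρ => ?_
  let _ := M.field hT
  have h := M.den_eq_of_provable ρ (Provable.hyp (hT.calculus_mem _ .fplus_def))
    (by simp) (by simp)
  rw [Model.tr_eqE, Model.den_app, Model.den_app, h]
  refine M.ext fun y => ?_
  rw [M.app_lam _ (by simp) (by simp), M.app_lam _ (by simp) (by simp),
    M.app_lam _ (by simp) (by simp)]
  simp [zeroF]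
  exact add_zero (M.app (ρ (fN, ιₜ ⟶ₜ ιₜ)) y : M.D ιₜ)

theorem fplus_zero_left : T ⊢ₚ rc .fplus ⬝ zeroF ⬝ fv (ιₜ ⟶ₜ ιₜ) =ₑ fv (ιₜ ⟶ₜ ιₜ) := by
  refine completeness hT (by simp) fun M ρ => ?_
  let _ := M.field hT
  have h := M.den_eq_of_provable ρ (Provable.hyp (hT.calculus_mem _ .fplus_def))
    (by simp) (by simp)
  rw [Model.tr_eqE, Model.den_app, Model.den_app, h]
  refine M.ext fun y => ?_
  rw [M.app_lam _ (by simp) (by simp), M.app_lam _ (by simp) (by simp),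
    M.app_lam _ (by simp) (by simp)]
  simp [zeroF]
  exact zero_add (M.app (ρ (fN, ιₜ ⟶ₜ ιₜ)) y : M.D ιₜ)

/-- As `k` is noneffective in each `F i`, reduction at the index affects only the indicators. They
leave one summand; the other two become the zero function. -/
theorem family_index {k : ℕ} {F : Fin 3 → Expr κ (ιₜ ⟶ₜ ιₜ)} (hF : ∀ i, T.Rigid k ιₜ (F i))
    (hL : ∀ i, T.Lang (F i)) (j : Fin 3) : T ⊢ₚ familyE k F ⬝ indexE j =ₑ F j := by
  have hS : ∀ i, T.Lang (selectE i) := fun i => (isLaw_selectE i).1.lang hT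
  have hI : T.Lang (indexE j) := (isLaw_indexE j).1.lang hT
  have hp : T.Lang (rc .fplus) := (pure_rc _).lang hT
  have hpR : T.Rigid k ιₜ (rc .fplus) := rigid_of_evalFree trivial (by simp [FreeIn]) hp
  have hSR : ∀ i, T.Rigid k ιₜ (selectE i) := fun i =>
    rigid_of_evalFree (isLaw_selectE i).1.evalFree (closed_selectE i _ _) (hS i)
  have hsel : ∀ i, T ⊢ₚ selectE i ⬝ indexE j ⬝ F i =ₑ if i = j then F i else zeroF := fun i => by
    have h := inst_unbound (k := fN) (hL i) (select_index hT i j)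
      (by split_ifs <;> simp [(isLaw_selectE i).1.evalFree, (isLaw_indexE j).1.evalFree,
        isLaw_zeroF.1.evalFree, EvalFree])
      (by simp only [eqE, Binds, binds_of_not_free _ (closed_selectE i _ _),
        binds_of_not_free _ (closed_indexE j _ _)]
          split_ifs <;> simp [Binds, zeroF, FreeIn, zeroE])
    simp [sub, sub_closed _ (isLaw_selectE i).1.evalFree _ (closed_selectE i),
      sub_closed _ (isLaw_indexE j).1.evalFree _ (closed_indexE j)] at h
    split_ifs at h ⊢
    · simpa [sub] using h
    · simpa [sub, zeroF, zeroE] using h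
  have hsum : ∀ (i : Fin 3), T ⊢ₚ (Expr.lam k ιₜ (selectE i ⬝ Expr.var k ιₜ ⬝ F i)) ⬝ indexE j =ₑ
      if i = j then F i else zeroF := fun i =>
    (beta_app (beta_app (hSR i _ hI) (beta_self hI)) (hF i _ hI)).trans (hsel i)
  have hr : ∀ i, T ⊢ₚ rc .fplus ⬝ F i ⬝ zeroF =ₑ F i := fun i => by
    have h := inst_unbound (k := fN) (hL i) (fplus_zero_right hT)
      (by simp [EvalFree, zeroF, zeroE]) (by simp [Binds, eqE, zeroF, FreeIn, zeroE])
    simpa [sub, zeroF, zeroE] using h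
  have hl : ∀ i, T ⊢ₚ rc .fplus ⬝ zeroF ⬝ F i =ₑ F i := fun i => by
    have h := inst_unbound (k := fN) (hL i) (fplus_zero_left hT)
      (by simp [EvalFree, zeroF, zeroE]) (by simp [Binds, eqE, zeroF, FreeIn, zeroE])
    simpa [sub, zeroF, zeroE] using h
  have hz : T.Lang zeroF := isLaw_zeroF.1.lang hT
  have hplus : ∀ {A B A' B' : Expr κ (ιₜ ⟶ₜ ιₜ)}, T ⊢ₚ A =ₑ A' → T ⊢ₚ B =ₑ B' →
      T ⊢ₚ rc .fplus ⬝ A ⬝ B =ₑ rc .fplus ⬝ A' ⬝ B' := fun h h' => ((refl hp).app h).app h'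
  have hz0 : T ⊢ₚ rc .fplus ⬝ zeroF ⬝ zeroF =ₑ zeroF := by
    have h := inst_unbound (k := fN) hz (fplus_zero_left hT)
      (by simp [EvalFree, zeroF, zeroE]) (by simp [Binds, eqE, zeroF, FreeIn, zeroE])
    simpa [sub, zeroF, zeroE] using h
  refine (beta_app (beta_app (hpR _ hI) (beta_app (beta_app (hpR _ hI) (hsum 0)) (hsum 1)))
    (hsum 2)).trans ?_
  fin_cases j
  · exact (hplus (hr 0) (refl hz)).trans (hr 0)
  · exact (hplus (hl 1) (refl hz)).trans (hr 1)
  · exact (hplus hz0 (refl (hL 2))).trans (hl 2)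

/-- Simultaneous substitution of three functions in which the variable `k` is noneffective. -/
theorem inst_functions {k : ℕ} {F : Fin 3 → Expr κ (ιₜ ⟶ₜ ιₜ)} (hF : ∀ i, T.Rigid k ιₜ (F i))
    (hL : ∀ i, T.Lang (F i)) {B : Expr κ oₜ} (h : T ⊢ₚ B) (hB : B.IsLaw)
    (hbind : ∀ a, a = fN ∨ a = gN ∨ a = hN →
      Binds (fun m γ => m = k ∧ γ = ιₜ) a (ιₜ ⟶ₜ ιₜ) B) :
    T ⊢ₚ sub (functionsS F) B := by
  have hE := hB.1.evalFree
  have hI : ∀ i, T.Lang (Expr.var paramN (ιₜ ⟶ₜ ιₜ ⟶ₜ ιₜ) ⬝ indexE i) := fun i =>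
    ⟨trivial, (isLaw_indexE i).1.lang hT⟩
  have hIE : ∀ i, EvalFree (Expr.var paramN (ιₜ ⟶ₜ ιₜ ⟶ₜ ιₜ) ⬝ indexE i : Expr κ _) := fun i =>
    ⟨trivial, (isLaw_indexE i).1.evalFree⟩
  have hIF : ∀ i m γ, FreeIn m γ (Expr.var paramN (ιₜ ⟶ₜ ιₜ ⟶ₜ ιₜ) ⬝ indexE i : Expr κ _) →
      m = paramN ∧ γ = (ιₜ ⟶ₜ ιₜ ⟶ₜ ιₜ) := fun i m γ hf => by
    rcases hf with hf | hf
    · exact ⟨hf.1.symm, hf.2.symm⟩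
    · exact (closed_indexE i _ _ hf).elim
  have hpass : ∀ i a, a = fN ∨ a = gN ∨ a = hN → Binds (fun m γ => T.Pass m γ
      (Expr.var paramN (ιₜ ⟶ₜ ιₜ ⟶ₜ ιₜ) ⬝ indexE i)) a (ιₜ ⟶ₜ ιₜ) B := fun i a ha =>
    (hbind a ha).mono fun m γ hm => pass_of_evalFree (hIE i) fun hf => by
      have := (hIF i _ _ hf).2
      rw [hm.2] at this
      cases this
  -- The values P 0, P 1, P (−1) of a parameter P are substituted for f, g, h first. They are
  -- eval-free, so this can be done successively. The type of P differs from that of the admitted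
  -- binder.
  have h0 : T ⊢ₚ sub idS B := by rwa [sub_idS]
  have h1 := inst_up (k := fN) (hI 0) hE h.lang h0 langS_idS rfl
    (fun p hp => ⟨trivial, fun e => hp (Prod.ext e.1 e.2)⟩) (hpass 0 fN (by simp))
  have h2 := inst_up (k := gN) (hI 1) hE h.lang h1 (langS_idS.up (hI 0))
    (by rw [Subst.up_ne _ _ (by simp)]; rfl)
    (fun p hp => by
      by_cases e : p = (fN, ιₜ ⟶ₜ ιₜ)
      · subst e; rw [Subst.up_self]; exact ⟨hIE 0, fun hf => by cases (hIF _ _ _ hf).1⟩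
      · rw [Subst.up_ne _ _ e]; exact ⟨trivial, fun e => hp (Prod.ext e.1 e.2)⟩)
    (hpass 1 gN (by simp))
  have h3 := inst_up (k := hN) (hI 2) hE h.lang h2 ((langS_idS.up (hI 0)).up (hI 1))
    (by rw [Subst.up_ne _ _ (by simp), Subst.up_ne _ _ (by simp)]; rfl)
    (fun p hp => by
      by_cases e' : p = (gN, ιₜ ⟶ₜ ιₜ)
      · subst e'; rw [Subst.up_self]; exact ⟨hIE 1, fun hf => by cases (hIF _ _ _ hf).1⟩
      rw [Subst.up_ne _ _ e']
      by_cases e : p = (fN, ιₜ ⟶ₜ ιₜ)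
      · subst e; rw [Subst.up_self]; exact ⟨hIE 0, fun hf => by cases (hIF _ _ _ hf).1⟩
      · rw [Subst.up_ne _ _ e]; exact ⟨trivial, fun e => hp (Prod.ext e.1 e.2)⟩)
    (hpass 2 hN (by simp))
  set G : Fin 3 → Expr κ (ιₜ ⟶ₜ ιₜ) :=
    fun i => Expr.var paramN (ιₜ ⟶ₜ ιₜ ⟶ₜ ιₜ) ⬝ indexE i with hG
  have h4 : T ⊢ₚ sub (functionsS G) B := h3
  have hH : T.Rigid k ιₜ (familyE k F) := rigid_lam_self (by
    have hS : ∀ i, T.Lang (selectE i) := fun i => (isLaw_selectE i).1.lang hT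
    have hp : T.Lang (rc .fplus) := (pure_rc _).lang hT
    exact ⟨⟨hp, ⟨hp, ⟨hS 0, trivial⟩, hL 0⟩, ⟨hS 1, trivial⟩, hL 1⟩, ⟨hS 2, trivial⟩, hL 2⟩)
  have hHL : T.Lang (familyE k F) := (hH (Expr.var k ιₜ) trivial).right
  -- This is the only irregular substitution: P becomes the family, which passes the binders of `k`
  -- because `k` is bound in it.
  have h5 := inst (k := paramN) hHL h4
    (evalFree_sub B hE _ fun p _ => functionsS_cases (P := fun _ a _ => EvalFree a) G G
      (fun _ _ i => hIE i) (fun _ => trivial) p)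
    ((binds_sub (Q := fun m γ => m = k ∧ γ = ιₜ) B hE
      (fun p => functionsS_cases (P := fun _ a _ => Binds _ _ _ a) G G
        (fun a _ i => ⟨trivial, binds_of_not_free _ (closed_indexE i _ _)⟩) (fun _ => trivial) p)
      (fun p => functionsS_cases
        (P := fun p a _ => FreeIn paramN (ιₜ ⟶ₜ ιₜ ⟶ₜ ιₜ) a →
          Binds (fun m γ => m = k ∧ γ = ιₜ) p.1 p.2 B) G G (fun a ha i _ => hbind a ha)
        (fun p hp => binds_of_not_free _ fun hf => absurd (hB.2.freeIn_lt hf) (by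
          rw [hp.1]; exact lt_irrefl _)) p)).mono fun m γ hm => by
            rw [hm.1, hm.2]; exact hH.pass)
  rw [sub_sub B hE hB.2 fun p hp => Subst.up_ne _ _ fun e => by
    rw [e] at hp; exact lt_irrefl _ hp] at h5
  refine (sub_eq B hE h.lang fun p hp => ?_).mp h5
  refine functionsS_cases (P := fun p a b => p.1 < paramN →
    T ⊢ₚ sub (idS.up paramN _ (familyE k F)) a =ₑ b) G F (fun a _ i _ => ?_) (fun p hp => ?_) p
    (hB.2.freeIn_lt hp)
  · simp only [hG, sub, Subst.up_self, sub_closed _ (isLaw_indexE i).1.evalFree _ (closed_indexE i)]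
    exact family_index hT hF hL i
  · rw [sub, Subst.up_ne _ _ fun e => by rw [Prod.ext_iff] at e; exact absurd e.1 hp.ne]
    exact refl trivial

end Theory
end CTTqe

namespace CTTqe
variable {κ : Ty → Type u} {T : Theory κ}

/-! ## Conditional equations between irregular expressions -/

/-- Eval-free formulas about constructions. -/
structure Expr.IsPremise (Q : Expr κ oₜ) : Prop where
  isLaw : Q.IsLaw
  free : ∀ n α, FreeIn n α Q → α = εₜ

theorem functionsS_up (F : Fin 3 → Expr κ (ιₜ ⟶ₜ ιₜ)) (n : ℕ) :
    (functionsS F).up n ιₜ (Expr.var n ιₜ) = functionsS F :=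
  Subst.up_eq_self _ (by simp [functionsS])

theorem Expr.IsPremise.sub_functionsS {Q : Expr κ oₜ} (hQ : Q.IsPremise)
    (F : Fin 3 → Expr κ (ιₜ ⟶ₜ ιₜ)) : CTTqe.sub (functionsS F) Q = Q := by
  conv_rhs => rw [← sub_idS Q]
  refine sub_congr Q hQ.isLaw.1.evalFree _ _ fun p hp => ?_
  refine functionsS_cases (P := fun p a _ => FreeIn p.1 p.2 Q → a = idS p) F F
    (fun a _ i hf => ?_) (fun _ _ => rfl) p hp
  cases hQ.free _ _ hf

theorem sub_zeroE (σ : Subst κ) : CTTqe.sub σ zeroE = (zeroE : Expr κ ιₜ) := rfl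

theorem Expr.IsPremise.binds {Q : Expr κ oₜ} (hQ : Q.IsPremise) {R : ℕ → Ty → Prop} (k : ℕ) {α : Ty}
    (hα : α ≠ εₜ) : Binds R k α Q :=
  Theory.binds_of_not_free Q fun hf => hα (hQ.free _ _ hf)

namespace Theory

theorem imp_eq {Q : Expr κ oₜ} {α : Ty} {A A' B B' : Expr κ α} (h : T ⊢ₚ (Q ⊃ₑ A =ₑ B))
    (hA : T ⊢ₚ A =ₑ A') (hB : T ⊢ₚ B =ₑ B') : T ⊢ₚ (Q ⊃ₑ A' =ₑ B') :=
  (imp_congr (refl (by simpa using h.lang : _ ∧ _).1) (hA.eq_congr hB)).mp h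

variable (hT : IsRealTheory T)
include hT

/-- Simultaneous substitution of three terms into a law about values of functions. -/
theorem inst_values {t : Fin 3 → Expr κ ιₜ} (ht : ∀ i, T.Lang (t i)) {B : Expr κ oₜ} (h : T ⊢ₚ B)
    (hB : B.IsLaw) (hb : ∀ a, a = fN ∨ a = gN ∨ a = hN →
      Binds (fun _ _ => False) a (ιₜ ⟶ₜ ιₜ) B) :
    T ⊢ₚ sub (functionsS fun i => Expr.lam xN ιₜ (t i)) B :=
  inst_functions hT (k := xN) (fun i => rigid_lam_self (ht i)) (fun i => ht i) h hB fun a ha =>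
    (hb a ha).mono fun _ _ h => h.elim

variable {Q : Expr κ oₜ} (hQ : Q.IsPremise)
include hQ

/-- Transitivity under the premise is proved for f x, g x, h x by completeness. Substituting λx.a,
λx.b, λx.d yields (λx.a)x and the like, which reduce to a, b, d by `beta_same`. The next four lemmas
follow this pattern. -/
theorem cond_trans {a b d : Expr κ ιₜ} (h : T ⊢ₚ (Q ⊃ₑ a =ₑ b)) (h' : T ⊢ₚ (Q ⊃ₑ b =ₑ d)) :
    T ⊢ₚ (Q ⊃ₑ a =ₑ d) := by
  have ha : T.Lang a ∧ T.Lang b := by simpa using h.lang.2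
  have hd : T.Lang d := by simpa using h'.lang.2.2
  have law : T ⊢ₚ ((Q ⊃ₑ fv (ιₜ ⟶ₜ ιₜ) ⬝ xv ιₜ =ₑ gv (ιₜ ⟶ₜ ιₜ) ⬝ xv ιₜ) ⊃ₑ
      (Q ⊃ₑ gv (ιₜ ⟶ₜ ιₜ) ⬝ xv ιₜ =ₑ hv (ιₜ ⟶ₜ ιₜ) ⬝ xv ιₜ) ⊃ₑ
      (Q ⊃ₑ fv (ιₜ ⟶ₜ ιₜ) ⬝ xv ιₜ =ₑ hv (ιₜ ⟶ₜ ιₜ) ⬝ xv ιₜ)) :=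
    completeness hT (by simp [hQ.isLaw]) fun M ρ => by
      simp only [Model.tr_impE, Model.tr_eqE]
      exact fun h h' hq => (h hq).trans (h' hq)
  have key := inst_values hT (t := ![a, b, d]) (by
    intro i; fin_cases i; exacts [ha.1, ha.2, hd]) law (by simp [hQ.isLaw])
    (fun k _ => by simp [impE, eqE, Binds, hQ.binds k, binds_of_not_free])
  simp only [sub, sub_impE, sub_eqE, hQ.sub_functionsS] at key
  simp [functionsS] at key
  exact imp_eq (modus_ponens (modus_ponens key
    (imp_eq h (beta_same a ha.1).symm (beta_same b ha.2).symm))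
    (imp_eq h' (beta_same b ha.2).symm (beta_same d hd).symm)) (beta_same a ha.1) (beta_same d hd)

theorem cond_symm {a b : Expr κ ιₜ} (h : T ⊢ₚ (Q ⊃ₑ a =ₑ b)) : T ⊢ₚ (Q ⊃ₑ b =ₑ a) := by
  have ha : T.Lang a ∧ T.Lang b := by simpa using h.lang.2
  have law : T ⊢ₚ ((Q ⊃ₑ fv (ιₜ ⟶ₜ ιₜ) ⬝ xv ιₜ =ₑ gv (ιₜ ⟶ₜ ιₜ) ⬝ xv ιₜ) ⊃ₑ
      (Q ⊃ₑ gv (ιₜ ⟶ₜ ιₜ) ⬝ xv ιₜ =ₑ fv (ιₜ ⟶ₜ ιₜ) ⬝ xv ιₜ)) :=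
    completeness hT (by simp [hQ.isLaw]) fun M ρ => by
      simp only [Model.tr_impE, Model.tr_eqE]
      exact fun h hq => (h hq).symm
  have key := inst_values hT (t := ![a, b, b]) (by
    intro i; fin_cases i; exacts [ha.1, ha.2, ha.2]) law (by simp [hQ.isLaw])
    (fun k _ => by simp [impE, eqE, Binds, hQ.binds k, binds_of_not_free])
  simp only [sub, sub_impE, sub_eqE, hQ.sub_functionsS] at key
  simp [functionsS] at key
  exact imp_eq (modus_ponens key
    (imp_eq h (beta_same a ha.1).symm (beta_same b ha.2).symm)) (beta_same b ha.2)
      (beta_same a ha.1)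

theorem cond_unary (c : RealConst (ιₜ ⟶ₜ ιₜ)) {a b : Expr κ ιₜ} (h : T ⊢ₚ (Q ⊃ₑ a =ₑ b)) :
    T ⊢ₚ (Q ⊃ₑ rc c ⬝ a =ₑ rc c ⬝ b) := by
  have ha : T.Lang a ∧ T.Lang b := by simpa using h.lang.2
  have hc : T.Lang (rc c) := (pure_rc c).lang hT
  have law : T ⊢ₚ ((Q ⊃ₑ fv (ιₜ ⟶ₜ ιₜ) ⬝ xv ιₜ =ₑ gv (ιₜ ⟶ₜ ιₜ) ⬝ xv ιₜ) ⊃ₑ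
      (Q ⊃ₑ rc c ⬝ (fv (ιₜ ⟶ₜ ιₜ) ⬝ xv ιₜ) =ₑ rc c ⬝ (gv (ιₜ ⟶ₜ ιₜ) ⬝ xv ιₜ))) :=
    completeness hT (by simp [hQ.isLaw]) fun M ρ => by
      simp only [Model.tr_impE, Model.tr_eqE]
      intro h hq
      rw [Model.den_app, h hq, Model.den_app M ρ (rc c)]
  have key := inst_values hT (t := ![a, b, b]) (by
    intro i; fin_cases i; exacts [ha.1, ha.2, ha.2]) law (by simp [hQ.isLaw])
    (fun k _ => by simp [impE, eqE, Binds, hQ.binds k, binds_of_not_free])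
  simp only [sub, sub_impE, sub_eqE, hQ.sub_functionsS] at key
  simp [functionsS] at key
  exact imp_eq (modus_ponens key
    (imp_eq h (beta_same a ha.1).symm (beta_same b ha.2).symm)) ((beta_same a ha.1).appR hc)
      ((beta_same b ha.2).appR hc)

theorem cond_left (c : RealConst (ιₜ ⟶ₜ ιₜ ⟶ₜ ιₜ)) {a b d : Expr κ ιₜ} (h : T ⊢ₚ (Q ⊃ₑ a =ₑ b))
    (hd : T.Lang d) : T ⊢ₚ (Q ⊃ₑ rc c ⬝ a ⬝ d =ₑ rc c ⬝ b ⬝ d) := by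
  have ha : T.Lang a ∧ T.Lang b := by simpa using h.lang.2
  have hc : T.Lang (rc c) := (pure_rc c).lang hT
  have law : T ⊢ₚ ((Q ⊃ₑ fv (ιₜ ⟶ₜ ιₜ) ⬝ xv ιₜ =ₑ gv (ιₜ ⟶ₜ ιₜ) ⬝ xv ιₜ) ⊃ₑ
      (Q ⊃ₑ rc c ⬝ (fv (ιₜ ⟶ₜ ιₜ) ⬝ xv ιₜ) ⬝ (hv (ιₜ ⟶ₜ ιₜ) ⬝ xv ιₜ) =ₑ
        rc c ⬝ (gv (ιₜ ⟶ₜ ιₜ) ⬝ xv ιₜ) ⬝ (hv (ιₜ ⟶ₜ ιₜ) ⬝ xv ιₜ))) :=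
    completeness hT (by simp [hQ.isLaw]) fun M ρ => by
      simp only [Model.tr_impE, Model.tr_eqE]
      intro h hq
      rw [Model.den_app, Model.den_app M ρ (rc c), h hq, ← Model.den_app, ← Model.den_app]
  have key := inst_values hT (t := ![a, b, d]) (by
    intro i; fin_cases i; exacts [ha.1, ha.2, hd]) law (by simp [hQ.isLaw])
    (fun k _ => by simp [impE, eqE, Binds, hQ.binds k, binds_of_not_free])
  simp only [sub, sub_impE, sub_eqE, hQ.sub_functionsS] at key
  simp [functionsS] at key
  exact imp_eq (modus_ponens key
    (imp_eq h (beta_same a ha.1).symm (beta_same b ha.2).symm))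
      (((beta_same a ha.1).appR hc).app (beta_same d hd))
      (((beta_same b ha.2).appR hc).app (beta_same d hd))

theorem cond_right (c : RealConst (ιₜ ⟶ₜ ιₜ ⟶ₜ ιₜ)) {a b d : Expr κ ιₜ} (h : T ⊢ₚ (Q ⊃ₑ a =ₑ b))
    (hd : T.Lang d) : T ⊢ₚ (Q ⊃ₑ rc c ⬝ d ⬝ a =ₑ rc c ⬝ d ⬝ b) := by
  have ha : T.Lang a ∧ T.Lang b := by simpa using h.lang.2
  have hc : T.Lang (rc c) := (pure_rc c).lang hT
  have law : T ⊢ₚ ((Q ⊃ₑ fv (ιₜ ⟶ₜ ιₜ) ⬝ xv ιₜ =ₑ gv (ιₜ ⟶ₜ ιₜ) ⬝ xv ιₜ) ⊃ₑ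
      (Q ⊃ₑ rc c ⬝ (hv (ιₜ ⟶ₜ ιₜ) ⬝ xv ιₜ) ⬝ (fv (ιₜ ⟶ₜ ιₜ) ⬝ xv ιₜ) =ₑ
        rc c ⬝ (hv (ιₜ ⟶ₜ ιₜ) ⬝ xv ιₜ) ⬝ (gv (ιₜ ⟶ₜ ιₜ) ⬝ xv ιₜ))) :=
    completeness hT (by simp [hQ.isLaw]) fun M ρ => by
      simp only [Model.tr_impE, Model.tr_eqE]
      intro h hq
      rw [Model.den_app, h hq, ← Model.den_app]
  have key := inst_values hT (t := ![a, b, d]) (by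
    intro i; fin_cases i; exacts [ha.1, ha.2, hd]) law (by simp [hQ.isLaw])
    (fun k _ => by simp [impE, eqE, Binds, hQ.binds k, binds_of_not_free])
  simp only [sub, sub_impE, sub_eqE, hQ.sub_functionsS] at key
  simp [functionsS] at key
  exact imp_eq (modus_ponens key
    (imp_eq h (beta_same a ha.1).symm (beta_same b ha.2).symm))
      (((beta_same d hd).appR hc).app (beta_same a ha.1))
      (((beta_same d hd).appR hc).app (beta_same b ha.2))

/-- Conditionally equal functions have conditionally equal values, for the closure of the variable
`z` by substitution of zero. -/
theorem cond_app {F G : Expr κ (ιₜ ⟶ₜ ιₜ)} (h : T ⊢ₚ (Q ⊃ₑ F =ₑ G)) {a : Expr κ ιₜ}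
    (ha : T.Lang a) :
    T ⊢ₚ (Q ⊃ₑ Expr.lam zN ιₜ (F ⬝ a) ⬝ zeroE =ₑ Expr.lam zN ιₜ (G ⬝ a) ⬝ zeroE) := by
  have hF : T.Lang F ∧ T.Lang G := by simpa using h.lang.2
  have h0 : T.Lang zeroE := (pure_zeroE).lang hT
  have hR : ∀ {α : Ty} {C : Expr κ α}, T.Lang C → T.Rigid zN ιₜ (Expr.lam zN ιₜ C ⬝ zeroE) :=
    fun hC => (rigid_lam_self hC).app (rigid_of_evalFree trivial (by simp [FreeIn, zeroE]) h0)
  have hR' : ∀ {α : Ty} {C : Expr κ α}, T.Lang C → T.Lang (Expr.lam zN ιₜ C) := fun h => h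
  -- Nothing is known about the effective variables of F and G. In (λz.F)0 and (λz.G)0 the variable
  -- z is noneffective, as `inst_functions` requires, and the premise has free variables of type ε
  -- only, so it is unchanged.
  have h1 : T ⊢ₚ (Q ⊃ₑ Expr.lam zN ιₜ F ⬝ zeroE =ₑ Expr.lam zN ιₜ G ⬝ zeroE) := by
    refine (beta_app (beta_app (beta_not_free (by simp) (by simp) (by simp) h0) (beta_not_free
      hQ.isLaw.1.evalFree (fun hf => by cases hQ.free _ _ hf) (hQ.isLaw.1.lang hT) h0))
      (beta_app (beta_app (beta_const h0 (T.lang_eq _)) (refl ?_)) (refl ?_))).mp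
      (lam_app h zN h0)
    exacts [⟨hF.1, h0⟩, ⟨hF.2, h0⟩]
  have law : T ⊢ₚ ((Q ⊃ₑ fv (ιₜ ⟶ₜ ιₜ) =ₑ gv (ιₜ ⟶ₜ ιₜ)) ⊃ₑ
      (Q ⊃ₑ fv (ιₜ ⟶ₜ ιₜ) ⬝ (hv (ιₜ ⟶ₜ ιₜ) ⬝ zeroE) =ₑ
        gv (ιₜ ⟶ₜ ιₜ) ⬝ (hv (ιₜ ⟶ₜ ιₜ) ⬝ zeroE))) :=
    completeness hT (by simp [hQ.isLaw]) fun M ρ => by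
      simp only [Model.tr_impE, Model.tr_eqE]
      intro h hq
      rw [Model.den_app, h hq, ← Model.den_app]
  have key := inst_functions hT (k := zN) (F := ![Expr.lam zN ιₜ F ⬝ zeroE,
    Expr.lam zN ιₜ G ⬝ zeroE, Expr.lam zN ιₜ a])
    (by intro i; fin_cases i; exacts [hR hF.1, hR hF.2, rigid_lam_self ha])
    (by intro i; fin_cases i; exacts [⟨hF.1, h0⟩, ⟨hF.2, h0⟩, ha]) law (by simp [hQ.isLaw])
    (fun k _ => by simp [impE, eqE, Binds, hQ.binds k, binds_of_not_free, zeroE])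
  simp only [sub, sub_impE, sub_eqE, sub_zeroE, hQ.sub_functionsS] at key
  simp [functionsS] at key
  -- Read backwards, `a4_4` collects ((λz.F)0)((λz.a)0) into (λz.(F a))0.
  exact imp_eq (modus_ponens key h1)
    (beta_app (refl (lang_app (hR' hF.1) h0)) (refl (lang_app (hR' ha) h0))).symm
    (beta_app (refl (lang_app (hR' hF.2) h0)) (refl (lang_app (hR' ha) h0))).symm

/-- Replacement of a term by a conditionally equal term in the argument of the derivative. -/
theorem cond_deriv_left {n : ℕ} (hn : n < paramN) (hind : ∀ (M : Model T) (ρ : M.Env) (d : M.D ιₜ),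
      M.Tr (M.den ρ Q) → M.Tr (M.den (M.up ρ n ιₜ d) Q)) {a b d : Expr κ ιₜ}
    (h : T ⊢ₚ (Q ⊃ₑ a =ₑ b)) (h' : T ⊢ₚ (Q ⊃ₑ derivE (Expr.lam n ιₜ a) =ₑ Expr.lam n ιₜ d)) :
    T ⊢ₚ (Q ⊃ₑ derivE (Expr.lam n ιₜ b) =ₑ Expr.lam n ιₜ d) := by
  have ha : T.Lang a ∧ T.Lang b := by simpa using h.lang.2
  have hd : T.Lang d := (inLang_eqE (inLang_impE.mp h'.lang).2).2
  -- The conditional equation is quantified over `n`, so that f = g follows by extensionality;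
  -- `hind` keeps the premise true while the value of `n` varies.
  have law : T ⊢ₚ (allE n ιₜ (Q ⊃ₑ fv (ιₜ ⟶ₜ ιₜ) ⬝ Expr.var n ιₜ =ₑ gv (ιₜ ⟶ₜ ιₜ) ⬝ Expr.var n ιₜ) ⊃ₑ
      (Q ⊃ₑ derivE (fv (ιₜ ⟶ₜ ιₜ)) =ₑ hv (ιₜ ⟶ₜ ιₜ)) ⊃ₑ
      (Q ⊃ₑ derivE (gv (ιₜ ⟶ₜ ιₜ)) =ₑ hv (ιₜ ⟶ₜ ιₜ))) :=
    completeness hT (by simp [hQ.isLaw, hn]) fun M ρ => by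
      simp only [Model.tr_impE, Model.tr_eqE]
      rw [Model.tr_allE' _ _ hn (by simp [hQ.isLaw, hn])]
      intro h h' hq
      have hfg : M.den ρ (fv (ιₜ ⟶ₜ ιₜ)) = M.den ρ (gv (ιₜ ⟶ₜ ιₜ)) := M.ext fun d => by
        simpa [hind M ρ d hq] using h d
      rw [← h' hq, Model.den_derivE, Model.den_derivE, hfg]
  have key := inst_functions hT (k := n) (F := fun i => Expr.lam n ιₜ (![a, b, d] i))
    (fun i => rigid_lam_self (by fin_cases i; exacts [ha.1, ha.2, hd]))
    (by intro i; fin_cases i; exacts [ha.1, ha.2, hd]) law (by simp [hQ.isLaw, hn])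
    (fun k _ => by simp [impE, eqE, allE, derivE, Binds, hQ.binds k, binds_of_not_free])
  simp only [sub, sub_impE, sub_allE, sub_eqE, derivE, hQ.sub_functionsS, functionsS_up] at key
  simp [functionsS] at key
  exact modus_ponens (modus_ponens key (gen (imp_eq h (beta_same a ha.1).symm
    (beta_same b ha.2).symm) n ιₜ)) h'

/-- Replacement of a term by a conditionally equal term in the value of the derivative. -/
theorem cond_deriv_right {n : ℕ} (hn : n < paramN) (hind : ∀ (M : Model T) (ρ : M.Env) (d : M.D ιₜ),
      M.Tr (M.den ρ Q) → M.Tr (M.den (M.up ρ n ιₜ d) Q)) {a b d : Expr κ ιₜ}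
    (h : T ⊢ₚ (Q ⊃ₑ a =ₑ b)) (h' : T ⊢ₚ (Q ⊃ₑ derivE (Expr.lam n ιₜ d) =ₑ Expr.lam n ιₜ a)) :
    T ⊢ₚ (Q ⊃ₑ derivE (Expr.lam n ιₜ d) =ₑ Expr.lam n ιₜ b) := by
  have ha : T.Lang a ∧ T.Lang b := by simpa using h.lang.2
  have hd : T.Lang d := (inLang_eqE (inLang_impE.mp h'.lang).2).1.2
  have law : T ⊢ₚ (allE n ιₜ (Q ⊃ₑ fv (ιₜ ⟶ₜ ιₜ) ⬝ Expr.var n ιₜ =ₑ gv (ιₜ ⟶ₜ ιₜ) ⬝ Expr.var n ιₜ) ⊃ₑ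
      (Q ⊃ₑ derivE (hv (ιₜ ⟶ₜ ιₜ)) =ₑ fv (ιₜ ⟶ₜ ιₜ)) ⊃ₑ
      (Q ⊃ₑ derivE (hv (ιₜ ⟶ₜ ιₜ)) =ₑ gv (ιₜ ⟶ₜ ιₜ))) :=
    completeness hT (by simp [hQ.isLaw, hn]) fun M ρ => by
      simp only [Model.tr_impE, Model.tr_eqE]
      rw [Model.tr_allE' _ _ hn (by simp [hQ.isLaw, hn])]
      intro h h' hq
      have hfg : M.den ρ (fv (ιₜ ⟶ₜ ιₜ)) = M.den ρ (gv (ιₜ ⟶ₜ ιₜ)) := M.ext fun d => by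
        simpa [hind M ρ d hq] using h d
      rw [h' hq, hfg]
  have key := inst_functions hT (k := n) (F := fun i => Expr.lam n ιₜ (![a, b, d] i))
    (fun i => rigid_lam_self (by fin_cases i; exacts [ha.1, ha.2, hd]))
    (by intro i; fin_cases i; exacts [ha.1, ha.2, hd]) law (by simp [hQ.isLaw, hn])
    (fun k _ => by simp [impE, eqE, allE, derivE, Binds, hQ.binds k, binds_of_not_free])
  simp only [sub, sub_impE, sub_allE, sub_eqE, derivE, hQ.sub_functionsS, functionsS_up] at key
  simp [functionsS] at key
  exact modus_ponens (modus_ponens key (gen (imp_eq h (beta_same a ha.1).symm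
    (beta_same b ha.2).symm) n ιₜ)) h'

end Theory
end CTTqe

namespace CTTqe
variable {κ : Ty → Type u} {T : Theory κ}

/-! ## The interpretation of the constructions by evaluation -/

/-- The function that evaluates constructions, with all relevant variables noneffective. -/
def interpE (n : ℕ) : Expr κ (εₜ ⟶ₜ ιₜ ⟶ₜ ιₜ) :=
  -- The vacuous redex makes w noneffective: it is bound there, and its argument is a quotation. The
  -- variables u and `n` are bound outright.
  Expr.lam uN εₜ (Expr.lam n ιₜ (Expr.lam wN εₜ (Expr.eval ιₜ (uv εₜ)) ⬝ Expr.quote zeroE))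

theorem isPremise_isPolyE {t : Expr κ εₜ} (ht : t.IsLaw) (hf : ∀ n α, FreeIn n α t → α = εₜ) :
    (isPolyE t).IsPremise :=
  ⟨by simpa using ht, fun n α h => h.elim (fun h => h.elim) (hf n α)⟩

theorem isPremise_andE {A B : Expr κ oₜ} (hA : A.IsPremise) (hB : B.IsPremise) :
    (A ∧ₑ B).IsPremise :=
  ⟨by simpa using ⟨hA.isLaw, hB.isLaw⟩, fun n α h => by
    rw [freeIn_andE] at h
    exact h.elim (hA.free n α) (hB.free n α)⟩

theorem isPremise_var (k : ℕ) (hk : k < paramN) :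
    (isPolyE (Expr.var k εₜ) : Expr κ oₜ).IsPremise :=
  isPremise_isPolyE (by simpa using hk) fun _ _ h => h.2.symm

namespace Theory

theorem lang_isExprTE {α : Ty} {A : Expr κ εₜ} (hA : T.Lang A) : T.Lang (isExprTE α A) :=
  ⟨T.logical_mem _ (.isExprT α), hA⟩

theorem lang_isFreeInE {A B : Expr κ εₜ} (hA : T.Lang A) (hB : T.Lang B) :
    T.Lang (isFreeInE A B) := ⟨⟨T.logical_mem _ .isFreeIn, hA⟩, hB⟩

theorem lang_appE {A B : Expr κ εₜ} (hA : T.Lang A) (hB : T.Lang B) :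
    T.Lang (appE A B) := ⟨⟨T.logical_mem _ .app, hA⟩, hB⟩

theorem lang_eval {α : Ty} {A : Expr κ εₜ} (hA : T.Lang A) : T.Lang (Expr.eval α A) := hA

variable (hT : IsRealTheory T)
include hT

/-- Substitution of an argument into the evaluation of a term that reduces to the construction
of a polynomial. -/
theorem beta_eval {k : ℕ} {α : Ty} {B : Expr κ εₜ} {A : Expr κ α} {t : Expr κ εₜ}
    (h : T ⊢ₚ Expr.lam k α B ⬝ A =ₑ t) (ht : t.IsLaw)
    (hx : ((k, α) : ℕ × Ty) ≠ (xN, ιₜ)) (hy : ((k, α) : ℕ × Ty) ≠ (yN, ιₜ)) :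
    T ⊢ₚ (isPolyE t ⊃ₑ Expr.lam k α (Expr.eval ιₜ B) ⬝ A =ₑ Expr.eval ιₜ t) := by
  have hB : T.Lang B := h.left.1
  have hA : T.Lang A := h.left.2
  have hq : T.Lang (Expr.quote (Expr.var k α)) := ⟨trivial, trivial⟩
  have hE : T.Lang (Expr.const (.isExprT ιₜ)) := T.logical_mem _ (.isExprT ιₜ)
  have hF : T.Lang (Expr.const .isFreeIn ⬝ Expr.quote (Expr.var k α)) :=
    ⟨T.logical_mem _ .isFreeIn, hq⟩
  -- These are the premises of `b11_2` once the redex is replaced by `t`. The variable `k` differs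
  -- from x and y of type ι, the only ones that can occur free in a polynomial.
  have law : T ⊢ₚ (isPolyE t ⊃ₑ
      (isExprTE ιₜ t ∧ₑ ¬ₑ isFreeInE (Expr.quote (Expr.var k α)) t)) :=
    completeness hT (by simp [ht]) fun M ρ => by
      simp only [Model.tr_impE, Model.tr_andE, Model.tr_negE, Model.tr_isPolyE, Model.tr_isExprTE,
        Model.tr_isFreeInE, Model.den_quote, Model.quo_var]
      exact fun hp => ⟨M.isExprT_poly hT _ hp, M.not_isFreeIn_poly hT hx hy _ hp⟩
  have hlam : T.Lang (Expr.lam k α B ⬝ A) := ⟨hB, hA⟩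
  have hl : T.Lang (Expr.lam k α (Expr.eval ιₜ B) ⬝ A) := ⟨hB, hA⟩
  have ax := Provable.logic (IsAxiom.b11_2 k α ιₜ B A) (T := T) (by
    exact inLang_impE.mpr ⟨inLang_andE.mpr ⟨lang_isExprTE hlam,
      inLang_negE.mpr (lang_isFreeInE hq hlam)⟩, lang_eqE hl (lang_eval hlam)⟩)
  exact imp_trans law ((imp_congr (and_congr (h.appR hE) (neg_congr (h.appR hF)))
    ((refl hl).eq_congr (h.eval ιₜ))).mp ax)

/-- The argument `t` passes λn because it is eval-free without `n`; the redex that remains has `n`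
itself as its argument. -/
theorem interp_app {n : ℕ} {t : Expr κ εₜ} (ht : T.Lang t) (hE : EvalFree t)
    (hn : ¬ FreeIn n ιₜ t) : T ⊢ₚ interpE n ⬝ t ⬝ Expr.var n ιₜ =ₑ
      Expr.lam uN εₜ (Expr.lam wN εₜ (Expr.eval ιₜ (uv εₜ)) ⬝ Expr.quote zeroE) ⬝ t := by
  have hz : T.Lang (Expr.quote zeroE) := ⟨trivial, pure_zeroE.lang hT⟩
  have hM : T.Lang (Expr.lam wN εₜ (Expr.eval ιₜ (uv εₜ)) ⬝ Expr.quote zeroE) := ⟨trivial, hz⟩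
  exact ((pass_of_evalFree hE hn uN _ (by simp) hM ht).appL (A := Expr.var n ιₜ) trivial).trans
    (beta_same _ ⟨hM, ht⟩)

/-- On constructions of polynomials, the interpretation is the evaluation. -/
theorem interp_eval {n : ℕ} {t : Expr κ εₜ} (ht : t.IsLaw)
    (hf : ∀ n α, FreeIn n α t → α = εₜ) :
    T ⊢ₚ (isPolyE t ⊃ₑ interpE n ⬝ t ⬝ Expr.var n ιₜ =ₑ Expr.eval ιₜ t) := by
  have hL := ht.1.lang hT
  have hz : T.Lang (Expr.quote zeroE) := ⟨trivial, pure_zeroE.lang hT⟩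
  have hP : T.Lang (rc .isPoly) := (pure_rc _).lang hT
  have h1 : T ⊢ₚ (isPolyE (uv εₜ) ⊃ₑ
      Expr.lam wN εₜ (Expr.eval ιₜ (uv εₜ)) ⬝ Expr.quote zeroE =ₑ Expr.eval ιₜ (uv εₜ)) :=
    beta_eval hT (beta_var hz (by simp)) (by simp) (by simp) (by simp)
  have hlam : ∀ {C : Expr κ ιₜ}, T.Lang C → T.Lang (Expr.lam uN εₜ C) := fun h => h
  have hw : T.Lang (Expr.lam wN εₜ (Expr.eval ιₜ (uv εₜ)) ⬝ Expr.quote zeroE) := ⟨trivial, hz⟩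
  -- Instantiation of u by `t`. The two sides stay redexes, since the substitution into the
  -- evaluations is not yet justified.
  have h2 : T ⊢ₚ (isPolyE t ⊃ₑ Expr.lam uN εₜ
      (Expr.lam wN εₜ (Expr.eval ιₜ (uv εₜ)) ⬝ Expr.quote zeroE) ⬝ t =ₑ
      Expr.lam uN εₜ (Expr.eval ιₜ (uv εₜ)) ⬝ t) :=
    (beta_app (beta_app (beta_not_free (by simp) (by simp) (by simp) hL)
      (beta_app (beta_const hL hP) (beta_self hL)))
      (beta_app (beta_app (beta_const hL (T.lang_eq _))
        (refl (lang_app (hlam hw) hL)))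
        (refl (lang_app (hlam (lang_eval (A := uv εₜ) trivial)) hL)))).mp (lam_app h1 uN hL)
  have h3 : T ⊢ₚ (isPolyE t ⊃ₑ Expr.lam uN εₜ (Expr.eval ιₜ (uv εₜ)) ⬝ t =ₑ Expr.eval ιₜ t) :=
    beta_eval hT (beta_self hL) ht (by simp) (by simp)
  exact imp_eq (cond_trans hT (isPremise_isPolyE ht hf) h2 h3)
    (interp_app hT hL ht.1.evalFree fun h => by cases hf _ _ h).symm (refl (lang_eval hL))

theorem interp_var (n : ℕ) {k : ℕ} (hk : k = xN ∨ k = yN) :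
    T ⊢ₚ evalVarE n (interpE n) k := by
  have law : T ⊢ₚ isPolyE (Expr.quote (Expr.var k ιₜ)) :=
    completeness hT (by simp) fun M ρ => by simpa using M.poly_qvar hT hk
  exact gen ((modus_ponens (interp_eval hT (by simp) (by simp [FreeIn])) law).trans
    (Provable.logic (IsAxiom.b10_1 k ιₜ) (lang_eqE ⟨trivial, trivial⟩ trivial))) n ιₜ

theorem eval_const {α : Ty} (c : RealConst α) :
    T ⊢ₚ Expr.eval α (Expr.quote (rc c)) =ₑ rc c := by
  have hc : T.Lang (rc c) := (pure_rc c).lang hT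
  exact Provable.logic (IsAxiom.b10_2 (Const.real c)) (lang_eqE ⟨trivial, hc⟩ hc)

theorem interp_con (n : ℕ) {c : RealConst ιₜ} (hc : ∀ M : Model T, M.poly (M.qcon c)) :
    T ⊢ₚ evalConE n (interpE n) c := by
  have law : T ⊢ₚ isPolyE (Expr.quote (rc c)) :=
    completeness hT (by simp) fun M ρ => by simpa using hc M
  exact gen ((modus_ponens (interp_eval hT (by simp) (by simp [FreeIn])) law).trans
    (eval_const hT c)) n ιₜ

/-- Evaluation of quasiquotations of applications of constants. -/
theorem eval_const_app {Q : Expr κ oₜ} {α : Ty} (c : RealConst (ιₜ ⟶ₜ α)) {t : Expr κ εₜ}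
    (ht : T.Lang t) (h : T ⊢ₚ (Q ⊃ₑ
      (isExprTE (ιₜ ⟶ₜ α) (Expr.quote (rc c)) ∧ₑ isExprTE ιₜ t))) :
    T ⊢ₚ (Q ⊃ₑ Expr.eval α (appE (Expr.quote (rc c)) t) =ₑ rc c ⬝ Expr.eval ιₜ t) := by
  have hc : T.Lang (Expr.quote (rc c)) := ⟨trivial, (pure_rc c).lang hT⟩
  have hl : T.Lang (Expr.eval (ιₜ ⟶ₜ α) (Expr.quote (rc c)) ⬝ Expr.eval ιₜ t) := ⟨hc, ht⟩
  have ha : T.Lang (Expr.eval α (appE (Expr.quote (rc c)) t)) := lang_appE hc ht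
  refine imp_eq (imp_trans h (Provable.logic (IsAxiom.b10_3 ιₜ α (Expr.quote (rc c)) t) ?_))
    (refl ha) ((eval_const hT c).appL (lang_eval ht))
  exact inLang_impE.mpr ⟨inLang_andE.mpr ⟨lang_isExprTE hc, lang_isExprTE ht⟩, lang_eqE ha hl⟩

/-- The chain is E (⊖u) n = ⟦⊖u⟧ = −⟦u⟧ = −(E u n), with `b10_3` for its middle equation. -/
theorem interp_neg (n : ℕ) : T ⊢ₚ evalNegE n (interpE n) := by
  have hQ : (isPolyE (uv εₜ) : Expr κ oₜ).IsPremise := isPremise_var _ (by simp)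
  have law1 : T ⊢ₚ (isPolyE (uv εₜ) ⊃ₑ isPolyE (qMinus (uv εₜ))) :=
    completeness hT (by simp) fun M ρ => by simpa using M.poly_qneg hT
  have law2 : T ⊢ₚ (isPolyE (uv εₜ) ⊃ₑ (isExprTE (ιₜ ⟶ₜ ιₜ) (Expr.quote (rc .minus)) ∧ₑ
      isExprTE ιₜ (uv εₜ))) :=
    completeness hT (by simp) fun M ρ => by
      simpa using fun h => ⟨M.isExprT_qcon hT _, M.isExprT_poly hT _ h⟩
  have h1 := imp_trans law1 (interp_eval hT (n := n) (by simp) (by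
    simp only [qMinus, appE, FreeIn]; tauto))
  have h2 := eval_const_app hT .minus (t := uv εₜ) trivial law2
  have h3 := cond_unary hT hQ .minus (cond_symm hT hQ (interp_eval hT (n := n) (t := uv εₜ)
    (by simp) (by simp only [FreeIn]; tauto)))
  exact gen (gen (cond_trans hT hQ (cond_trans hT hQ h1 h2) h3) n ιₜ) uN εₜ

/-- Here `b10_3` is needed for the whole application and for its function part, of type ι→ι. The
equation for the function part is applied to ⟦w⟧ by `cond_app`, at the price of wrapping both sides
in (λz. ·)0. Therefore the evaluations are carried in the form (λz.⟦s⟧)0, which `b11_2` reduces to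
⟦s⟧ in the end. -/
theorem interp_bin (n : ℕ) {c : RealConst (ιₜ ⟶ₜ ιₜ ⟶ₜ ιₜ)} (hc : ∀ (M : Model T) (a b : M.D εₜ),
    M.poly a → M.poly b → M.poly (M.appc (M.appc (M.qcon c) a) b)) :
    T ⊢ₚ evalBinE n (interpE n) c := by
  have hQ : (isPolyE (uv εₜ) ∧ₑ isPolyE (wv εₜ) : Expr κ oₜ).IsPremise :=
    isPremise_andE (isPremise_var _ (by simp)) (isPremise_var _ (by simp))
  have h0 : T.Lang zeroE := pure_zeroE.lang hT
  have hcL : T.Lang (rc c) := (pure_rc c).lang hT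
  have hcq : T.Lang (Expr.quote (rc c)) := ⟨trivial, hcL⟩
  have hu : T.Lang (uv εₜ) := trivial
  have hw : T.Lang (wv εₜ) := trivial
  have hcu : T.Lang (appE (Expr.quote (rc c)) (uv εₜ)) := lang_appE hcq hu
  set Q : Expr κ oₜ := (isPolyE (uv εₜ) ∧ₑ isPolyE (wv εₜ)) with hQ'
  set t : Expr κ εₜ := appE (appE (Expr.quote (rc c)) (uv εₜ)) (wv εₜ) with ht
  have htL : T.Lang t := lang_appE hcu hw
  have htf : ∀ n α, FreeIn n α t → α = εₜ := by
    simp only [ht, appE, FreeIn]; aesop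
  have htlaw : t.IsLaw := by simp [ht]
  have law1 : T ⊢ₚ (Q ⊃ₑ isPolyE t) :=
    completeness hT (by simp [hQ', htlaw]) fun M ρ => by
      simpa [hQ', ht] using hc M _ _
  have law2 : T ⊢ₚ (Q ⊃ₑ (isExprTE (ιₜ ⟶ₜ ιₜ ⟶ₜ ιₜ) (Expr.quote (rc c)) ∧ₑ
      isExprTE ιₜ (uv εₜ))) :=
    completeness hT (by simp [hQ']) fun M ρ => by
      simpa [hQ'] using fun h _ => ⟨M.isExprT_qcon hT _, M.isExprT_poly hT _ h⟩
  have law3 : T ⊢ₚ (Q ⊃ₑ (isExprTE (ιₜ ⟶ₜ ιₜ) (appE (Expr.quote (rc c)) (uv εₜ)) ∧ₑ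
      isExprTE ιₜ (wv εₜ))) :=
    completeness hT (by simp [hQ']) fun M ρ => by
      simpa [hQ'] using fun h h' => ⟨M.isExprT_appc hT (M.isExprT_qcon hT _)
        (M.isExprT_poly hT _ h), M.isExprT_poly hT _ h'⟩
  have hQu : T ⊢ₚ (Q ⊃ₑ isPolyE (uv εₜ)) :=
    completeness hT (by simp [hQ']) fun M ρ => by simpa [hQ'] using fun h _ => h
  have hQw : T ⊢ₚ (Q ⊃ₑ isPolyE (wv εₜ)) :=
    completeness hT (by simp [hQ']) fun M ρ => by simp [hQ']
  -- the value of the interpretation, with the variable `z` made noneffective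
  have hz : ∀ {s : Expr κ εₜ}, s.IsLaw → EvalFree s → ¬ FreeIn zN ιₜ s → T ⊢ₚ (Q ⊃ₑ isPolyE s) →
      T ⊢ₚ (Q ⊃ₑ Expr.lam zN ιₜ (Expr.eval ιₜ s) ⬝ zeroE =ₑ Expr.eval ιₜ s) :=
    fun hs hE hf hp => imp_trans hp (beta_eval hT (beta_not_free hE hf (hs.1.lang hT) h0) hs
      (by simp) (by simp))
  have hi : ∀ {s : Expr κ εₜ}, s.IsLaw → (∀ n α, FreeIn n α s → α = εₜ) → T ⊢ₚ (Q ⊃ₑ isPolyE s) →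
      T ⊢ₚ (Q ⊃ₑ Expr.lam zN ιₜ (Expr.eval ιₜ s) ⬝ zeroE =ₑ
        interpE n ⬝ s ⬝ Expr.var n ιₜ) := fun hs hf hp =>
    cond_trans hT hQ (hz hs hs.1.evalFree (fun h => by cases hf _ _ h) hp)
      (cond_symm hT hQ (imp_trans hp (interp_eval hT hs hf)))
  have hQL : T.Lang Q := hQ.isLaw.1.lang hT
  have ax := imp_trans law3 (Provable.logic
    (IsAxiom.b10_3 ιₜ ιₜ (appE (Expr.quote (rc c)) (uv εₜ)) (wv εₜ))
    (inLang_impE.mpr ⟨inLang_andE.mpr ⟨lang_isExprTE hcu, lang_isExprTE hw⟩,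
      lang_eqE (lang_eval htL) (lang_app (lang_eval hcu) (lang_eval hw))⟩))
  have hlam : ∀ {C : Expr κ ιₜ}, T.Lang C → T.Lang (Expr.lam zN ιₜ C ⬝ zeroE) := fun h => ⟨h, h0⟩
  have s1 : T ⊢ₚ (Q ⊃ₑ Expr.lam zN ιₜ (Expr.eval ιₜ t) ⬝ zeroE =ₑ
      Expr.lam zN ιₜ (Expr.eval (ιₜ ⟶ₜ ιₜ) (appE (Expr.quote (rc c)) (uv εₜ)) ⬝
        Expr.eval ιₜ (wv εₜ)) ⬝ zeroE) :=
    (beta_app (beta_app (beta_not_free (by simp) (by simp) (by simp) h0) (beta_not_free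
      hQ.isLaw.1.evalFree (fun hf => by cases hQ.free _ _ hf) hQL h0))
      (beta_app (beta_app (beta_const h0 (T.lang_eq _)) (refl (hlam (lang_eval htL))))
        (refl (hlam (lang_app (lang_eval hcu) (lang_eval hw)))))).mp (lam_app ax zN h0)
  have s2 := cond_app hT hQ (eval_const_app hT c hu law2) (a := Expr.eval ιₜ (wv εₜ)) hw
  have s3 : T ⊢ₚ Expr.lam zN ιₜ (rc c ⬝ Expr.eval ιₜ (uv εₜ) ⬝ Expr.eval ιₜ (wv εₜ)) ⬝ zeroE =ₑ
      rc c ⬝ (Expr.lam zN ιₜ (Expr.eval ιₜ (uv εₜ)) ⬝ zeroE) ⬝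
        (Expr.lam zN ιₜ (Expr.eval ιₜ (wv εₜ)) ⬝ zeroE) :=
    beta_app (beta_app (beta_const h0 hcL) (refl (hlam (lang_eval hu))))
      (refl (hlam (lang_eval hw)))
  have s4 := imp_eq (cond_trans hT hQ s1 s2) (refl (hlam (lang_eval htL))) s3
  have iu := hi (s := uv εₜ) (by simp) (fun _ _ h => h.2.symm) hQu
  have iw := hi (s := wv εₜ) (by simp) (fun _ _ h => h.2.symm) hQw
  have it := hi htlaw htf law1
  have hiL := (inLang_eqE (inLang_impE.mp iu.lang).2).2
  have s5 := cond_trans hT hQ (cond_trans hT hQ s4 (cond_left hT hQ c iu (hlam (lang_eval hw))))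
    (cond_right hT hQ c iw hiL)
  exact gen (gen (gen (cond_trans hT hQ (cond_symm hT hQ it) s5) n ιₜ) wN εₜ) uN εₜ

end Theory

theorem sub_evalLawE {n : ℕ} (m : ℕ) (E : Expr κ (εₜ ⟶ₜ ιₜ ⟶ₜ ιₜ)) :
    sub (idS.up fN _ E) (evalLawE n (fv (εₜ ⟶ₜ ιₜ ⟶ₜ ιₜ)) m) = evalLawE n E m := by
  have hm : (idS.up fN _ E).up n ιₜ (Expr.var n ιₜ) (m, ιₜ) = Expr.var m ιₜ := by
    by_cases h : m = n
    · subst h; simp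
    · simp [h, idS]
  simp [hm, evalLawE, evalVarE, evalConE, evalNegE, evalBinE, evalMeaningE, isPolyE, derivE, qMinus,
    appE, minusE, polyDiffE, sub]

/-! ### Transfer of the law to evaluations -/

namespace Theory
variable (hT : IsRealTheory T)
include hT

/-- The listed variables are those whose binders stand over f in `evalLawE`; by `b13` the
interpretation may therefore be substituted there. -/
theorem rigid_interp (n : ℕ) {k : ℕ} {α : Ty}
    (h : (k = n ∧ α = ιₜ) ∨ (k = uN ∧ α = εₜ) ∨ (k = wN ∧ α = εₜ)) :
    T.Rigid k α (interpE n) := by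
  have hz : T.Lang (Expr.quote zeroE) := ⟨trivial, pure_zeroE.lang hT⟩
  have hE : T.Lang (Expr.eval ιₜ (uv εₜ)) := trivial
  have hM : T.Lang (Expr.lam wN εₜ (Expr.eval ιₜ (uv εₜ)) ⬝ Expr.quote zeroE) := ⟨trivial, hz⟩
  have hN : T.Lang (Expr.lam n ιₜ (Expr.lam wN εₜ (Expr.eval ιₜ (uv εₜ)) ⬝ Expr.quote zeroE)) := hM
  rcases h with ⟨rfl, rfl⟩ | ⟨rfl, rfl⟩ | ⟨rfl, rfl⟩
  · exact (rigid_lam_self hM).lam hN _ _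
  · exact rigid_lam_self hN
  · exact (((rigid_lam_self hE).app
      fun _ hA => beta_quote hA hz).lam hM _ _).lam hN _ _

/-- The meaning formula for the interpretation by evaluation. -/
theorem evalMeaning_interp {n : ℕ} (hn : n = xN ∨ n = yN) : T ⊢ₚ evalMeaningE n (interpE n) := by
  obtain ⟨m, hnm⟩ : ∃ m, n = xN ∧ m = yN ∨ n = yN ∧ m = xN := by
    rcases hn with rfl | rfl
    exacts [⟨yN, by simp⟩, ⟨xN, by simp⟩]
  have hn' : n < paramN := by rcases hn with rfl | rfl <;> simp
  have hm : m = xN ∨ m = yN := by tauto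
  have hm' : m < paramN := by rcases hm with rfl | rfl <;> simp
  have hlaw := isLaw_evalLawE (E := (fv (εₜ ⟶ₜ ιₜ ⟶ₜ ιₜ) : Expr κ _)) hn' hm' (by simp)
  have hL : T.Lang (interpE n) := (rigid_interp hT n (Or.inl ⟨rfl, rfl⟩) (Expr.var n ιₜ) trivial).right
  have h := inst (k := fN) hL
    (completeness hT hlaw fun M ρ => M.tr_evalLawE hT hnm ρ) hlaw.1.evalFree (by
      suffices h : Binds (fun k α => (k = n ∧ α = ιₜ) ∨ (k = uN ∧ α = εₜ) ∨ (k = wN ∧ α = εₜ))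
          fN (εₜ ⟶ₜ ιₜ ⟶ₜ ιₜ) (evalLawE n (fv (εₜ ⟶ₜ ιₜ ⟶ₜ ιₜ)) m : Expr κ oₜ) from
        h.mono fun k α hk => (rigid_interp hT n hk).pass
      simp [evalLawE, evalVarE, evalConE, evalNegE, evalBinE, evalMeaningE, impE, andE, allE, eqE,
        Binds, binds_of_not_free, isPolyE, derivE, qMinus, appE, minusE, polyDiffE])
  rw [sub_evalLawE] at h
  exact modus_ponens (modus_ponens (modus_ponens (modus_ponens (modus_ponens (modus_ponens
    (modus_ponens h (interp_var hT n hn)) (interp_var hT n hm))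
    (interp_con hT n fun M => M.poly_zero hT)) (interp_con hT n fun M => M.poly_one hT))
    (interp_neg hT n)) (interp_bin hT n fun M _ _ => M.poly_qadd hT))
    (interp_bin hT n fun M _ _ => M.poly_qmul hT)

end Theory
end CTTqe

/-- The meaning formula for symbolic differentiation of polynomials. -/
theorem mainTheorem5 {κ : CTTqe.Ty → Type u} (T : CTTqe.Theory κ) (hT : CTTqe.IsRealTheory T)
    (n : ℕ) (hn : n = CTTqe.xN ∨ n = CTTqe.yN) :
    T.Provable (CTTqe.meaningFormula n) := by
  open CTTqe CTTqe.Theory in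
  have hn' : n < paramN := by rcases hn with rfl | rfl <;> simp
  have hQ : (isPolyE (uv εₜ) : Expr κ oₜ).IsPremise := isPremise_var _ (by simp)
  have hind : ∀ (M : Model T) (ρ : M.Env) (d : M.D ιₜ), M.Tr (M.den ρ (isPolyE (uv εₜ))) →
      M.Tr (M.den (M.up ρ n ιₜ d) (isPolyE (uv εₜ))) := fun M ρ d => by simp
  have law : T ⊢ₚ (isPolyE (uv εₜ) ⊃ₑ
      isPolyE (polyDiffE (uv εₜ) (Expr.quote (Expr.var n ιₜ)))) :=
    completeness hT (by simp) fun M ρ => by simpa using M.poly_diff hT n _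
  -- The law for the interpretation E speaks of E u n and of E (d u ⌜n⌝) n. Both become evaluations,
  -- the second because the symbolic derivative is again a polynomial.
  exact gen (cond_deriv_right hT hQ hn' hind
    (imp_trans law (interp_eval hT (n := n) (by simp) (by simp only [polyDiffE, FreeIn]; aesop)))
    (cond_deriv_left hT hQ hn' hind (interp_eval hT (n := n) (t := uv εₜ) (by simp)
      fun _ _ h => h.2.symm) (evalMeaning_interp hT hn))) uN εₜ
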